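/- Let $k$ be a field and let $G$ be a finite cyclic group of order $n$. Let $\mathcal R_{kG}$ be the representation (Green) ring of $G$ over $k$: the free abelian group on the isomorphism classes $\{V\}$ of finite-dimensional $kG$-modules modulo the relations $\{V\oplus W\}=\{V\}+\{W\}$, with multiplication $\{V\}\cdot\{W\}=\{V\otimes_k W\}$ (diagonal action). For $H\le G$ let $\operatorname{Ind}_H^G:\mathcal R_{kH}\to\mathcal R_{kG}$ be the additive map $\{V\}\mapsto\{kG\otimes_{kH}V\}$. The sum of the images $\sum_{H<G}\operatorname{Ind}_H^G\mathcal R_{kH}$ over all proper subgroups is an ideal of $\mathcal R_{kG}$; the ring of non-induced representations is $$N_k(G)=\mathcal R_{kG}\Big/\sum_{H<G}\operatorname{Ind}_H^G\mathcal R_{kH}.$$ Let $[r]\in\mathbb Z[X]$ ($r\in\mathbb Z$) be the quantum numbers, $[0]=0$, $[1]=1$, $[r]=X[r-1]-[r-2]$, and write $[r]_x$ for the value of $[r]$ at $X=x$. For a prime $p$ and $\alpha\ge 0$ define polynomials in $\mathbb Z[X_0,\dots,X_{\alpha-1}]$ by $$D_0=1,\qquad D_{j+1}=[p]_{X_j}D_j-[p-1]_{X_j},\qquad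 F_j=(X_j-2D_j)\,[p]_{X_j}.$$ **Theorem.** (1) Suppose that $k$ has characteristic $p>0$, that $n=m\,p^\alpha$ with $p\nmid m$ and $\alpha\ge 0$, and that $k$ contains a primitive $m$-th root of unity (for example, $k$ is algebraically closed, or $m=1$). Then there are ring isomorphisms $$N_k(G)\;\cong\;\frac{\mathbb Z[Y]}{(\Phi_m(Y))}\otimes_{\mathbb Z}\frac{\mathbb Z[X_0,\dots,X_{\alpha-1}]}{([p]_{X_0},F_1,\dots,F_{\alpha-1})}\;\cong\;\frac{\mathbb Z[X_0,\dots,X_{\alpha-1},Y]}{(\Phi_m(Y),[p]_{X_0},F_1,\dots,F_{\alpha-1})},$$ where $\Phi_m$ is the $m$-th cyclotomic polynomial (for $\alpha=0$ there are no variables $X_i$ and no relations $[p]_{X_0},F_j$). In particular $\operatorname{rank}_{\mathbb Z}N_k(G)=\varphi(m)\,\varphi(p^\alpha)=\varphi(n)$. (2) If $k$ has characteristic $0$ and contains a primitive $n$-th root of unity, then likewise $\operatorname{rank}_{\mathbb Z}N_k(G)=\varphi(n)$. So the rank does not depend on the characteristic. -/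

import Mathlib

open scoped TensorProduct Polynomial

universe u v

/-! ### Auxiliary facts on induced representations and tensor products -/

namespace IndAux

open Representation

section lift

variable {k G H A B : Type*} [CommRing k] [Group G] [Group H] (φ : G →* H)
  [AddCommGroup A] [Module k A] (ρ : Representation k G A)
  [AddCommGroup B] [Module k B]

/-- The map `a ↦ ⟦h ⊗ a⟧`. -/
noncomputable def mk (h : H) : A →ₗ[k] IndV φ ρ := IndV.mk φ ρ h

theorem ind_mk (h₁ h₂ : H) (a : A) : ind φ ρ h₁ (mk φ ρ h₂ a) = mk φ ρ (h₂ * h₁⁻¹) a :=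
  Representation.ind_mk φ ρ h₁ h₂ a

/-- Linear maps out of an induced representation. -/
noncomputable def lift (f : H → A →ₗ[k] B) (hf : ∀ g h a, f (φ g * h) (ρ g a) = f h a) :
    IndV φ ρ →ₗ[k] B :=
  Coinvariants.lift _
    (TensorProduct.lift ((Finsupp.lift (A →ₗ[k] B) k H f) ∘ₗ
      (MonoidAlgebra.coeffLinearEquiv k).toLinearMap))
    fun g => by
      ext h a
      simp only [LinearMap.coe_comp, Function.comp_apply, MonoidAlgebra.lsingle_apply]
      simp [hf]

theorem lift_mk (f : H → A →ₗ[k] B) (hf : ∀ g h a, f (φ g * h) (ρ g a) = f h a) (h : H) (a : A) :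
    lift φ ρ f hf (mk φ ρ h a) = f h a := by
  simp [lift, mk]

theorem mk_mul (g : G) (h : H) (a : A) : mk φ ρ (φ g * h) (ρ g a) = mk φ ρ h a := by
  have := Coinvariants.mk_self_apply
    (Representation.tprod (MonoidHom.comp (leftRegular k H) φ) ρ) g
    ((MonoidAlgebra.single h (1 : k)) ⊗ₜ[k] a)
  simpa [mk] using this

theorem induction_on {P : IndV φ ρ → Prop} (x : IndV φ ρ) (hm : ∀ h a, P (mk φ ρ h a))
    (ha : ∀ x y, P x → P y → P (x + y)) : P x := by
  have h0 : P 0 := by simpa using hm 1 0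
  induction x using Coinvariants.induction_on with
  | h x =>
    induction x using TensorProduct.induction_on with
    | zero => simpa using h0
    | add x y hx hy => rw [map_add]; exact ha _ _ hx hy
    | tmul x a =>
      induction x using MonoidAlgebra.induction_linear with
      | zero => simpa using h0
      | add x y hx hy => rw [TensorProduct.add_tmul, map_add]; exact ha _ _ hx hy
      | single h c =>
        have : (MonoidAlgebra.single h c : MonoidAlgebra k H) ⊗ₜ[k] a
            = MonoidAlgebra.single h 1 ⊗ₜ[k] (c • a) := by
          rw [← TensorProduct.smul_tmul, MonoidAlgebra.smul_single, smul_eq_mul, mul_one]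
        rw [this]
        exact hm h (c • a)

end lift

section maps

variable {k G H A B C : Type*} [CommRing k] [Group G] [Group H] (φ : G →* H)
  [AddCommGroup A] [Module k A] (ρ : Representation k G A)
  [AddCommGroup B] [Module k B] (σ : Representation k G B)
  [AddCommGroup C] [Module k C] (τ : Representation k H C)

/-- Functoriality of induction. -/
noncomputable def map (f : A →ₗ[k] B) (hf : ∀ g a, f (ρ g a) = σ g (f a)) :
    IndV φ ρ →ₗ[k] IndV φ σ :=
  lift φ ρ (fun h => mk φ σ h ∘ₗ f) fun g h a => by
    rw [LinearMap.comp_apply, hf, mk_mul, LinearMap.comp_apply]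

theorem map_mk (f : A →ₗ[k] B) (hf : ∀ g a, f (ρ g a) = σ g (f a)) (h : H) (a : A) :
    map φ ρ σ f hf (mk φ ρ h a) = mk φ σ h (f a) :=
  lift_mk ..

theorem map_ind (f : A →ₗ[k] B) (hf : ∀ g a, f (ρ g a) = σ g (f a)) (h : H) (x : IndV φ ρ) :
    map φ ρ σ f hf (ind φ ρ h x) = ind φ σ h (map φ ρ σ f hf x) := by
  induction x using induction_on φ ρ with
  | hm h' a => rw [ind_mk, map_mk, map_mk, ind_mk]
  | ha x y hx hy => simp only [map_add, hx, hy]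

/-- Isomorphic representations induce isomorphic representations. -/
noncomputable def congr (e : A ≃ₗ[k] B) (he : ∀ g a, e (ρ g a) = σ g (e a)) :
    IndV φ ρ ≃ₗ[k] IndV φ σ :=
  have he' : ∀ g b, e.symm (σ g b) = ρ g (e.symm b) := fun g b => by
    rw [LinearEquiv.symm_apply_eq, he, LinearEquiv.apply_symm_apply]
  { map φ ρ σ e he with
    invFun := map φ σ ρ e.symm he'
    left_inv := fun x => by
      change map φ σ ρ e.symm he' (map φ ρ σ e he x) = x
      induction x using induction_on φ ρ with
      | hm h a =>
        rw [map_mk, map_mk, LinearEquiv.coe_coe, LinearEquiv.coe_coe, LinearEquiv.symm_apply_apply]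
      | ha x y hx hy => rw [map_add, map_add, hx, hy]
    right_inv := fun x => by
      change map φ ρ σ e he (map φ σ ρ e.symm he' x) = x
      induction x using induction_on φ σ with
      | hm h a =>
        rw [map_mk, map_mk, LinearEquiv.coe_coe, LinearEquiv.coe_coe, LinearEquiv.apply_symm_apply]
      | ha x y hx hy => rw [map_add, map_add, hx, hy] }

/-- Induction commutes with direct sums. -/
noncomputable def sumEquiv : IndV φ (ρ.prod σ) ≃ₗ[k] IndV φ ρ × IndV φ σ :=
  have h₁ : ∀ g (a : A × B), LinearMap.fst k A B (ρ.prod σ g a) = ρ g (LinearMap.fst k A B a) :=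
    fun _ _ => rfl
  have h₂ : ∀ g (a : A × B), LinearMap.snd k A B (ρ.prod σ g a) = σ g (LinearMap.snd k A B a) :=
    fun _ _ => rfl
  have h₃ : ∀ g a, LinearMap.inl k A B (ρ g a) = ρ.prod σ g (LinearMap.inl k A B a) :=
    fun g a => Prod.ext rfl (map_zero (σ g)).symm
  have h₄ : ∀ g a, LinearMap.inr k A B (σ g a) = ρ.prod σ g (LinearMap.inr k A B a) :=
    fun g a => Prod.ext (map_zero (ρ g)).symm rfl
  { LinearMap.prod (map φ (ρ.prod σ) ρ _ h₁) (map φ (ρ.prod σ) σ _ h₂) with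
    invFun := fun y => map φ ρ (ρ.prod σ) _ h₃ y.1 + map φ σ (ρ.prod σ) _ h₄ y.2
    left_inv := fun x => by
      change map φ ρ (ρ.prod σ) _ h₃ (map φ (ρ.prod σ) ρ _ h₁ x)
        + map φ σ (ρ.prod σ) _ h₄ (map φ (ρ.prod σ) σ _ h₂ x) = x
      induction x using induction_on φ (ρ.prod σ) with
      | hm h a =>
        rw [map_mk, map_mk, map_mk, map_mk, ← map_add]
        exact congrArg _ (Prod.ext (add_zero a.1) (zero_add a.2))
      | ha x y hx hy =>
        conv_rhs => rw [← hx, ← hy]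
        simp only [map_add]
        abel
    right_inv := fun y => by
      obtain ⟨y, z⟩ := y
      have e₁ : map φ (ρ.prod σ) ρ _ h₁ (map φ ρ (ρ.prod σ) _ h₃ y) = y := by
        induction y using induction_on φ ρ with
        | hm h a => rw [map_mk, map_mk]; rfl
        | ha x y hx hy => rw [map_add, map_add, hx, hy]
      have e₂ : map φ (ρ.prod σ) ρ _ h₁ (map φ σ (ρ.prod σ) _ h₄ z) = 0 := by
        induction z using induction_on φ σ with
        | hm h a => rw [map_mk, map_mk]; exact map_zero _
        | ha x y hx hy => rw [map_add, map_add, hx, hy, add_zero]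
      have e₃ : map φ (ρ.prod σ) σ _ h₂ (map φ ρ (ρ.prod σ) _ h₃ y) = 0 := by
        clear e₁
        induction y using induction_on φ ρ with
        | hm h a => rw [map_mk, map_mk]; exact map_zero _
        | ha x y hx hy => rw [map_add, map_add, hx, hy, add_zero]
      have e₄ : map φ (ρ.prod σ) σ _ h₂ (map φ σ (ρ.prod σ) _ h₄ z) = z := by
        clear e₂
        induction z using induction_on φ σ with
        | hm h a => rw [map_mk, map_mk]; rfl
        | ha x y hx hy => rw [map_add, map_add, hx, hy]
      refine Prod.ext ?_ ?_
      · change map φ (ρ.prod σ) ρ _ h₁ (_ + _) = y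
        rw [map_add, e₁, e₂, add_zero]
      · change map φ (ρ.prod σ) σ _ h₂ (_ + _) = z
        rw [map_add, e₃, e₄, zero_add] }

theorem sumEquiv_ind (h : H) (x : IndV φ (ρ.prod σ)) :
    sumEquiv φ ρ σ (ind φ (ρ.prod σ) h x)
      = ((ind φ ρ).prod (ind φ σ)) h (sumEquiv φ ρ σ x) :=
  Prod.ext (map_ind ..) (map_ind ..)

/-- `⟦h ⊗ a⟧ ⊗ c ↦ ⟦h ⊗ (a ⊗ h c)⟧` -/
noncomputable def tensorTo : IndV φ ρ ⊗[k] C →ₗ[k] IndV φ (ρ.tprod (τ.comp φ)) :=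
  TensorProduct.lift (lift φ ρ
    (fun h => ((TensorProduct.mk k A C).compl₂ (τ h)).compr₂ (mk φ (ρ.tprod (τ.comp φ)) h))
    fun g h a => LinearMap.ext fun c => by
      have := mk_mul φ (ρ.tprod (τ.comp φ)) g h (a ⊗ₜ[k] (τ h c))
      rw [Representation.tprod_apply, TensorProduct.map_tmul] at this
      rw [LinearMap.compr₂_apply, LinearMap.compl₂_apply, TensorProduct.mk_apply, map_mul]
      exact this)

theorem tensorTo_mk (h : H) (a : A) (c : C) :
    tensorTo φ ρ τ (mk φ ρ h a ⊗ₜ[k] c) = mk φ (ρ.tprod (τ.comp φ)) h (a ⊗ₜ[k] τ h c) := by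
  rw [tensorTo, TensorProduct.lift.tmul, lift_mk]
  rfl

/-- `⟦h ⊗ (a ⊗ c)⟧ ↦ ⟦h ⊗ a⟧ ⊗ h⁻¹ c` -/
noncomputable def tensorFrom : IndV φ (ρ.tprod (τ.comp φ)) →ₗ[k] IndV φ ρ ⊗[k] C :=
  lift φ (ρ.tprod (τ.comp φ)) (fun h => TensorProduct.map (mk φ ρ h) (τ h⁻¹)) fun g h x => by
    induction x using TensorProduct.induction_on with
    | zero => simp only [map_zero]
    | add x y hx hy => simp only [map_add, hx, hy]
    | tmul a c =>
      rw [Representation.tprod_apply, TensorProduct.map_tmul, TensorProduct.map_tmul,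
        TensorProduct.map_tmul, mk_mul, mul_inv_rev, map_mul, MonoidHom.comp_apply,
        Module.End.mul_apply, inv_self_apply]

theorem tensorFrom_mk (h : H) (a : A) (c : C) :
    tensorFrom φ ρ τ (mk φ (ρ.tprod (τ.comp φ)) h (a ⊗ₜ[k] c)) = mk φ ρ h a ⊗ₜ[k] τ h⁻¹ c := by
  rw [tensorFrom, lift_mk, TensorProduct.map_tmul]

/-- The projection formula `Ind A ⊗ C ≅ Ind (A ⊗ Res C)`. -/
noncomputable def tensorEquiv :
    IndV φ ρ ⊗[k] C ≃ₗ[k] IndV φ (ρ.tprod (τ.comp φ)) :=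
  { tensorTo φ ρ τ with
    invFun := tensorFrom φ ρ τ
    left_inv := fun x => by
      change tensorFrom φ ρ τ (tensorTo φ ρ τ x) = x
      induction x using TensorProduct.induction_on with
      | zero => simp only [map_zero]
      | add x y hx hy => rw [map_add, map_add, hx, hy]
      | tmul x c =>
        induction x using induction_on φ ρ with
        | ha x y hx hy => rw [TensorProduct.add_tmul, map_add, map_add, hx, hy]
        | hm h a => rw [tensorTo_mk, tensorFrom_mk, inv_self_apply]
    right_inv := fun x => by
      change tensorTo φ ρ τ (tensorFrom φ ρ τ x) = x
      induction x using induction_on φ _ with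
      | ha x y hx hy => rw [map_add, map_add, hx, hy]
      | hm h x =>
        induction x using TensorProduct.induction_on with
        | zero => simp only [map_zero]
        | add x y hx hy => rw [map_add, map_add, map_add, hx, hy]
        | tmul a c => rw [tensorFrom_mk, tensorTo_mk, self_inv_apply] }

theorem tensorEquiv_ind (h : H) (x : IndV φ ρ ⊗[k] C) :
    tensorEquiv φ ρ τ (((ind φ ρ).tprod τ) h x)
      = ind φ (ρ.tprod (τ.comp φ)) h (tensorEquiv φ ρ τ x) := by
  change tensorTo φ ρ τ _ = ind φ _ h (tensorTo φ ρ τ x)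
  induction x using TensorProduct.induction_on with
  | zero => simp only [map_zero]
  | add x y hx hy => simp only [map_add, hx, hy]
  | tmul x c =>
    rw [Representation.tprod_apply, TensorProduct.map_tmul]
    induction x using induction_on φ ρ with
    | ha x y hx hy => simp only [TensorProduct.add_tmul, map_add, hx, hy]
    | hm h' a =>
      rw [ind_mk, tensorTo_mk, tensorTo_mk, ind_mk,
        ← Module.End.mul_apply, ← map_mul, inv_mul_cancel_right]

end maps

section tensor

variable {k G A A' B B' C : Type*} [Field k] [Group G]
  [AddCommGroup A] [Module k A] {ρ : Representation k G A}
  [AddCommGroup A'] [Module k A'] {ρ' : Representation k G A'}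
  [AddCommGroup B] [Module k B] {σ : Representation k G B}
  [AddCommGroup B'] [Module k B'] {σ' : Representation k G B'}
  [AddCommGroup C] [Module k C] {τ : Representation k G C}

theorem tprod_congr (e : ρ.Equiv ρ') (f : σ.Equiv σ') :
    Nonempty ((ρ.tprod σ).Equiv (ρ'.tprod σ')) :=
  ⟨.mk (TensorProduct.congr e.toLinearEquiv f.toLinearEquiv)
    (e.toIntertwiningMap.tensor f.toIntertwiningMap).isIntertwining'⟩

theorem tprod_prod : Nonempty ((ρ.tprod (σ.prod τ)).Equiv ((ρ.tprod σ).prod (ρ.tprod τ))) :=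
  ⟨.mk (TensorProduct.prodRight k k A B C) fun g => TensorProduct.ext' fun a b => by simp⟩

theorem trivial_ulift :
    Nonempty ((trivial k G (ULift k)).Equiv (trivial k G k)) :=
  ⟨.mk ULift.moduleEquiv fun _ => rfl⟩

end tensor

end IndAux

/-! ### Finite-dimensional representations up to isomorphism -/

/-- A finite-dimensional representation of `G` over the field `k`, i.e. a finite-dimensional
`kG`-module. -/
structure FinRep (k : Type u) (G : Type v) [Field k] [Group G] where
  /-- the underlying space -/
  V : Type (max u v)
  [addCommGroup : AddCommGroup V]
  [module : Module k V]
  [finite : Module.Finite k V]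
  /-- the action of the group -/
  ρ : Representation k G V

attribute [instance] FinRep.addCommGroup FinRep.module FinRep.finite

namespace FinRep

variable {k : Type u} {G : Type v} [Field k] [Group G]

/-- Isomorphism of representations. -/
instance setoid (k : Type u) (G : Type v) [Field k] [Group G] : Setoid (FinRep k G) where
  r A B := Nonempty (A.ρ.Equiv B.ρ)
  iseqv :=
    { refl := fun A => ⟨.refl A.ρ⟩
      symm := fun ⟨e⟩ => ⟨e.symm⟩
      trans := fun ⟨e⟩ ⟨f⟩ => ⟨e.trans f⟩ }

/-- The direct sum `A ⊕ B`. -/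
noncomputable def sum (A B : FinRep k G) : FinRep k G := ⟨A.V × B.V, A.ρ.prod B.ρ⟩

/-- The tensor product `A ⊗ₖ B` with the diagonal action. -/
noncomputable def tensor (A B : FinRep k G) : FinRep k G := ⟨A.V ⊗[k] B.V, A.ρ.tprod B.ρ⟩

/-- The one-dimensional trivial representation. -/
noncomputable def triv (k : Type u) (G : Type v) [Field k] [Group G] : FinRep k G :=
  ⟨ULift.{v} k, Representation.trivial k G (ULift.{v} k)⟩

/-- The representation of `G` induced from a representation of a subgroup `H`. -/
noncomputable def ind [Finite G] (H : Subgroup G) (A : FinRep k H) : FinRep k G :=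
  haveI : Module.Finite k (MonoidAlgebra k G) :=
    Module.Finite.equiv (MonoidAlgebra.coeffLinearEquiv k (S := k) (M := G)).symm
  ⟨Representation.IndV H.subtype A.ρ, Representation.ind H.subtype A.ρ⟩

/-- The restriction of a representation of `G` to a subgroup `H`. -/
noncomputable def res (H : Subgroup G) (A : FinRep k G) : FinRep k H :=
  ⟨A.V, A.ρ.comp H.subtype⟩

theorem equiv_of {A B : FinRep k G} (e : A.V ≃ₗ[k] B.V)
    (he : ∀ g x, e (A.ρ g x) = B.ρ g (e x)) : A ≈ B :=
  ⟨.mk e fun g => LinearMap.ext (he g)⟩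

theorem exists_of_equiv {A B : FinRep k G} (h : A ≈ B) :
    ∃ e : A.V ≃ₗ[k] B.V, ∀ g x, e (A.ρ g x) = B.ρ g (e x) := by
  obtain ⟨e⟩ := h
  exact ⟨e.toLinearEquiv, fun g x => LinearMap.congr_fun (e.isIntertwining' g) x⟩

theorem sum_congr {A A' B B' : FinRep k G} (hA : A ≈ A') (hB : B ≈ B') :
    A.sum B ≈ A'.sum B' := by
  obtain ⟨e, he⟩ := exists_of_equiv hA
  obtain ⟨f, hf⟩ := exists_of_equiv hB
  exact equiv_of (A := A.sum B) (B := A'.sum B') (e.prodCongr f)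
    fun g x => Prod.ext (he g x.1) (hf g x.2)

theorem tensor_congr {A A' B B' : FinRep k G} (hA : A ≈ A') (hB : B ≈ B') :
    A.tensor B ≈ A'.tensor B' := by
  obtain ⟨e⟩ := hA
  obtain ⟨f⟩ := hB
  exact IndAux.tprod_congr e f

theorem tensor_comm (A B : FinRep k G) : A.tensor B ≈ B.tensor A :=
  ⟨Representation.TensorProduct.comm A.ρ B.ρ⟩

theorem tensor_assoc (A B C : FinRep k G) :
    (A.tensor B).tensor C ≈ A.tensor (B.tensor C) :=
  ⟨Representation.TensorProduct.assoc A.ρ B.ρ C.ρ⟩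

theorem triv_tensor (A : FinRep k G) : (triv k G).tensor A ≈ A := by
  obtain ⟨e⟩ := IndAux.trivial_ulift.{u, v, v} (k := k) (G := G)
  obtain ⟨f⟩ := IndAux.tprod_congr e (Representation.Equiv.refl A.ρ)
  exact ⟨f.trans (Representation.TensorProduct.lid k A.ρ)⟩

theorem tensor_sum (A B C : FinRep k G) :
    A.tensor (B.sum C) ≈ (A.tensor B).sum (A.tensor C) := IndAux.tprod_prod

theorem ind_congr [Finite G] (H : Subgroup G) {A B : FinRep k H} (h : A ≈ B) :
    A.ind H ≈ B.ind H := by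
  obtain ⟨e, he⟩ := exists_of_equiv h
  exact ⟨.mk (IndAux.congr H.subtype A.ρ B.ρ e he)
    fun g => LinearMap.ext fun x => IndAux.map_ind H.subtype A.ρ B.ρ e.toLinearMap he g x⟩

theorem ind_sum [Finite G] (H : Subgroup G) (A B : FinRep k H) :
    (A.sum B).ind H ≈ (A.ind H).sum (B.ind H) :=
  ⟨.mk (IndAux.sumEquiv H.subtype A.ρ B.ρ)
    fun g => LinearMap.ext fun x => IndAux.sumEquiv_ind H.subtype A.ρ B.ρ g x⟩

theorem ind_tensor_res [Finite G] (H : Subgroup G) (A : FinRep k H) (B : FinRep k G) :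
    (A.ind H).tensor B ≈ (A.tensor (B.res H)).ind H :=
  ⟨.mk (IndAux.tensorEquiv H.subtype A.ρ B.ρ)
    fun g => LinearMap.ext fun x => IndAux.tensorEquiv_ind H.subtype A.ρ B.ρ g x⟩

end FinRep

/-- Isomorphism classes of finite-dimensional representations of `G` over `k`. -/
def RepClass (k : Type u) (G : Type v) [Field k] [Group G] : Type (max u v + 1) :=
  Quotient (FinRep.setoid k G)

namespace RepClass

variable {k : Type u} {G : Type v} [Field k] [Group G]

/-- The isomorphism class of a representation. -/
def mk (A : FinRep k G) : RepClass k G := Quotient.mk _ A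

theorem mk_eq {A B : FinRep k G} : mk A = mk B ↔ A ≈ B := Quotient.eq

/-- `{A} + {B} = {A ⊕ B}` -/
noncomputable instance : Add (RepClass k G) :=
  ⟨Quotient.map₂ FinRep.sum fun _ _ hA _ _ hB => FinRep.sum_congr hA hB⟩

/-- `{A} * {B} = {A ⊗ B}` -/
noncomputable instance : CommMonoid (RepClass k G) where
  mul := Quotient.map₂ FinRep.tensor fun _ _ hA _ _ hB => FinRep.tensor_congr hA hB
  one := mk (FinRep.triv k G)
  mul_comm := by rintro ⟨A⟩ ⟨B⟩; exact Quotient.sound (FinRep.tensor_comm A B)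
  mul_assoc := by rintro ⟨A⟩ ⟨B⟩ ⟨C⟩; exact Quotient.sound (FinRep.tensor_assoc A B C)
  one_mul := by rintro ⟨A⟩; exact Quotient.sound (FinRep.triv_tensor A)
  mul_one := by
    rintro ⟨A⟩
    exact Quotient.sound (Setoid.trans (FinRep.tensor_comm A _) (FinRep.triv_tensor A))

theorem mk_add (A B : FinRep k G) : mk A + mk B = mk (A.sum B) := rfl

theorem mk_mul (A B : FinRep k G) : mk A * mk B = mk (A.tensor B) := rfl

theorem one_eq : (1 : RepClass k G) = mk (FinRep.triv k G) := rfl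

theorem mul_add' (a b c : RepClass k G) : a * (b + c) = a * b + a * c := by
  induction a using Quotient.ind
  induction b using Quotient.ind
  induction c using Quotient.ind
  exact Quotient.sound (FinRep.tensor_sum _ _ _)

/-- Induction on isomorphism classes. -/
noncomputable def ind [Finite G] (H : Subgroup G) : RepClass k H → RepClass k G :=
  Quotient.map (FinRep.ind H) fun _ _ h => FinRep.ind_congr H h

theorem ind_mk [Finite G] (H : Subgroup G) (A : FinRep k H) : ind H (mk A) = mk (A.ind H) := rfl

/-- Restriction on isomorphism classes. -/
noncomputable def res (H : Subgroup G) : RepClass k G → RepClass k H :=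
  Quotient.map (FinRep.res H) fun _ _ h => by
    obtain ⟨e, he⟩ := FinRep.exists_of_equiv h
    exact FinRep.equiv_of (A := FinRep.res H _) (B := FinRep.res H _) e fun g x => he g x

theorem ind_add [Finite G] (H : Subgroup G) (a b : RepClass k H) :
    ind H (a + b) = ind H a + ind H b := by
  induction a using Quotient.ind
  induction b using Quotient.ind
  exact Quotient.sound (FinRep.ind_sum H _ _)

theorem ind_mul [Finite G] (H : Subgroup G) (a : RepClass k H) (b : RepClass k G) :
    ind H a * b = ind H (a * res H b) := by
  induction a using Quotient.ind
  induction b using Quotient.ind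
  exact Quotient.sound (FinRep.ind_tensor_res H _ _)

end RepClass

/-! ### The representation ring -/

/-- The ideal of the relations `{A ⊕ B} = {A} + {B}` in the free abelian group on the isomorphism
classes, which is a ring with the tensor product as multiplication. -/
noncomputable def sumRelations (k : Type u) (G : Type v) [Field k] [Group G] :
    Ideal (MonoidAlgebra ℤ (RepClass k G)) :=
  Ideal.span {x | ∃ a b : RepClass k G,
    x = MonoidAlgebra.of ℤ _ (a + b) - MonoidAlgebra.of ℤ _ a - MonoidAlgebra.of ℤ _ b}

/-- The representation ring (Green ring) of `G` over `k`: the free abelian group on the isomorphism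
classes of finite-dimensional representations modulo `{A ⊕ B} = {A} + {B}`, with multiplication
`{A} * {B} = {A ⊗ B}`. -/
abbrev RepRing (k : Type u) (G : Type v) [Field k] [Group G] : Type (max u v + 1) :=
  MonoidAlgebra ℤ (RepClass k G) ⧸ sumRelations k G

namespace RepRing

variable {k : Type u} {G : Type v} [Field k] [Group G]

/-- The element of the representation ring given by an isomorphism class. -/
noncomputable def of : RepClass k G →* RepRing k G :=
  (Ideal.Quotient.mk (sumRelations k G)).toMonoidHom.comp (MonoidAlgebra.of ℤ (RepClass k G))

theorem of_add (a b : RepClass k G) : of (a + b) = of a + of b := by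
  have h : Ideal.Quotient.mk (sumRelations k G)
      (MonoidAlgebra.of ℤ _ (a + b) - MonoidAlgebra.of ℤ _ a - MonoidAlgebra.of ℤ _ b) = 0 :=
    Ideal.Quotient.eq_zero_iff_mem.2 (Ideal.subset_span ⟨a, b, rfl⟩)
  rw [map_sub, map_sub, sub_sub, sub_eq_zero] at h
  exact h

theorem addHom_ext {M : Type*} [AddCommGroup M] {f g : RepRing k G →+ M}
    (h : ∀ a, f (of a) = g (of a)) : f = g := by
  ext x
  obtain ⟨x, rfl⟩ := Ideal.Quotient.mk_surjective x
  induction x using MonoidAlgebra.induction_linear with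
  | zero => simp
  | add x y hx hy => rw [map_add, map_add, map_add, hx, hy]
  | single a n =>
    have : (MonoidAlgebra.single a n : MonoidAlgebra ℤ (RepClass k G))
        = n • MonoidAlgebra.of ℤ _ a := by simp
    rw [this, map_zsmul, map_zsmul, map_zsmul]
    exact congrArg _ (h a)

/-- The additive extension to the free abelian group. -/
noncomputable def preLift {M : Type*} [AddCommGroup M] (f : RepClass k G → M) :
    MonoidAlgebra ℤ (RepClass k G) →+ M :=
  ((Finsupp.lift M ℤ (RepClass k G) f) ∘ₗ
    (MonoidAlgebra.coeffLinearEquiv ℤ).toLinearMap).toAddMonoidHom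

theorem preLift_of {M : Type*} [AddCommGroup M] (f : RepClass k G → M) (a : RepClass k G) :
    preLift f (MonoidAlgebra.of ℤ _ a) = f a := by
  simp [preLift]

theorem preLift_eq_zero {M : Type*} [AddCommGroup M] (f : RepClass k G → M)
    (hf : ∀ a b, f (a + b) = f a + f b) {x : MonoidAlgebra ℤ (RepClass k G)}
    (hx : x ∈ sumRelations k G) : preLift f x = 0 := by
  suffices H : ∀ y, preLift f (y * x) = 0 by simpa using H 1
  refine Submodule.span_induction (p := fun x _ => ∀ y, preLift f (y * x) = 0)
    ?_ ?_ ?_ ?_ hx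
  · rintro _ ⟨a, b, rfl⟩ y
    induction y using MonoidAlgebra.induction_linear with
    | zero => simp
    | add y z hy hz => rw [add_mul, map_add, hy, hz, add_zero]
    | single c n =>
      have : (MonoidAlgebra.single c n : MonoidAlgebra ℤ (RepClass k G))
          = n • MonoidAlgebra.of ℤ _ c := by simp
      rw [this, smul_mul_assoc, map_zsmul, mul_sub, mul_sub, ← map_mul, ← map_mul, ← map_mul,
        map_sub, map_sub, preLift_of, preLift_of, preLift_of, RepClass.mul_add', hf,
        add_sub_cancel_left, sub_self, smul_zero]
  · intro y; simp
  · intro x z _ _ hx hz y; rw [mul_add, map_add, hx, hz, add_zero]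
  · intro a x _ hx y; rw [smul_eq_mul, ← mul_assoc]; exact hx _

/-- An additive function on isomorphism classes extends to the representation ring. -/
noncomputable def lift {M : Type*} [AddCommGroup M] (f : RepClass k G → M)
    (hf : ∀ a b, f (a + b) = f a + f b) : RepRing k G →+ M :=
  QuotientAddGroup.lift (sumRelations k G).toAddSubgroup (preLift f)
    fun _ hx => preLift_eq_zero f hf hx

theorem lift_of {M : Type*} [AddCommGroup M] (f : RepClass k G → M)
    (hf : ∀ a b, f (a + b) = f a + f b) (a : RepClass k G) : lift f hf (of a) = f a :=
  preLift_of f a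

/-- The additive homomorphism `Ind_H^G` between the representation rings. -/
noncomputable def ind [Finite G] (H : Subgroup G) : RepRing k H →+ RepRing k G :=
  lift (fun a => of (RepClass.ind H a)) fun a b => by rw [RepClass.ind_add, of_add]

theorem ind_of [Finite G] (H : Subgroup G) (a : RepClass k H) :
    ind H (of a) = of (RepClass.ind H a) := lift_of _ _ _

/-- The additive subgroup `∑_{H < G} Ind_H^G R_{kH}`, the sum running over the proper subgroups. -/
noncomputable def inducedSubgroup (k : Type u) (G : Type v) [Field k] [Group G] [Finite G] :
    AddSubgroup (RepRing k G) :=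
  ⨆ (H : Subgroup G) (_ : H < ⊤), (ind (k := k) H).range

theorem ind_mul_of [Finite G] (H : Subgroup G) (x : RepRing k H) (b : RepClass k G) :
    ind H x * of b = ind H (x * of (RepClass.res H b)) := by
  have : (AddMonoidHom.mulRight (of b)).comp (ind H)
      = (ind H).comp (AddMonoidHom.mulRight (of (RepClass.res H b))) :=
    addHom_ext fun a => by
      simp only [AddMonoidHom.comp_apply, AddMonoidHom.mulRight_apply]
      rw [← map_mul, ind_of, ind_of, ← map_mul, RepClass.ind_mul]
  exact DFunLike.congr_fun this x

theorem mul_mem_inducedSubgroup [Finite G] (x : RepRing k G) {y : RepRing k G}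
    (hy : y ∈ inducedSubgroup k G) : x * y ∈ inducedSubgroup k G := by
  suffices H : ∀ b : RepClass k G,
      inducedSubgroup k G ≤ (inducedSubgroup k G).comap (AddMonoidHom.mulRight (of b)) by
    obtain ⟨x, rfl⟩ := Ideal.Quotient.mk_surjective x
    induction x using MonoidAlgebra.induction_linear with
    | zero => rw [map_zero, zero_mul]; exact zero_mem _
    | add x z hx hz => rw [map_add, add_mul]; exact add_mem hx hz
    | single a n =>
      have : (MonoidAlgebra.single a n : MonoidAlgebra ℤ (RepClass k G))
          = n • MonoidAlgebra.of ℤ _ a := by simp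
      rw [this, map_zsmul, smul_mul_assoc, mul_comm]
      exact zsmul_mem (show _ ∈ inducedSubgroup k G from H a hy) n
  intro b
  refine iSup₂_le fun K hK => ?_
  rintro _ ⟨z, rfl⟩
  change ind K z * of b ∈ inducedSubgroup k G
  rw [ind_mul_of]
  exact le_iSup₂ (f := fun (H : Subgroup G) (_ : H < ⊤) => (ind (k := k) H).range) K hK ⟨_, rfl⟩

/-- The ideal `∑_{H < G} Ind_H^G R_{kH}`. -/
noncomputable def inducedIdeal (k : Type u) (G : Type v) [Field k] [Group G] [Finite G] :
    Ideal (RepRing k G) where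
  __ := inducedSubgroup k G
  smul_mem' x _ hy := mul_mem_inducedSubgroup x hy

end RepRing

/-- The ring of non-induced representations `R_{kG} / ∑_{H < G} Ind_H^G R_{kH}`. -/
abbrev NonInducedRing (k : Type u) (G : Type v) [Field k] [Group G] [Finite G] :
    Type (max u v + 1) :=
  RepRing k G ⧸ RepRing.inducedIdeal k G

/-! ### Quantum numbers and the relations -/

/-- The quantum number `[n] ∈ ℤ[X]`: it is determined by `[0] = 0`, `[1] = 1` and
`[n] = X [n - 1] - [n - 2]`, see the three lemmas below. -/
noncomputable def quantumNumber (n : ℤ) : ℤ[X] := Polynomial.Chebyshev.S ℤ (n - 1)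

theorem quantumNumber_zero : quantumNumber 0 = 0 := by simp [quantumNumber]

theorem quantumNumber_one : quantumNumber 1 = 1 := by simp [quantumNumber]

theorem quantumNumber_eq (n : ℤ) :
    quantumNumber n = Polynomial.X * quantumNumber (n - 1) - quantumNumber (n - 2) := by
  have h := Polynomial.Chebyshev.S_eq ℤ (n - 1)
  rw [sub_right_comm n 1 2] at h
  exact h

/-- The quantum number `[n]_x` evaluated at an element `x` of a ring. -/
noncomputable def quantumAt {A : Type*} [CommRing A] (n : ℤ) (x : A) : A :=
  Polynomial.aeval x (quantumNumber n)

/-- `D_0 = 1` and `D_{j+1} = [p]_{x_j} D_j - [p-1]_{x_j}`. -/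
noncomputable def relatorD {A : Type*} [CommRing A] (p : ℕ) {α : ℕ} (x : Fin α → A) :
    (j : ℕ) → j ≤ α → A
  | 0, _ => 1
  | j + 1, h => quantumAt p (x ⟨j, h⟩) * relatorD p x j (Nat.le_of_succ_le h)
      - quantumAt (p - 1) (x ⟨j, h⟩)

/-- `F_j = (x_j - 2 D_j) [p]_{x_j}`. -/
noncomputable def relatorF {A : Type*} [CommRing A] (p : ℕ) {α : ℕ} (x : Fin α → A)
    (j : Fin α) : A :=
  (x j - 2 * relatorD p x j j.2.le) * quantumAt p (x j)

/-- The relators `[p]_{x_0}, F_1, …, F_{α-1}` (none if `α = 0`). -/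
noncomputable def relator {A : Type*} [CommRing A] (p : ℕ) {α : ℕ} (x : Fin α → A)
    (j : Fin α) : A :=
  if (j : ℕ) = 0 then quantumAt p (x j) else relatorF p x j

/-- `ℤ[X_0, …, X_{α-1}] / ([p]_{X_0}, F_1, …, F_{α-1})` -/
abbrev QuantumQuotient (p α : ℕ) : Type :=
  MvPolynomial (Fin α) ℤ ⧸
    Ideal.span (Set.range (relator p (MvPolynomial.X : Fin α → MvPolynomial (Fin α) ℤ)))

/-- `ℤ[Y] / (Φ_m(Y))` -/
abbrev CyclotomicQuotient (m : ℕ) : Type :=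
  ℤ[X] ⧸ Ideal.span {Polynomial.cyclotomic m ℤ}

/-- `ℤ[X_0, …, X_{α-1}, Y] / (Φ_m(Y), [p]_{X_0}, F_1, …, F_{α-1})`, where `X_i` is the variable
indexed by `some i` and `Y` the one indexed by `none`. -/
abbrev CombinedQuotient (m p α : ℕ) : Type :=
  MvPolynomial (Option (Fin α)) ℤ ⧸
    Ideal.span (insert
      (Polynomial.aeval (MvPolynomial.X none : MvPolynomial (Option (Fin α)) ℤ)
        (Polynomial.cyclotomic m ℤ))
      (Set.range (relator p
        (fun i : Fin α => (MvPolynomial.X (some i) : MvPolynomial (Option (Fin α)) ℤ)))))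

/-!
Let `g` generate `G`, let `n = m p ^ α` be its order, let `ζ` be a primitive `m`-th root of unity in
`k`, and write `V_r` for the unipotent Jordan block of size `r`. Since `X ^ n - 1 = (X ^ m - 1) ^ P`
with `P = p ^ α`, the representation ring is spanned by the Jordan blocks of `g` with eigenvalue
`ζ ^ i` and size `r ≤ P` (`RepRing.of_mem_closure_jordan`), and the block with eigenvalue `ζ ^ i` is
`V_r` twisted by the `i`-th power of a character `Y` (`RepRing.jordan_one_mul`).

*Generators and relations.* `V_a ⊗ V_b` is a commutative algebra generated by `x` and `y` with
`x ^ a = y ^ b = 0`, on which `g - 1` acts as `x + y` up to a unit (`RepRing.exists_tensor_model`).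
To decompose it, it is enough to find elements that generate it modulo `x + y`, that are killed by
powers of `x + y`, and for which the exponents of these powers add up to `a b`. In characteristic
`p` this gives the products that are needed (`GreenRelations`), because
`(x + y) ^ q = x ^ q + y ^ q` for `q = p ^ j`. With `X_j = V_{q+1} - V_{q-1}` they imply that
`D_j = V_q - V_{q-1}`, that `F_j = 0` for `j ≥ 1`, and that the `X_j` generate all `V_r`. Modulo
induced modules, `[p]_{X_0} = V_p` vanishes, being induced from the trivial module of the subgroup
of index `p`. For a prime `l ∣ m` so does the sum of the powers of `Y ^ (m / l)`, which is induced
from the trivial module of the subgroup of index `l`. These sums and `Y ^ m - 1` generate the ideal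
of `Φ_m(Y)` (`span_prod_cyclotomic_eq_top`), so `Φ_m(Y) = 0`. Hence the ring presented by generators
and relations maps onto the ring of non-induced representations
(`RepRing.exists_combinedQuotient_surjective`).

*Lower bound.* For `r` prime to `p`, let `b_i` be the number of Jordan blocks of size `r` with
eigenvalue `ζ ^ i`, and consider `∑ b_i Y ^ i` in `ℤ[Y] / (Φ_m)`. This vanishes on a module induced
from a proper subgroup. If the subgroup lies in one of prime index `l ∣ m`, the module is isomorphic
to its twist by a character of order `l`, so the sum is invariant under `Y ^ (m / l) ≠ 1`
(`FinRep.blockCount_ind_mul`). If it lies in the one of index `p`, the grading by cosets provides an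
operator `E` with `E g = g E - g`, which excludes Jordan blocks of size prime to `p`
(`FinRep.blockCount_ind_eq_zero`). The Jordan blocks themselves show that these sums map the ring of
non-induced representations onto `(ℤ[Y] / (Φ_m)) ^ φ(P)`.

*Comparison.* The relations are monic in `X_0, X_1, …` successively, so `ℤ[X] / ([p]_{X_0}, F_j)` is
generated by `φ(P)` elements as an abelian group (`exists_span_quantumQuotient`). Therefore
`(ℤ[Y] / (Φ_m)) ^ φ(P)` maps onto the tensor product of the two quotients, onto the presented ring,
onto the ring of non-induced representations, and back onto itself. A surjection between free
abelian groups of the same finite rank is bijective, so all these maps are (`nonInducedRing_equiv`).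

In characteristic zero the same argument applies with `α = 0`: then only blocks of size `1` occur,
and `p` plays no role. This is why the hypothesis on the characteristic reads `CharP k p ∨ α = 0`
below.
-/

/-! ### Modules over a group generated by one element -/

namespace FinRep

variable {k : Type u} {G : Type v} [Field k] [Group G]

theorem exists_pow_eq_of_forall_mem_zpowers [Finite G] {g : G}
    (hg : ∀ x, x ∈ Subgroup.zpowers g) (x : G) : ∃ i : ℕ, g ^ i = x :=
  (mem_powers_iff_mem_zpowers.2 (hg x))

/-- For a group generated by `g`, a linear isomorphism commuting with `g` is equivariant. -/
theorem equiv_of_generator [Finite G] {g : G} (hg : ∀ x, x ∈ Subgroup.zpowers g)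
    {A B : FinRep k G} (e : A.V ≃ₗ[k] B.V) (he : ∀ x, e (A.ρ g x) = B.ρ g (e x)) : A ≈ B := by
  refine equiv_of e fun h x => ?_
  obtain ⟨i, rfl⟩ := exists_pow_eq_of_forall_mem_zpowers hg h
  induction i generalizing x with
  | zero => simp
  | succ i ih => rw [pow_succ, map_mul, map_mul, Module.End.mul_apply, Module.End.mul_apply, ih, he]

/-- The direct sum of a finite family. -/
noncomputable def pi {t : ℕ} (W : Fin t → FinRep k G) : FinRep k G :=
  ⟨∀ i, (W i).V,
    { toFun := fun h => LinearMap.pi fun i => (W i).ρ h ∘ₗ LinearMap.proj i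
      map_one' := by ext; simp
      map_mul' := fun a b => by ext; simp }⟩

theorem pi_ρ_apply {t : ℕ} (W : Fin t → FinRep k G) (h : G) (x : (pi W).V) (i : Fin t) :
    (pi W).ρ h x i = (W i).ρ h (x i) := rfl

end FinRep

namespace RepRing

variable {k : Type u} {G : Type v} [Field k] [Group G]

theorem of_mk_congr {A B : FinRep k G} (h : A ≈ B) :
    of (RepClass.mk A) = of (RepClass.mk B) := congrArg of (RepClass.mk_eq.2 h)

theorem of_mk_sum (A B : FinRep k G) :
    of (RepClass.mk (A.sum B)) = of (RepClass.mk A) + of (RepClass.mk B) := by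
  rw [← RepClass.mk_add, of_add]

/-- The class of a zero module vanishes, because `A ⊕ A ≅ A`. -/
theorem of_mk_subsingleton (A : FinRep k G) [Subsingleton A.V] : of (RepClass.mk A) = 0 := by
  have h : A.sum A ≈ A :=
    FinRep.equiv_of (A := A.sum A) (B := A)
      { LinearMap.fst k A.V A.V with
        invFun := fun x => (x, x)
        left_inv := fun x => Prod.ext (Subsingleton.elim _ _) (Subsingleton.elim _ _)
        right_inv := fun x => rfl } fun _ _ => rfl
  have := of_mk_congr h
  rw [of_mk_sum] at this
  exact left_eq_add.1 this.symm

theorem of_mk_pi {t : ℕ} (W : Fin t → FinRep k G) :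
    of (RepClass.mk (FinRep.pi W)) = ∑ i, of (RepClass.mk (W i)) := by
  induction t with
  | zero =>
    have : Subsingleton (FinRep.pi W).V := ⟨fun a b => funext fun i => i.elim0⟩
    simp [of_mk_subsingleton]
  | succ t ih =>
    rw [Fin.sum_univ_succ, ← ih, ← of_mk_sum]
    refine (of_mk_congr ?_).symm
    exact FinRep.equiv_of (A := (W 0).sum (FinRep.pi fun i : Fin t => W i.succ))
      (B := FinRep.pi W) (Fin.consLinearEquiv k fun i => (W i).V)
      fun h x => by
        funext i
        refine Fin.cases ?_ (fun i => ?_) i <;> rfl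

end RepRing

/-! ### Cyclic modules over a cyclic group -/

/-- The algebra `k[X] / (f, X ^ n - 1)`, the largest quotient of `k[X] / (f)` in which
`X ^ n = 1`. -/
abbrev CyclicAlg (k : Type u) [Field k] (n : ℕ) (f : k[X]) : Type u :=
  k[X] ⧸ (Ideal.span {f} ⊔ Ideal.span {Polynomial.X ^ n - 1})

namespace CyclicAlg

variable {k : Type u} [Field k] {n : ℕ} {f : k[X]}

/-- The class of `X`. -/
noncomputable def root (k : Type u) [Field k] (n : ℕ) (f : k[X]) : CyclicAlg k n f :=
  Ideal.Quotient.mk _ Polynomial.X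

theorem aeval_root (φ : k[X]) :
    Polynomial.aeval (root k n f) φ = Ideal.Quotient.mk _ φ := by
  have : Polynomial.aeval (root k n f)
      = Ideal.Quotient.mkₐ k (Ideal.span {f} ⊔ Ideal.span {Polynomial.X ^ n - 1}) := by
    ext; simp [root]
  rw [this]; rfl

theorem aeval_root_self : Polynomial.aeval (root k n f) f = 0 := by
  rw [aeval_root, Ideal.Quotient.eq_zero_iff_mem]
  exact Ideal.mem_sup_left (Ideal.mem_span_singleton_self _)

theorem root_pow : root k n f ^ n = 1 := by
  have h : Polynomial.aeval (root k n f) (Polynomial.X ^ n - 1 : k[X]) = 0 := by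
    rw [aeval_root, Ideal.Quotient.eq_zero_iff_mem]
    exact Ideal.mem_sup_right (Ideal.mem_span_singleton_self _)
  simpa [sub_eq_zero] using h

theorem span_sup_eq (hf : f ∣ Polynomial.X ^ n - 1) :
    Ideal.span {f} ⊔ Ideal.span {Polynomial.X ^ n - 1} = Ideal.span {f} :=
  sup_eq_left.2 ((Ideal.span_singleton_le_span_singleton).2 hf)

theorem finite_of_ne_zero (hn : n ≠ 0) : Module.Finite k (CyclicAlg k n f) := by
  have h : (Polynomial.X ^ n - 1 : k[X]).Monic := Polynomial.monic_X_pow_sub_C (1 : k) hn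
  have : Module.Finite k (k[X] ⧸ Ideal.span {(Polynomial.X ^ n - 1 : k[X])}) := h.finite_adjoinRoot
  refine Module.Finite.of_surjective
    (Ideal.Quotient.factorₐ k (show Ideal.span {(Polynomial.X ^ n - 1 : k[X])}
      ≤ Ideal.span {f} ⊔ Ideal.span {Polynomial.X ^ n - 1} from le_sup_right)).toLinearMap
    (Ideal.Quotient.factor_surjective le_sup_right)

theorem finrank_eq (hn : n ≠ 0) (hf : f ∣ Polynomial.X ^ n - 1) :
    Module.finrank k (CyclicAlg k n f) = f.natDegree := by
  have h0 : (Polynomial.X ^ n - 1 : k[X]) ≠ 0 := (Polynomial.monic_X_pow_sub_C (1 : k) hn).ne_zero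
  have hf0 : f ≠ 0 := ne_zero_of_dvd_ne_zero h0 hf
  have h : Module.finrank k (CyclicAlg k n f) = Module.finrank k (k[X] ⧸ Ideal.span {f}) :=
    (Ideal.quotientEquivAlgOfEq k (span_sup_eq hf)).toLinearEquiv.finrank_eq
  exact h.trans <| (AdjoinRoot.powerBasis hf0).finrank.trans (AdjoinRoot.powerBasis_dim hf0)

/-- Unlike in `finrank_eq`, the polynomial `f` need not divide `X ^ n - 1`. -/
theorem finrank_le (hf : f ≠ 0) : Module.finrank k (CyclicAlg k n f) ≤ f.natDegree := by
  have : Module.Finite k (k[X] ⧸ Ideal.span {f}) := (AdjoinRoot.powerBasis hf).finite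
  have h := LinearMap.finrank_le_finrank_of_surjective (R := k)
    (f := (Ideal.Quotient.factorₐ k (show Ideal.span {f}
      ≤ Ideal.span {f} ⊔ Ideal.span {Polynomial.X ^ n - 1} from le_sup_left)).toLinearMap)
    (Ideal.Quotient.factor_surjective le_sup_left)
  exact h.trans_eq ((AdjoinRoot.powerBasis hf).finrank.trans (AdjoinRoot.powerBasis_dim hf))

end CyclicAlg

namespace FinRep

variable {k : Type u} {G : Type v} [Field k] [Group G]

theorem ρ_pow_card (W : FinRep k G) (g : G) : W.ρ g ^ Nat.card G = 1 := by
  rw [← map_pow, pow_card_eq_one', map_one]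

/-- The map `φ ↦ φ(g) w` from a cyclic module. -/
noncomputable def cycLift (W : FinRep k G) (g : G) (f : k[X]) (w : W.V)
    (hw : Polynomial.aeval (W.ρ g) f w = 0) : CyclicAlg k (Nat.card G) f →ₗ[k] W.V :=
  Submodule.liftQ ((Ideal.span {f} ⊔ Ideal.span {Polynomial.X ^ Nat.card G - 1}).restrictScalars k)
    ((LinearMap.applyₗ w) ∘ₗ (Polynomial.aeval (W.ρ g)).toLinearMap) (by
      intro φ hφ
      rw [Submodule.restrictScalars_mem, Submodule.mem_sup] at hφ
      obtain ⟨a, ha, b, hb, rfl⟩ := hφ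
      obtain ⟨a, rfl⟩ := Ideal.mem_span_singleton'.1 ha
      obtain ⟨b, rfl⟩ := Ideal.mem_span_singleton'.1 hb
      simp [hw, ρ_pow_card])

theorem cycLift_mk (W : FinRep k G) (g : G) (f : k[X]) (w : W.V)
    (hw : Polynomial.aeval (W.ρ g) f w = 0) (φ : k[X]) :
    cycLift W g f w hw (Ideal.Quotient.mk _ φ) = Polynomial.aeval (W.ρ g) φ w := rfl

theorem cycLift_root_mul (W : FinRep k G) (g : G) (f : k[X]) (w : W.V)
    (hw : Polynomial.aeval (W.ρ g) f w = 0) (x : CyclicAlg k (Nat.card G) f) :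
    cycLift W g f w hw (CyclicAlg.root k (Nat.card G) f * x) = W.ρ g (cycLift W g f w hw x) := by
  obtain ⟨φ, rfl⟩ := Ideal.Quotient.mk_surjective x
  rw [CyclicAlg.root, ← map_mul, cycLift_mk, cycLift_mk, map_mul, Polynomial.aeval_X,
    Module.End.mul_apply]

variable [Finite G]

/-- The homomorphism from a group generated by `g` that sends `g` to `e`, where `e ^ |G| = 1`. -/
noncomputable def genHom {g : G} (hg : ∀ x, x ∈ Subgroup.zpowers g) {A : Type*} [Monoid A] (e : A)
    (he : e ^ Nat.card G = 1) : G →* A :=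
  (Units.coeHom A).comp (monoidHomOfForallMemZpowers hg
    (g' := Units.ofPowEqOne e (Nat.card G) he Nat.card_pos.ne') (by
      rw [orderOf_eq_card_of_forall_mem_zpowers hg]
      exact orderOf_dvd_of_pow_eq_one (Units.pow_ofPowEqOne he _)))

theorem genHom_gen {g : G} (hg : ∀ x, x ∈ Subgroup.zpowers g) {A : Type*} [Monoid A] (e : A)
    (he : e ^ Nat.card G = 1) : genHom hg e he g = e := by
  simp [genHom]

/-- The representation of `G` on a finite-dimensional algebra `A` in which the generator `g` acts as
multiplication by `e`. -/
noncomputable def ofAlg {g : G} (hg : ∀ x, x ∈ Subgroup.zpowers g) (A : Type (max u v)) [CommRing A]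
    [Algebra k A] [Module.Finite k A] (e : A) (he : e ^ Nat.card G = 1) : FinRep k G :=
  ⟨A, (Algebra.lmul k A).toMonoidHom.comp (genHom hg e he)⟩

theorem ofAlg_ρ_gen {g : G} (hg : ∀ x, x ∈ Subgroup.zpowers g) (A : Type (max u v)) [CommRing A]
    [Algebra k A] [Module.Finite k A] (e : A) (he : e ^ Nat.card G = 1) (x : A) :
    (ofAlg (k := k) hg A e he).ρ g x = e * x := by
  change Algebra.lmul k A (genHom hg e he g) x = _
  rw [genHom_gen]; rfl

theorem tensor_mulLeft {A B : Type*} [CommRing A] [Algebra k A] [CommRing B] [Algebra k B]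
    (e : A) (f : B) (x : A ⊗[k] B) :
    TensorProduct.map (LinearMap.mulLeft k e) (LinearMap.mulLeft k f) x = e ⊗ₜ f * x := by
  induction x using TensorProduct.induction_on with
  | zero => simp
  | add x y hx hy => rw [map_add, hx, hy, mul_add]
  | tmul a b => simp

theorem ofAlg_tensor {g : G} (hg : ∀ x, x ∈ Subgroup.zpowers g) (A B : Type (max u v))
    [CommRing A] [Algebra k A] [Module.Finite k A] [CommRing B] [Algebra k B] [Module.Finite k B]
    (e : A) (he : e ^ Nat.card G = 1) (f : B) (hf : f ^ Nat.card G = 1) :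
    (ofAlg (k := k) hg A e he).tensor (ofAlg hg B f hf)
      ≈ ofAlg hg (A ⊗[k] B) (e ⊗ₜ f) (by simp [he, hf, Algebra.TensorProduct.one_def]) := by
  refine equiv_of_generator hg (LinearEquiv.refl k (A ⊗[k] B)) fun x => ?_
  have hA : (ofAlg (k := k) hg A e he).ρ g = LinearMap.mulLeft k e :=
    LinearMap.ext (ofAlg_ρ_gen hg A e he)
  have hB : (ofAlg (k := k) hg B f hf).ρ g = LinearMap.mulLeft k f :=
    LinearMap.ext (ofAlg_ρ_gen hg B f hf)
  refine Eq.trans ?_ (ofAlg_ρ_gen hg (A ⊗[k] B) _ _ x).symm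
  change TensorProduct.map ((ofAlg (k := k) hg A e he).ρ g) ((ofAlg hg B f hf).ρ g) x = _
  rw [hA, hB]
  exact tensor_mulLeft e f x

instance finite_cyclicAlg (f : k[X]) : Module.Finite k (CyclicAlg k (Nat.card G) f) :=
  CyclicAlg.finite_of_ne_zero Nat.card_pos.ne'

/-- The cyclic module `k[X] / (f, X ^ n - 1)`, where `n = |G|` and the generator `g` acts as `X`. -/
noncomputable def cyc {g : G} (hg : ∀ x, x ∈ Subgroup.zpowers g) (f : k[X]) : FinRep k G :=
  ofAlg hg (ULift.{v} (CyclicAlg k (Nat.card G) f)) ⟨CyclicAlg.root k (Nat.card G) f⟩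
    (ULift.ext _ _ CyclicAlg.root_pow)

/-- The underlying space of `cyc hg f`. -/
noncomputable def cycEquiv {g : G} (hg : ∀ x, x ∈ Subgroup.zpowers g) (f : k[X]) :
    (cyc hg f).V ≃ₗ[k] CyclicAlg k (Nat.card G) f :=
  ULift.moduleEquiv

theorem cycEquiv_ρ {g : G} (hg : ∀ x, x ∈ Subgroup.zpowers g) (f : k[X]) (x : (cyc hg f).V) :
    cycEquiv hg f ((cyc hg f).ρ g x) = CyclicAlg.root k (Nat.card G) f * cycEquiv hg f x :=
  congrArg ULift.down (ofAlg_ρ_gen (k := k) hg (ULift.{v} (CyclicAlg k (Nat.card G) f))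
    ⟨CyclicAlg.root k (Nat.card G) f⟩ (ULift.ext _ _ CyclicAlg.root_pow) x)

theorem finrank_cyc {g : G} (hg : ∀ x, x ∈ Subgroup.zpowers g) (f : k[X]) :
    Module.finrank k (cyc hg f).V = Module.finrank k (CyclicAlg k (Nat.card G) f) :=
  (cycEquiv hg f).finrank_eq

/-- If vectors `w i` generate a representation, `w i` is killed by `f i (g)`, and the dimensions do
not leave room for further relations, then the representation is the direct sum of the cyclic
modules `cyc hg (f i)`. -/
theorem of_eq_sum_cyc_fin {g : G} (hg : ∀ x, x ∈ Subgroup.zpowers g) {t : ℕ} (W : FinRep k G)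
    (f : Fin t → k[X]) (w : Fin t → W.V) (hw : ∀ i, Polynomial.aeval (W.ρ g) (f i) (w i) = 0)
    (hgen : ∀ U : Submodule k W.V, (∀ x ∈ U, W.ρ g x ∈ U) → (∀ i, w i ∈ U) → U = ⊤)
    (hdim : ∑ i, Module.finrank k (cyc hg (f i)).V ≤ Module.finrank k W.V) :
    RepRing.of (RepClass.mk W) = ∑ i, RepRing.of (RepClass.mk (cyc hg (f i))) := by
  rw [← RepRing.of_mk_pi]
  let L : (∀ i, (cyc hg (f i)).V) →ₗ[k] W.V :=
    ∑ i, cycLift W g (f i) (w i) (hw i) ∘ₗ (cycEquiv hg (f i)).toLinearMap ∘ₗ LinearMap.proj i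
  have hL : ∀ x, L x = ∑ i, cycLift W g (f i) (w i) (hw i) (cycEquiv hg (f i) (x i)) :=
    fun x => by simp [L]
  have hLg : ∀ x, L ((pi fun i => cyc hg (f i)).ρ g x) = W.ρ g (L x) := fun x => by
    refine (hL _).trans (Eq.trans ?_ (congrArg (W.ρ g) (hL x)).symm)
    rw [map_sum]
    refine Finset.sum_congr rfl fun i _ => ?_
    rw [pi_ρ_apply, cycEquiv_ρ, cycLift_root_mul]
  have hsurj : LinearMap.range L = ⊤ := by
    refine hgen _ ?_ fun i => ?_
    · rintro _ ⟨x, rfl⟩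
      exact ⟨_, hLg x⟩
    · classical
      refine ⟨Pi.single i ((cycEquiv hg (f i)).symm (Ideal.Quotient.mk _ 1)), ?_⟩
      rw [hL, Finset.sum_eq_single i]
      · rw [Pi.single_eq_same, LinearEquiv.apply_symm_apply, cycLift_mk, map_one,
          Module.End.one_apply]
      · intro j _ hj
        rw [Pi.single_eq_of_ne hj, map_zero, map_zero]
      · exact fun h => absurd (Finset.mem_univ i) h
  have hd : Module.finrank k (∀ i, (cyc hg (f i)).V) = Module.finrank k W.V := by
    refine le_antisymm ?_
      (LinearMap.finrank_le_finrank_of_surjective (LinearMap.range_eq_top.1 hsurj))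
    rwa [Module.finrank_pi_fintype]
  have hinj : Function.Injective L :=
    (LinearMap.injective_iff_surjective_of_finrank_eq_finrank hd).2 (LinearMap.range_eq_top.1 hsurj)
  refine (RepRing.of_mk_congr (equiv_of_generator hg (A := pi fun i => cyc hg (f i)) (B := W)
    (LinearEquiv.ofBijective L ⟨hinj, LinearMap.range_eq_top.1 hsurj⟩) hLg)).symm

theorem of_eq_sum_cyc {g : G} (hg : ∀ x, x ∈ Subgroup.zpowers g) {ι : Type*} [Fintype ι]
    (W : FinRep k G)
    (f : ι → k[X]) (w : ι → W.V) (hw : ∀ i, Polynomial.aeval (W.ρ g) (f i) (w i) = 0)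
    (hgen : ∀ U : Submodule k W.V, (∀ x ∈ U, W.ρ g x ∈ U) → (∀ i, w i ∈ U) → U = ⊤)
    (hdim : ∑ i, Module.finrank k (cyc hg (f i)).V ≤ Module.finrank k W.V) :
    RepRing.of (RepClass.mk W) = ∑ i, RepRing.of (RepClass.mk (cyc hg (f i))) := by
  let e := (Fintype.equivFin ι).symm
  rw [← e.sum_comp (fun i => RepRing.of (RepClass.mk (cyc hg (f i))))]
  refine of_eq_sum_cyc_fin hg W (f ∘ e) (w ∘ e) (fun i => hw _)
    (fun U h1 h2 => hgen U h1 fun i => ?_) ?_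
  · simpa using h2 (e.symm i)
  · exact (e.sum_comp (fun i => Module.finrank k (cyc hg (f i)).V)).trans_le hdim

end FinRep

/-! ### Jordan blocks and their tensor products -/

namespace RepRing

variable {k : Type u} {G : Type v} [Field k] [Group G] [Finite G]

/-- The class of the module `k[X] / ((X - μ) ^ r, X ^ n - 1)`: the Jordan block of size `r` with
eigenvalue `μ` if `(X - μ) ^ r` divides `X ^ n - 1`. -/
noncomputable def jordan {g : G} (hg : ∀ x, x ∈ Subgroup.zpowers g) (μ : k) (r : ℕ) :
    RepRing k G :=
  of (RepClass.mk (FinRep.cyc hg ((Polynomial.X - Polynomial.C μ) ^ r)))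

variable {g : G} (hg : ∀ x, x ∈ Subgroup.zpowers g)

theorem finrank_jordan_le (μ : k) (r : ℕ) :
    Module.finrank k (FinRep.cyc hg ((Polynomial.X - Polynomial.C μ) ^ r)).V ≤ r := by
  rw [FinRep.finrank_cyc]
  refine (CyclicAlg.finrank_le (pow_ne_zero _ (Polynomial.X_sub_C_ne_zero μ))).trans_eq ?_
  rw [Polynomial.natDegree_pow, Polynomial.natDegree_X_sub_C, mul_one]

theorem finrank_jordan {μ : k} {r : ℕ}
    (h : (Polynomial.X - Polynomial.C μ) ^ r ∣ (Polynomial.X ^ Nat.card G - 1 : k[X])) :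
    Module.finrank k (FinRep.cyc hg ((Polynomial.X - Polynomial.C μ) ^ r)).V = r := by
  rw [FinRep.finrank_cyc, CyclicAlg.finrank_eq Nat.card_pos.ne' h, Polynomial.natDegree_pow,
    Polynomial.natDegree_X_sub_C, mul_one]

theorem jordan_zero (μ : k) : jordan hg μ 0 = 0 := by
  have h := finrank_jordan_le hg μ 0
  have : Subsingleton (FinRep.cyc hg ((Polynomial.X - Polynomial.C μ) ^ 0)).V :=
    Module.finrank_zero_iff.1 (Nat.le_zero.1 h)
  exact of_mk_subsingleton _

/-- If `g` acts on an algebra as multiplication by `e`, and `e - μ` is a nilpotent element `T` up to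
a unit, then elements `w i` with `T ^ s i * w i = 0` that generate the algebra modulo `T` exhibit it
as a sum of Jordan blocks of sizes `s i`, as soon as these sizes do not exceed the dimension. -/
theorem of_ofAlg_eq_sum {ι : Type*} [Fintype ι] (A : Type (max u v)) [CommRing A] [Algebra k A]
    [Module.Finite k A] (e : A) (he : e ^ Nat.card G = 1) (μ : k) (T ε : A) (hε : IsUnit ε)
    (hT : IsNilpotent T) (heT : e - algebraMap k A μ = T * ε) (s : ι → ℕ) (w : ι → A)
    (hw : ∀ i, T ^ s i * w i = 0)
    (hgen : ∀ a : A, ∃ c ∈ Submodule.span k (Set.range w), T ∣ a - c)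
    (hdim : ∑ i, s i ≤ Module.finrank k A) :
    of (RepClass.mk (FinRep.ofAlg hg A e he)) = ∑ i, jordan hg μ (s i) := by
  have hρ : (FinRep.ofAlg (k := k) hg A e he).ρ g = Algebra.lmul k A e :=
    LinearMap.ext (FinRep.ofAlg_ρ_gen hg A e he)
  refine FinRep.of_eq_sum_cyc hg (FinRep.ofAlg hg A e he) _ w (fun i => ?_) (fun U hU hUw => ?_) ?_
  · rw [hρ]
    have h : Polynomial.aeval (Algebra.lmul k A e) ((Polynomial.X - Polynomial.C μ) ^ s i)
        = Algebra.lmul k A ((e - algebraMap k A μ) ^ s i) := by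
      rw [map_pow, map_sub, Polynomial.aeval_X, Polynomial.aeval_C, map_pow, map_sub,
        AlgHom.commutes]
    refine (LinearMap.congr_fun h (w i)).trans ?_
    change (e - algebraMap k A μ) ^ s i * w i = 0
    rw [heT, mul_pow, mul_right_comm, hw, zero_mul]
  · change Submodule k A at U
    have hU' : ∀ x ∈ U, (e - algebraMap k A μ) * x ∈ U := fun x hx => by
      rw [sub_mul, ← Algebra.smul_def]
      refine U.sub_mem ?_ (U.smul_mem _ hx)
      have := hU x hx
      rwa [hρ] at this
    have hUn : ∀ (n : ℕ), ∀ x ∈ U, (e - algebraMap k A μ) ^ n * x ∈ U := by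
      intro n
      induction n with
      | zero => intro x hx; simpa using hx
      | succ n ih => intro x hx; rw [pow_succ, mul_assoc]; exact ih _ (hU' x hx)
    have hspan : Submodule.span k (Set.range w) ≤ U :=
      Submodule.span_le.2 (Set.range_subset_iff.2 hUw)
    have hstep : ∀ (n : ℕ) (a : A), ∃ c ∈ U, (e - algebraMap k A μ) ^ n ∣ a - c := by
      intro n a
      induction n with
      | zero => exact ⟨0, U.zero_mem, by simp⟩
      | succ n ih =>
        obtain ⟨c, hc, b, hb⟩ := ih
        obtain ⟨c', hc', d, hd⟩ := hgen b
        obtain ⟨ε', hε'⟩ := hε.exists_right_inv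
        refine ⟨c + (e - algebraMap k A μ) ^ n * c', U.add_mem hc (hUn n _ (hspan hc')), ε' * d, ?_⟩
        rw [← sub_sub, hb, ← mul_sub, hd, pow_succ, mul_assoc]
        congr 1
        rw [heT, mul_assoc, ← mul_assoc ε, hε', one_mul]
    obtain ⟨M, hM⟩ := hT
    refine eq_top_iff.2 fun a _ => ?_
    obtain ⟨c, hc, b, hb⟩ := hstep M a
    rw [heT, mul_pow, hM, zero_mul, zero_mul] at hb
    have hac : (show A from a) = c := sub_eq_zero.1 hb
    exact hac.symm ▸ hc
  · exact (Finset.sum_le_sum fun i _ => finrank_jordan_le hg μ (s i)).trans hdim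

/-- The generator of `CyclicAlg`, lifted to the universe of representations. -/
noncomputable def uroot (k : Type u) [Field k] (n : ℕ) (f : k[X]) :
    ULift.{v} (CyclicAlg k n f) :=
  ⟨CyclicAlg.root k n f⟩

theorem uroot_pow (n : ℕ) (f : k[X]) : uroot.{u, v} k n f ^ n = 1 :=
  ULift.ext _ _ CyclicAlg.root_pow

theorem uroot_sub_pow (n : ℕ) (μ : k) (r : ℕ) :
    (uroot.{u, v} k n ((Polynomial.X - Polynomial.C μ) ^ r) - algebraMap k _ μ) ^ r = 0 := by
  have h := CyclicAlg.aeval_root_self (k := k) (n := n)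
    (f := (Polynomial.X - Polynomial.C μ) ^ r)
  rw [map_pow, map_sub, Polynomial.aeval_X, Polynomial.aeval_C] at h
  exact ULift.ext _ _ h

theorem exists_aeval_uroot_sub (n : ℕ) (f : k[X]) (μ : k) (a : ULift.{v} (CyclicAlg k n f)) :
    ∃ φ : k[X], a = Polynomial.aeval (uroot.{u, v} k n f - algebraMap k _ μ) φ := by
  obtain ⟨a⟩ := a
  obtain ⟨φ, rfl⟩ := Ideal.Quotient.mk_surjective a
  refine ⟨φ.comp (Polynomial.X + Polynomial.C μ), ?_⟩
  rw [Polynomial.aeval_comp]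
  simp only [map_add, Polynomial.aeval_X, Polynomial.aeval_C, sub_add_cancel]
  have := (Polynomial.aeval_algHom_apply (ULift.algEquiv (R := k) (A := CyclicAlg k n f)).symm
    (CyclicAlg.root k n f) φ)
  rw [CyclicAlg.aeval_root] at this
  exact this.symm

/-- A product of Jordan blocks is the tensor product of two cyclic algebras, on which `g` acts as
multiplication by the tensor product of the generators. -/
theorem jordan_mul (μ ν : k) (a b : ℕ) :
    jordan hg μ a * jordan hg ν b = of (RepClass.mk (FinRep.ofAlg hg
      (ULift.{v} (CyclicAlg k (Nat.card G) ((Polynomial.X - Polynomial.C μ) ^ a)) ⊗[k]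
        ULift.{v} (CyclicAlg k (Nat.card G) ((Polynomial.X - Polynomial.C ν) ^ b)))
      (uroot k _ _ ⊗ₜ uroot k _ _)
      (by simp [uroot_pow, Algebra.TensorProduct.one_def]))) := by
  rw [jordan, jordan, ← map_mul, RepClass.mk_mul]
  exact of_mk_congr (FinRep.ofAlg_tensor hg _ _ _ _ _ _)

/-- Twisting a Jordan block by a character, for abstract algebras: if `g` acts on `A` as the scalar
`μ` and on `B` as a Jordan block of size `r` with eigenvalue `ν`, then it acts on `A ⊗ B` as a
Jordan block with eigenvalue `μ * ν`. Keeping `A` and `B` abstract spares the unifier the quotient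
rings to which this is applied. -/
theorem of_ofAlg_tensor_eq_jordan (A B : Type (max u v)) [CommRing A] [Algebra k A]
    [Module.Finite k A] [CommRing B] [Algebra k B] [Module.Finite k B] (μ ν : k) (hμ : μ ≠ 0)
    (e₁ : A) (e₂ : B) (he : (e₁ ⊗ₜ[k] e₂) ^ Nat.card G = 1) {r : ℕ} (h₁ : e₁ = algebraMap k A μ)
    (h₂ : (e₂ - algebraMap k B ν) ^ r = 0) (hA : ∀ z : A, ∃ c, z = algebraMap k A c)
    (hB : ∀ z : B, ∃ φ : k[X], z = Polynomial.aeval (e₂ - algebraMap k B ν) φ)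
    (hdim : Module.finrank k (A ⊗[k] B) = r) :
    of (RepClass.mk (FinRep.ofAlg hg (A ⊗[k] B) (e₁ ⊗ₜ e₂) he))
      = jordan hg (μ * ν) r := by
  subst h₁
  have hT : (1 ⊗ₜ (e₂ - algebraMap k B ν) : A ⊗[k] B) ^ r = 0 := by
    rw [Algebra.TensorProduct.tmul_pow, h₂, TensorProduct.tmul_zero]
  rw [of_ofAlg_eq_sum hg (ι := Unit) (A ⊗[k] B) _ _ (μ * ν) (1 ⊗ₜ (e₂ - algebraMap k B ν))
    (algebraMap k _ μ) ((isUnit_iff_ne_zero.2 hμ).map _) ⟨r, hT⟩ ?_ (fun _ => r) (fun _ => 1)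
    (fun _ => by rw [hT, zero_mul]) ?_ (by simp [hdim])]
  · simp
  · rw [mul_comm _ (algebraMap k _ μ), ← Algebra.smul_def, TensorProduct.tmul_sub,
      Algebra.algebraMap_eq_smul_one, Algebra.algebraMap_eq_smul_one,
      Algebra.algebraMap_eq_smul_one, TensorProduct.smul_tmul, TensorProduct.tmul_smul,
      TensorProduct.tmul_smul, smul_sub, Algebra.TensorProduct.one_def, smul_smul]
  · intro a
    obtain ⟨b, rfl⟩ : ∃ b : B, a = 1 ⊗ₜ b := by
      induction a using TensorProduct.induction_on with
      | zero => exact ⟨0, (TensorProduct.tmul_zero _ _).symm⟩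
      | add a b ha hb =>
        obtain ⟨c, rfl⟩ := ha
        obtain ⟨d, rfl⟩ := hb
        exact ⟨c + d, (TensorProduct.tmul_add _ _ _).symm⟩
      | tmul a b =>
        obtain ⟨c, rfl⟩ := hA a
        exact ⟨c • b, by rw [Algebra.algebraMap_eq_smul_one, TensorProduct.smul_tmul]⟩
    obtain ⟨ψ, rfl⟩ := hB b
    refine ⟨ψ.coeff 0 • 1, Submodule.smul_mem _ _ (Submodule.subset_span ⟨(), rfl⟩), ?_⟩
    obtain ⟨χ, hχ⟩ : Polynomial.X ∣ ψ - Polynomial.C (ψ.coeff 0) := by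
      rw [Polynomial.X_dvd_iff]; simp
    refine ⟨1 ⊗ₜ Polynomial.aeval (e₂ - algebraMap k B ν) χ, ?_⟩
    rw [Algebra.TensorProduct.tmul_mul_tmul, one_mul, Algebra.TensorProduct.one_def,
      ← TensorProduct.tmul_smul, ← TensorProduct.tmul_sub, ← Algebra.algebraMap_eq_smul_one]
    congr 1
    have := congrArg (Polynomial.aeval (e₂ - algebraMap k B ν)) hχ
    rwa [map_sub, map_mul, Polynomial.aeval_X, Polynomial.aeval_C] at this

/-- Tensoring with a one-dimensional module multiplies the eigenvalue. -/
theorem jordan_one_mul (μ ν : k) (hμ : μ ^ Nat.card G = 1) {r : ℕ}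
    (hr : (Polynomial.X - Polynomial.C ν) ^ r ∣ (Polynomial.X ^ Nat.card G - 1 : k[X])) :
    jordan hg μ 1 * jordan hg ν r = jordan hg (μ * ν) r := by
  have hμ0 : μ ≠ 0 := by
    rintro rfl
    rw [zero_pow Nat.card_pos.ne'] at hμ
    exact zero_ne_one hμ
  have hμ1 : (Polynomial.X - Polynomial.C μ) ^ 1 ∣ (Polynomial.X ^ Nat.card G - 1 : k[X]) := by
    rw [pow_one, Polynomial.dvd_iff_isRoot]
    simp [hμ]
  have h₁ : uroot.{u, v} k (Nat.card G) ((Polynomial.X - Polynomial.C μ) ^ 1)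
      = algebraMap k _ μ :=
    sub_eq_zero.1 ((pow_one _).symm.trans (uroot_sub_pow.{u, v} (Nat.card G) μ 1))
  have hd := Module.finrank_tensorProduct (R := k) (S := k)
    (M := (FinRep.cyc hg ((Polynomial.X - Polynomial.C μ) ^ 1)).V)
    (M' := (FinRep.cyc hg ((Polynomial.X - Polynomial.C ν) ^ r)).V)
  rw [finrank_jordan hg hμ1, finrank_jordan hg hr, one_mul] at hd
  rw [jordan_mul]
  have hA : ∀ z : ULift.{v} (CyclicAlg k (Nat.card G) ((Polynomial.X - Polynomial.C μ) ^ 1)),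
      ∃ c, z = algebraMap k _ c := by
    intro z
    obtain ⟨φ, rfl⟩ := exists_aeval_uroot_sub _ _ μ z
    exact ⟨φ.coeff 0, by
      rw [sub_eq_zero.2 h₁, ← Polynomial.coeff_zero_eq_aeval_zero']⟩
  exact of_ofAlg_tensor_eq_jordan hg _ _ μ ν hμ0 _ _ _ h₁ (uroot_sub_pow (Nat.card G) ν r) hA
    (exists_aeval_uroot_sub _ _ ν) hd

/-- In a tensor product of algebras generated by `x` and by a nilpotent element `y`, the powers of
`1 ⊗ y` span the quotient by `x ⊗ 1 + 1 ⊗ y`, since `x ⊗ 1` acts on it as `-(1 ⊗ y)`. -/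
theorem exists_span_pow_of_tensor {A B : Type*} [CommRing A] [Algebra k A] [CommRing B]
    [Algebra k B] (x : A) (y : B) (hx : ∀ a, ∃ φ : k[X], a = Polynomial.aeval x φ)
    (hy : ∀ a, ∃ φ : k[X], a = Polynomial.aeval y φ) {b : ℕ} (hb : y ^ b = 0) (z : A ⊗[k] B) :
    ∃ c ∈ Submodule.span k (Set.range fun j : Fin b => (1 ⊗ₜ y : A ⊗[k] B) ^ (j : ℕ)),
      x ⊗ₜ 1 + 1 ⊗ₜ y ∣ z - c := by
  set T : A ⊗[k] B := x ⊗ₜ 1 + 1 ⊗ₜ y with hT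
  set Y : A ⊗[k] B := 1 ⊗ₜ y with hY
  have hYb : Y ^ b = 0 := by
    rw [hY, Algebra.TensorProduct.tmul_pow, hb, TensorProduct.tmul_zero]
  let U : Submodule k (A ⊗[k] B) :=
    Submodule.span k (Set.range fun j : Fin b => Y ^ (j : ℕ))
      ⊔ (Ideal.span {T}).restrictScalars k
  have hTU : ∀ u, T * u ∈ U := fun u =>
    Submodule.mem_sup_right (Ideal.mul_mem_right _ _ (Ideal.mem_span_singleton_self T))
  have hYU : ∀ u ∈ U, Y * u ∈ U := by
    intro u hu
    obtain ⟨c, hc, d, hd, rfl⟩ := Submodule.mem_sup.1 hu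
    obtain ⟨d, rfl⟩ := Ideal.mem_span_singleton.1 hd
    rw [mul_add, mul_left_comm]
    refine U.add_mem ?_ (hTU _)
    clear hu
    induction hc using Submodule.span_induction with
    | zero => rw [mul_zero]; exact U.zero_mem
    | add c d _ _ hc hd =>
      rw [mul_add]
      exact U.add_mem hc hd
    | smul r c _ hc =>
      rw [mul_smul_comm]
      exact U.smul_mem _ hc
    | mem c hc =>
      obtain ⟨j, rfl⟩ := hc
      change Y * Y ^ (j : ℕ) ∈ U
      rw [← pow_succ']
      rcases Nat.lt_or_ge (j + 1) b with h | h
      · exact Submodule.mem_sup_left (Submodule.subset_span ⟨⟨j + 1, h⟩, rfl⟩)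
      · rw [pow_eq_zero_of_le h hYb]; exact U.zero_mem
  have hXU : ∀ u ∈ U, (x ⊗ₜ 1 : A ⊗[k] B) * u ∈ U := fun u hu => by
    rw [show (x ⊗ₜ 1 : A ⊗[k] B) = T - Y by rw [hT, add_sub_cancel_right], sub_mul]
    exact U.sub_mem (hTU u) (hYU u hu)
  -- the multipliers of `U` contain `x ⊗ 1` and `1 ⊗ y`, so they are everything, and `1 ∈ U`
  let S : Subalgebra k (A ⊗[k] B) :=
    { carrier := {z | ∀ u ∈ U, z * u ∈ U}
      mul_mem' := fun {a b} ha hb u hu => by rw [mul_assoc]; exact ha _ (hb u hu)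
      add_mem' := fun {a b} ha hb u hu => by rw [add_mul]; exact U.add_mem (ha u hu) (hb u hu)
      algebraMap_mem' := fun r u hu => by rw [← Algebra.smul_def]; exact U.smul_mem r hu }
  have hS : ∀ z, z ∈ S := by
    intro z
    induction z using TensorProduct.induction_on with
    | zero => exact S.zero_mem
    | add a b ha hb => exact S.add_mem ha hb
    | tmul a b =>
      obtain ⟨φ, rfl⟩ := hx a
      obtain ⟨ψ, rfl⟩ := hy b
      have h : Polynomial.aeval x φ ⊗ₜ[k] Polynomial.aeval y ψ
          = Polynomial.aeval (x ⊗ₜ 1 : A ⊗[k] B) φ * Polynomial.aeval Y ψ := by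
        have h1 := Polynomial.aeval_algHom_apply
          (Algebra.TensorProduct.includeLeft : A →ₐ[k] A ⊗[k] B) x φ
        have h2 := Polynomial.aeval_algHom_apply
          (Algebra.TensorProduct.includeRight : B →ₐ[k] A ⊗[k] B) y ψ
        rw [Algebra.TensorProduct.includeLeft_apply, Algebra.TensorProduct.includeLeft_apply] at h1
        rw [Algebra.TensorProduct.includeRight_apply,
          Algebra.TensorProduct.includeRight_apply] at h2
        rw [h1, h2, Algebra.TensorProduct.tmul_mul_tmul, mul_one, one_mul]
      rw [h]
      exact S.mul_mem
        (Algebra.adjoin_le (S := S) (Set.singleton_subset_iff.2 hXU)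
          (Polynomial.aeval_mem_adjoin_singleton k _))
        (Algebra.adjoin_le (S := S) (Set.singleton_subset_iff.2 hYU)
          (Polynomial.aeval_mem_adjoin_singleton k _))
  have h1 : (1 : A ⊗[k] B) ∈ U := by
    rcases Nat.eq_zero_or_pos b with rfl | h
    · rw [pow_zero] at hYb; rw [hYb]; exact U.zero_mem
    · exact Submodule.mem_sup_left (Submodule.subset_span ⟨⟨0, h⟩, pow_zero _⟩)
  have hz := hS z 1 h1
  rw [mul_one] at hz
  obtain ⟨c, hc, d, hd, rfl⟩ := Submodule.mem_sup.1 hz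
  exact ⟨c, hc, by rw [add_sub_cancel_left]; exact Ideal.mem_span_singleton.1 hd⟩

/-- `exists_tensor_model` for abstract algebras `A` and `B` on which `g` acts as unipotent elements
`e₁` and `e₂`. With `f = e₂⁻¹`, the identity behind it is
`e₁ ⊗ e₂ - 1 = ((e₁ - 1) ⊗ 1 + 1 ⊗ (1 - f)) (1 ⊗ e₂)`. -/
theorem exists_tensor_model_aux (A B : Type (max u v)) [CommRing A] [Algebra k A]
    [Module.Finite k A] [CommRing B] [Algebra k B] [Module.Finite k B] (e₁ : A) (e₂ : B)
    (he : (e₁ ⊗ₜ[k] e₂) ^ Nat.card G = 1) (he₂ : e₂ ^ Nat.card G = 1) {a b : ℕ}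
    (h₁ : (e₁ - algebraMap k A 1) ^ a = 0) (h₂ : (e₂ - algebraMap k B 1) ^ b = 0)
    (hA : ∀ z : A, ∃ φ : k[X], z = Polynomial.aeval (e₁ - algebraMap k A 1) φ)
    (hB : ∀ z : B, ∃ φ : k[X], z = Polynomial.aeval (e₂ - algebraMap k B 1) φ)
    (hdim : Module.finrank k (A ⊗[k] B) = a * b) :
    ∃ (R : Type (max u v)) (_ : CommRing R) (_ : Algebra k R) (x y : R), x ^ a = 0 ∧ y ^ b = 0 ∧
      ∀ (ι : Type) [Fintype ι] (s : ι → ℕ) (w : ι → R), (∀ i, (x + y) ^ s i * w i = 0) →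
        ∑ i, s i ≤ a * b →
        (∀ j < b, ∃ i, ∃ c : k, c ≠ 0 ∧ x + y ∣ w i - algebraMap k R c * y ^ j) →
        of (RepClass.mk (FinRep.ofAlg hg (A ⊗[k] B) (e₁ ⊗ₜ e₂) he))
          = ∑ i, jordan hg (1 : k) (s i) := by
  rw [map_one] at h₁ h₂ hA hB
  obtain ⟨f, hf⟩ : ∃ f, e₂ * f = 1 := by
    refine ⟨e₂ ^ (Nat.card G - 1), ?_⟩
    rw [← pow_succ', Nat.sub_add_cancel Nat.card_pos, he₂]
  have hfb : (1 - f) ^ b = 0 := by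
    rw [show 1 - f = (e₂ - 1) * f by rw [sub_mul, hf, one_mul], mul_pow, h₂, zero_mul]
  -- `g = (1 - y)⁻¹` is a polynomial in the nilpotent element `y = 1 - g⁻¹`
  have he₂f : e₂ = ∑ i ∈ Finset.range b, (1 - f) ^ i := by
    have h := geom_sum_mul_neg (1 - f) b
    rw [hfb, sub_sub_cancel, sub_zero] at h
    calc e₂ = e₂ * ((∑ i ∈ Finset.range b, (1 - f) ^ i) * f) := by rw [h, mul_one]
      _ = (∑ i ∈ Finset.range b, (1 - f) ^ i) * (e₂ * f) := by ring
      _ = _ := by rw [hf, mul_one]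
  have hy : ∀ z, ∃ φ : k[X], z = Polynomial.aeval (1 - f) φ := fun z => by
    obtain ⟨φ, hφ⟩ := hB z
    refine ⟨φ.comp (∑ i ∈ Finset.range b, Polynomial.X ^ i - 1), ?_⟩
    rw [Polynomial.aeval_comp, hφ]
    congr 2
    rw [map_sub, map_sum, map_one, he₂f]
    simp
  have hxa : ((e₁ - 1) ⊗ₜ[k] (1 : B)) ^ a = 0 := by
    rw [Algebra.TensorProduct.tmul_pow, h₁, TensorProduct.zero_tmul]
  have hyb : ((1 : A) ⊗ₜ[k] (1 - f)) ^ b = 0 := by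
    rw [Algebra.TensorProduct.tmul_pow, hfb, TensorProduct.tmul_zero]
  refine ⟨A ⊗[k] B, inferInstance, inferInstance, (e₁ - 1) ⊗ₜ[k] 1, 1 ⊗ₜ[k] (1 - f), hxa, hyb, ?_⟩
  intro ι _ s w hw hs hgen
  refine of_ofAlg_eq_sum hg _ _ _ 1 ((e₁ - 1) ⊗ₜ[k] 1 + 1 ⊗ₜ[k] (1 - f)) (1 ⊗ₜ e₂)
    (IsUnit.of_mul_eq_one (1 ⊗ₜ f) ?_) ?_ ?_ s w hw ?_ (hs.trans hdim.ge)
  · rw [Algebra.TensorProduct.tmul_mul_tmul, hf, one_mul, Algebra.TensorProduct.one_def]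
  · exact (Commute.all _ _).isNilpotent_add ⟨a, hxa⟩ ⟨b, hyb⟩
  · rw [map_one, add_mul, Algebra.TensorProduct.tmul_mul_tmul, Algebra.TensorProduct.tmul_mul_tmul,
      one_mul, mul_one, one_mul, sub_mul, mul_comm f, hf, one_mul, TensorProduct.sub_tmul,
      TensorProduct.tmul_sub, Algebra.TensorProduct.one_def]
    abel
  · intro z
    obtain ⟨c, hc, hzc⟩ := exists_span_pow_of_tensor (e₁ - 1) (1 - f) hA hy hfb z
    suffices h : ∃ d ∈ Submodule.span k (Set.range w),
        (e₁ - 1) ⊗ₜ[k] 1 + 1 ⊗ₜ[k] (1 - f) ∣ c - d by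
      obtain ⟨d, hd, hcd⟩ := h
      exact ⟨d, hd, by rw [← sub_add_sub_cancel z c d]; exact dvd_add hzc hcd⟩
    clear hzc
    induction hc using Submodule.span_induction with
    | zero => exact ⟨0, zero_mem _, by simp⟩
    | add c d _ _ hc hd =>
      obtain ⟨c', hc', hcc⟩ := hc
      obtain ⟨d', hd', hdd⟩ := hd
      exact ⟨c' + d', add_mem hc' hd', by rw [add_sub_add_comm]; exact dvd_add hcc hdd⟩
    | smul r c _ hc =>
      obtain ⟨c', hc', hcc⟩ := hc
      refine ⟨r • c', Submodule.smul_mem _ _ hc', ?_⟩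
      rw [← smul_sub]
      exact dvd_smul_of_dvd r hcc
    | mem c hc =>
      obtain ⟨j, rfl⟩ := hc
      obtain ⟨i, c, hc, hd⟩ := hgen j j.2
      refine ⟨c⁻¹ • w i, Submodule.smul_mem _ _ (Submodule.subset_span ⟨i, rfl⟩), ?_⟩
      rw [← dvd_neg, neg_sub]
      have := dvd_smul_of_dvd c⁻¹ hd
      rwa [smul_sub, ← Algebra.smul_def, smul_smul, inv_mul_cancel₀ hc, one_smul] at this

/-- The tensor product of two unipotent Jordan blocks of sizes `a` and `b`, as a module over the
generator `g`, is an algebra generated by `x` and `y` with `x ^ a = 0` and `y ^ b = 0`, in which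
`g - 1` is `x + y` up to a unit. Here `x = g ⊗ 1 - 1` and `y = 1 - 1 ⊗ g⁻¹`. Modulo `x + y` this
algebra is spanned by `1, y, …, y ^ (b - 1)`, so elements `w i` that represent these powers up to
scalars exhibit the decomposition as soon as their annihilators allow it. -/
theorem exists_tensor_model {a b : ℕ}
    (ha : (Polynomial.X - Polynomial.C 1) ^ a ∣ (Polynomial.X ^ Nat.card G - 1 : k[X]))
    (hb : (Polynomial.X - Polynomial.C 1) ^ b ∣ (Polynomial.X ^ Nat.card G - 1 : k[X])) :
    ∃ (A : Type (max u v)) (_ : CommRing A) (_ : Algebra k A) (x y : A), x ^ a = 0 ∧ y ^ b = 0 ∧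
      ∀ (ι : Type) [Fintype ι] (s : ι → ℕ) (w : ι → A), (∀ i, (x + y) ^ s i * w i = 0) →
        ∑ i, s i ≤ a * b →
        (∀ j < b, ∃ i, ∃ c : k, c ≠ 0 ∧ x + y ∣ w i - algebraMap k A c * y ^ j) →
        jordan hg (1 : k) a * jordan hg 1 b = ∑ i, jordan hg 1 (s i) := by
  have hd := Module.finrank_tensorProduct (R := k) (S := k)
    (M := (FinRep.cyc hg ((Polynomial.X - Polynomial.C (1 : k)) ^ a)).V)
    (M' := (FinRep.cyc hg ((Polynomial.X - Polynomial.C (1 : k)) ^ b)).V)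
  rw [finrank_jordan hg ha, finrank_jordan hg hb] at hd
  rw [jordan_mul]
  exact exists_tensor_model_aux hg _ _ _ _ _ (uroot_pow _ _) (uroot_sub_pow _ 1 a)
    (uroot_sub_pow _ 1 b) (exists_aeval_uroot_sub _ _ 1) (exists_aeval_uroot_sub _ _ 1) hd

end RepRing

/-! ### Products of unipotent Jordan blocks in positive characteristic -/

theorem sub_pow_succ_of_sq_eq_zero {R : Type*} [CommRing R] (t : R) {s : R} (hs : s * s = 0)
    (n : ℕ) : (t - s) ^ (n + 1) = t ^ (n + 1) - (n + 1 : ℕ) * t ^ n * s := by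
  induction n with
  | zero => simp
  | succ n ih =>
    rw [pow_succ, ih]
    push_cast
    linear_combination ((n : R) + 1) * t ^ n * hs

theorem add_pow_prime_pow_of_algebra (k : Type*) [Field k] {R : Type*} [CommRing R] [Algebra k R]
    {p : ℕ} (hp : p.Prime) [CharP k p] (x y : R) (j : ℕ) :
    (x + y) ^ p ^ j = x ^ p ^ j + y ^ p ^ j := by
  nontriviality R
  have := charP_of_injective_algebraMap (algebraMap k R).injective p
  have := Fact.mk hp
  exact add_pow_char_pow x y p j

/-- Relations in an algebra of characteristic `p` generated by `x` and `y` with `x ^ (a q + 1) = 0`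
and `y ^ (q + 1) = 0`, where `q = q' + 2` is a power of `p` and `a = a' + 1`. They bound the orders
of the generators used to decompose `V_{aq+1} ⊗ V_{q+1}`. -/
theorem tensor_relations {R : Type*} [CommRing R] {x y : R} {q q' a' : ℕ} (hq : q = q' + 2)
    (hx : x ^ ((a' + 1) * q + 1) = 0) (hy : y ^ (q + 1) = 0)
    (hxy : (x + y) ^ q = x ^ q + y ^ q) :
    (∀ i, (x + y) ^ ((a' + 1) * q) * (x * y ^ (i + 1)) = 0) ∧
    (x + y) ^ (a' * q + 1) * ((x + y) ^ q - (x + y) ^ (q' + 1) * y - (a' + 1 : ℕ) * y ^ q) = 0 ∧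
    (x + y) ^ ((a' + 2) * q) = (a' + 2 : ℕ) * ((x + y) ^ ((a' + 1) * q) * y ^ q) ∧
    (x + y) ^ ((a' + 1) * q + (q' + 1)) * y = (x + y) ^ ((a' + 1) * q) * y ^ q := by
  set T := x + y with hT
  have hyy : y ^ q * y ^ q = 0 := by
    rw [← pow_add]
    exact pow_eq_zero_of_le (by omega) hy
  have hxT : x ^ ((a' + 1) * q)
      = T ^ ((a' + 1) * q) - (a' + 1 : ℕ) * T ^ (a' * q) * y ^ q := by
    have h := sub_pow_succ_of_sq_eq_zero (T ^ q) hyy a'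
    rw [hxy, add_sub_cancel_right, ← hxy, ← pow_mul, ← pow_mul, ← pow_mul, mul_comm q,
      mul_comm q] at h
    exact h
  have h1 : ∀ i, T ^ ((a' + 1) * q) * (x * y ^ (i + 1)) = 0 := fun i => by
    have hyi : y ^ q * y ^ (i + 1) = 0 := by
      rw [← pow_add]
      exact pow_eq_zero_of_le (by omega) hy
    rw [pow_succ] at hx
    linear_combination (-x * y ^ (i + 1)) * hxT + y ^ (i + 1) * hx
      + (a' + 1 : ℕ) * T ^ (a' * q) * x * hyi
  have h2 : T ^ ((a' + 1) * q + 1) - T ^ ((a' + 1) * q) * y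
      - (a' + 1 : ℕ) * T ^ (a' * q + 1) * y ^ q = 0 := by
    rw [pow_succ] at hx hy
    rw [pow_succ, pow_succ]
    have hx' : x = T - y := by rw [hT, add_sub_cancel_right]
    have h := hx
    rw [hxT] at h
    linear_combination h + ((a' + 1 : ℕ) * T ^ (a' * q) * y ^ q
      - T ^ ((a' + 1) * q)) * hx' - ((a' + 1 : ℕ) * T ^ (a' * q)) * hy
  have h3 : ∀ s, T ^ ((a' + 1) * q + s) * y = T ^ ((a' + 1) * q) * y ^ (s + 1) := by
    intro s
    induction s with
    | zero => rw [add_zero, zero_add, pow_one]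
    | succ s ih =>
      have hT' : T = x + y := hT
      rw [← add_assoc, pow_succ T]
      linear_combination T * ih + h1 s + T ^ ((a' + 1) * q) * y ^ (s + 1) * hT'
  have h4 := h3 (q' + 1)
  rw [show q' + 1 + 1 = q by omega] at h4
  refine ⟨h1, ?_, ?_, h4⟩
  · have e1 : T ^ ((a' + 1) * q + 1) = T ^ (a' * q + 1) * T ^ q := by
      rw [← pow_add]; congr 1; ring
    have e2 : T ^ ((a' + 1) * q) = T ^ (a' * q + 1) * T ^ (q' + 1) := by
      rw [← pow_add, hq]; congr 1; ring
    rw [e1, e2] at h2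
    linear_combination h2
  · have e1 : T ^ ((a' + 2) * q) = T ^ ((a' + 1) * q + 1) * T ^ (q' + 1) := by
      rw [← pow_add, hq]; congr 1; ring
    have e2 : T ^ ((a' + 1) * q) = T ^ (a' * q + 1) * T ^ (q' + 1) := by
      rw [← pow_add, hq]; congr 1; ring
    have e3 : T ^ ((a' + 1) * q + (q' + 1)) = T ^ ((a' + 1) * q) * T ^ (q' + 1) := pow_add ..
    rw [e3] at h4
    rw [e1]
    push_cast at h2 ⊢
    linear_combination T ^ (q' + 1) * h2 + h4 - ((a' : R) + 1) * y ^ q * e2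

namespace RepRing

variable {k : Type u} {G : Type v} [Field k] [Group G] [Finite G]
variable {g : G} (hg : ∀ x, x ∈ Subgroup.zpowers g) {P : ℕ}
  (hP : (Polynomial.X - Polynomial.C 1) ^ P ∣ (Polynomial.X ^ Nat.card G - 1 : k[X]))
  {p : ℕ} [CharP k p]

include hP

/-- `V_b ⊗ V_2 = V_{b+1} ⊕ V_{b-1}` for `1 ≤ b < p`. -/
theorem jordan_mul_two {b : ℕ} (hb : b + 1 < p) (h : b + 2 ≤ P) :
    jordan hg (1 : k) (b + 1) * jordan hg (1 : k) 2
      = jordan hg (1 : k) (b + 2) + jordan hg (1 : k) b := by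
  obtain ⟨A, _, _, x, y, hx, hy, H⟩ := exists_tensor_model hg
    ((pow_dvd_pow _ (show b + 1 ≤ P by omega)).trans hP)
    ((pow_dvd_pow _ (show 2 ≤ P by omega)).trans hP)
  -- the element `T - (b + 1) y`, where `T = x + y`, is killed by `T ^ b`, as `y ^ 2 = 0`
  have hrel : (x + y) ^ (b + 1) - (b + 1 : ℕ) * (x + y) ^ b * y = 0 := by
    rw [← sub_pow_succ_of_sq_eq_zero (x + y) (by rw [← sq, hy]) b, add_sub_cancel_right, hx]
  rw [H (Fin 2) ![b + 2, b] ![1, x + y - (b + 1 : ℕ) * y] ?_ ?_ ?_]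
  · simp
  · intro i
    fin_cases i
    · change (x + y) ^ (b + 2) * 1 = 0
      rw [mul_one]
      exact (Commute.all x y).add_pow_eq_zero_of_add_le_succ_of_pow_eq_zero hx hy (by omega)
    · change (x + y) ^ b * (x + y - (b + 1 : ℕ) * y) = 0
      rw [pow_succ] at hrel
      linear_combination hrel
  · rw [Fin.sum_univ_two]
    change b + 2 + b ≤ _
    omega
  · intro i hi
    interval_cases i
    · exact ⟨0, 1, one_ne_zero, by simp⟩
    · refine ⟨1, -((b + 1 : ℕ) : k), ?_, 1, ?_⟩
      · rw [neg_ne_zero, Ne, CharP.cast_eq_zero_iff k p]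
        exact Nat.not_dvd_of_pos_of_lt (by omega) hb
      · change x + y - (b + 1 : ℕ) * y - algebraMap k A (-((b + 1 : ℕ) : k)) * y ^ 1 = _
        rw [map_neg, map_natCast]
        ring

variable (hp : p.Prime)

include hp

/-- `V_{aq+1} ⊗ V_r = (r - 1) V_{aq} ⊕ V_{aq+r}` for `1 ≤ r ≤ q`, where `q` is a power of `p`. -/
theorem jordan_mul_jordan_of_le {j a r : ℕ} (hr : r + 1 ≤ p ^ j) (h : a * p ^ j + 1 ≤ P)
    (hrP : r + 1 ≤ P) :
    jordan hg (1 : k) (a * p ^ j + 1) * jordan hg (1 : k) (r + 1)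
      = (r : RepRing k G) * jordan hg (1 : k) (a * p ^ j)
        + jordan hg (1 : k) (a * p ^ j + (r + 1)) := by
  obtain ⟨A, _, _, x, y, hx, hy, H⟩ := exists_tensor_model hg
    ((pow_dvd_pow _ h).trans hP) ((pow_dvd_pow _ hrP).trans hP)
  have hT : (x + y) ^ (a * p ^ j) = x ^ (a * p ^ j) := by
    rw [mul_comm, pow_mul, add_pow_prime_pow_of_algebra k hp, pow_eq_zero_of_le hr hy, add_zero,
      ← pow_mul]
  -- the generators are `1` and `x y ^ i` for `i + 1 < r`, which is `-y ^ (i + 1)` modulo `x + y`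
  have hxx : x ^ (a * p ^ j) * x = 0 := by rw [← pow_succ, hx]
  rw [H (Option (Fin r)) (fun i => i.elim (a * p ^ j + (r + 1)) fun _ => a * p ^ j)
    (fun i => i.elim 1 fun i => x * y ^ (i : ℕ)) ?_ ?_ ?_]
  · simp [add_comm]
  · rintro (_ | i)
    · change (x + y) ^ (a * p ^ j + (r + 1)) * 1 = 0
      obtain ⟨z, hz⟩ : x ∣ (x + y) ^ (r + 1) - y ^ (r + 1) := by
        have := sub_dvd_pow_sub_pow (x + y) y (r + 1)
        rwa [add_sub_cancel_right] at this
      rw [hy, sub_zero] at hz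
      rw [mul_one, pow_add, hT, hz, ← mul_assoc, hxx, zero_mul]
    · change (x + y) ^ (a * p ^ j) * (x * y ^ (i : ℕ)) = 0
      rw [hT, ← mul_assoc, hxx, zero_mul]
  · simp only [Fintype.sum_option, Option.elim, Finset.sum_const, Finset.card_univ,
      Fintype.card_fin, smul_eq_mul]
    apply le_of_eq
    ring
  · rintro (_ | i) hi
    · exact ⟨none, 1, one_ne_zero, by simp⟩
    · refine ⟨some ⟨i, by omega⟩, -1, neg_ne_zero.2 one_ne_zero, y ^ i, ?_⟩
      simp only [Option.elim, map_neg, map_one]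
      ring

/-- `V_q ⊗ V_r = r V_q` for `r ≤ q`, where `q` is a power of `p`. -/
theorem jordan_prime_pow_mul {j r : ℕ} (hr : r ≤ p ^ j) (h : p ^ j ≤ P) :
    jordan hg (1 : k) (p ^ j) * jordan hg (1 : k) r
      = (r : RepRing k G) * jordan hg (1 : k) (p ^ j) := by
  obtain ⟨A, _, _, x, y, hx, hy, H⟩ := exists_tensor_model hg
    ((pow_dvd_pow _ h).trans hP) ((pow_dvd_pow _ (hr.trans h)).trans hP)
  have hT : (x + y) ^ (p ^ j) = 0 := by
    rw [add_pow_prime_pow_of_algebra k hp, hx, pow_eq_zero_of_le hr hy, add_zero]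
  rw [H (Fin r) (fun i => p ^ j) (fun i => y ^ (i : ℕ)) (fun i => by rw [hT, zero_mul]) ?_ ?_]
  · simp
  · simp [mul_comm]
  · exact fun i hi => ⟨⟨i, hi⟩, 1, one_ne_zero, by simp⟩

/-- `V_{q-1} ⊗ V_{q-1} = (q - 2) V_q ⊕ V_1`, where `q ≥ 2` is a power of `p`. -/
theorem jordan_pred_mul_self {j r : ℕ} (hr : p ^ j = r + 2) (h : p ^ j ≤ P) :
    jordan hg (1 : k) (r + 1) * jordan hg (1 : k) (r + 1)
      = (r : RepRing k G) * jordan hg (1 : k) (p ^ j) + jordan hg (1 : k) 1 := by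
  have h1 := (pow_dvd_pow _ (show r + 1 ≤ P by omega)).trans hP
  obtain ⟨A, _, _, x, y, hx, hy, H⟩ := exists_tensor_model hg h1 h1
  have hT : (x + y) ^ (p ^ j) = 0 := by
    rw [add_pow_prime_pow_of_algebra k hp, pow_eq_zero_of_le (by omega) hx,
      pow_eq_zero_of_le (by omega) hy, add_zero]
  -- the generators are `y ^ i` for `i ≤ q - 3` and the sum `(x ^ (q-1) - (-y) ^ (q-1)) / (x + y)`
  have hgeom := geom_sum₂_mul x (-y) (r + 1)
  rw [hx, neg_pow, hy, mul_zero, sub_zero, sub_neg_eq_add] at hgeom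
  rw [H (Option (Fin r)) (fun i => i.elim 1 fun _ => p ^ j)
    (fun i => i.elim (∑ i ∈ Finset.range (r + 1), x ^ i * (-y) ^ (r + 1 - 1 - i))
      fun i => y ^ (i : ℕ)) ?_ ?_ ?_]
  · simp [add_comm]
  · rintro (_ | i)
    · simp only [Option.elim, pow_one]
      rw [mul_comm, hgeom]
    · simp only [Option.elim]
      rw [hT, zero_mul]
  · simp only [Fintype.sum_option, Option.elim, Finset.sum_const, Finset.card_univ,
      Fintype.card_fin, smul_eq_mul, hr]
    apply le_of_eq
    ring
  · intro i hi
    rcases Nat.lt_or_ge i r with hir | hir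
    · exact ⟨some ⟨i, hir⟩, 1, one_ne_zero, by simp⟩
    · obtain rfl : i = r := by omega
      -- modulo `x + y` the geometric sum is `(q - 1) (-y) ^ (q - 2)`, and `q - 1 ≠ 0` in `k`
      refine ⟨none, (i + 1 : ℕ) * (-1) ^ i, mul_ne_zero ?_ (by simp), ?_⟩
      · intro h0
        rw [CharP.cast_eq_zero_iff k p] at h0
        have hj : j ≠ 0 := by rintro rfl; rw [pow_zero] at hr; omega
        have h2 : p ∣ i + 2 := hr ▸ dvd_pow_self p hj
        have h3 : p ∣ 1 := by
          rw [show 1 = i + 2 - (i + 1) by omega]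
          exact Nat.dvd_sub h2 h0
        exact hp.one_lt.ne' (Nat.dvd_one.1 h3)
      · simp only [Option.elim, map_mul, map_natCast, map_pow, map_neg, map_one]
        have : ((i + 1 : ℕ) : A) * (-1) ^ i * y ^ i
            = ∑ s ∈ Finset.range (i + 1), (-y) ^ s * (-y) ^ (i + 1 - 1 - s) := by
          have hc : ∀ s ∈ Finset.range (i + 1), (-y) ^ s * (-y) ^ (i + 1 - 1 - s) = (-y) ^ i := by
            intro s hs
            have := Finset.mem_range.1 hs
            rw [← pow_add]
            congr 1
            omega
          rw [Finset.sum_congr rfl hc, Finset.sum_const, Finset.card_range, nsmul_eq_mul,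
            neg_pow y, mul_assoc]
        rw [this, ← Finset.sum_sub_distrib]
        refine Finset.dvd_sum fun s _ => ?_
        rw [← sub_mul]
        refine Dvd.dvd.mul_right ?_ _
        have := sub_dvd_pow_sub_pow x (-y) s
        rwa [sub_neg_eq_add] at this

/-- `V_{aq+1} ⊗ V_{q+1} = V_{(a-1)q+1} ⊕ (q - 2) V_{aq} ⊕ V_{(a+1)q+1} ⊕ V_{(a+1)q-1}` for
`1 ≤ a ≤ p - 2`, where `q ≥ 2` is a power of `p`. -/
theorem jordan_mul_succ {j q' a' : ℕ} (hq : p ^ j = q' + 2) (ha : a' + 2 < p)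
    (h : (a' + 1) * p ^ j + 1 ≤ P) :
    jordan hg (1 : k) ((a' + 1) * p ^ j + 1) * jordan hg (1 : k) (p ^ j + 1)
      = jordan hg (1 : k) (a' * p ^ j + 1)
        + (q' : RepRing k G) * jordan hg (1 : k) ((a' + 1) * p ^ j)
        + jordan hg (1 : k) ((a' + 2) * p ^ j + 1)
        + jordan hg (1 : k) ((a' + 1) * p ^ j + (q' + 1)) := by
  obtain ⟨A, _, _, x, y, hx, hy, H⟩ := exists_tensor_model hg
    ((pow_dvd_pow _ h).trans hP)
    ((pow_dvd_pow _ (show p ^ j + 1 ≤ P by nlinarith)).trans hP)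
  obtain ⟨h1, h2, h3, h4⟩ := tensor_relations hq hx hy (add_pow_prime_pow_of_algebra k hp x y j)
  have hcast : ∀ c : ℕ, 0 < c → c < p → (-(c : k)) ≠ 0 := fun c hc hcp => by
    rw [neg_ne_zero, Ne, CharP.cast_eq_zero_iff k p]
    exact Nat.not_dvd_of_pos_of_lt hc hcp
  -- With `T = x + y` and `a = a' + 1`, the generators are `x y ^ i` for `1 ≤ i ≤ q - 2`,
  -- `T ^ q - T ^ (q - 1) y - a y ^ q`, `1` and `T - (a + 1) y`. Modulo `T` they are multiples of
  -- `y ^ 2, …, y ^ (q - 1)`, `y ^ q`, `1` and `y` by scalars, which are nonzero since `a + 1 < p`.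
  rw [H (Fin q' ⊕ Fin 3) (Sum.elim (fun _ => (a' + 1) * p ^ j)
      ![a' * p ^ j + 1, (a' + 2) * p ^ j + 1, (a' + 1) * p ^ j + (q' + 1)])
    (Sum.elim (fun i => x * y ^ ((i : ℕ) + 1))
      ![(x + y) ^ p ^ j - (x + y) ^ (q' + 1) * y - (a' + 1 : ℕ) * y ^ p ^ j, 1,
        x + y - (a' + 2 : ℕ) * y]) ?_ ?_ ?_]
  · rw [Fintype.sum_sum_type, Fin.sum_univ_three]
    simp
    ring
  · rintro (i | i)
    · exact h1 i
    · fin_cases i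
      · exact h2
      · change (x + y) ^ ((a' + 2) * p ^ j + 1) * 1 = 0
        have h5 := h1 (q' + 1)
        have h6 : y ^ p ^ j * y = 0 := by rw [← pow_succ, hy]
        rw [← hq.trans rfl] at h5
        rw [pow_succ, h3]
        linear_combination (a' + 2 : ℕ) * h5 + (a' + 2 : ℕ) * (x + y) ^ ((a' + 1) * p ^ j) * h6
      · change (x + y) ^ ((a' + 1) * p ^ j + (q' + 1)) * (x + y - (a' + 2 : ℕ) * y) = 0
        have e : (x + y) ^ ((a' + 2) * p ^ j)
            = (x + y) ^ ((a' + 1) * p ^ j + (q' + 1)) * (x + y) := by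
          rw [← pow_succ, hq]; congr 1; ring
        rw [e] at h3
        linear_combination h3 - (a' + 2 : ℕ) * h4
  · rw [Fintype.sum_sum_type, Fin.sum_univ_three]
    simp only [Sum.elim_inl, Sum.elim_inr, Finset.sum_const, Finset.card_univ, Fintype.card_fin,
      smul_eq_mul, Matrix.cons_val]
    rw [hq]
    apply le_of_eq
    ring
  · intro i hi
    rcases Nat.lt_or_ge i 1 with h0 | h0
    · obtain rfl : i = 0 := by omega
      exact ⟨Sum.inr 1, 1, one_ne_zero, by simp⟩
    obtain ⟨i, rfl⟩ := Nat.exists_eq_add_of_le' h0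
    rcases Nat.lt_or_ge i 1 with h0' | h0'
    · obtain rfl : i = 0 := by omega
      refine ⟨Sum.inr 2, -((a' + 2 : ℕ) : k), hcast _ (by omega) ha, 1, ?_⟩
      change x + y - (a' + 2 : ℕ) * y - algebraMap k A (-((a' + 2 : ℕ) : k)) * y ^ 1 = _
      rw [map_neg, map_natCast]
      ring
    obtain ⟨i, rfl⟩ := Nat.exists_eq_add_of_le' h0'
    rcases Nat.lt_or_ge i q' with h0'' | h0''
    · refine ⟨Sum.inl ⟨i, h0''⟩, -1, neg_ne_zero.2 one_ne_zero, y ^ (i + 1), ?_⟩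
      simp only [Sum.elim_inl, map_neg, map_one]
      ring
    · obtain rfl : i = q' := by omega
      refine ⟨Sum.inr 0, -((a' + 1 : ℕ) : k), hcast _ (by omega) (by omega),
        (x + y) ^ (i + 1) - (x + y) ^ i * y, ?_⟩
      change (x + y) ^ p ^ j - (x + y) ^ (i + 1) * y - (a' + 1 : ℕ) * y ^ p ^ j
        - algebraMap k A (-((a' + 1 : ℕ) : k)) * y ^ (i + 2) = _
      rw [map_neg, map_natCast, hq]
      ring

/-- `V_{(p-1)q+1} ⊗ V_{q+1} = V_{(p-2)q+1} ⊕ (q - 2) V_{(p-1)q} ⊕ 2 V_{pq}`, where `q ≥ 2` is a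
power of `p`. -/
theorem jordan_mul_succ_of_add_two_eq {j q' a' : ℕ} (hq : p ^ j = q' + 2) (ha : a' + 2 = p)
    (h : (a' + 1) * p ^ j + 1 ≤ P) :
    jordan hg (1 : k) ((a' + 1) * p ^ j + 1) * jordan hg (1 : k) (p ^ j + 1)
      = jordan hg (1 : k) (a' * p ^ j + 1)
        + (q' : RepRing k G) * jordan hg (1 : k) ((a' + 1) * p ^ j)
        + 2 * jordan hg (1 : k) ((a' + 2) * p ^ j) := by
  obtain ⟨A, _, _, x, y, hx, hy, H⟩ := exists_tensor_model hg
    ((pow_dvd_pow _ h).trans hP)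
    ((pow_dvd_pow _ (show p ^ j + 1 ≤ P by nlinarith)).trans hP)
  obtain ⟨h1, h2, h3, h4⟩ := tensor_relations hq hx hy (add_pow_prime_pow_of_algebra k hp x y j)
  have hp0 : ((a' + 2 : ℕ) : A) = 0 := by
    rw [ha, ← map_natCast (algebraMap k A), CharP.cast_eq_zero, map_zero]
  rw [hp0, zero_mul] at h3
  -- now `a + 1 = p`, so `T - (a + 1) y` is replaced by `y`, and `T ^ (p q) = 0`
  rw [H (Fin q' ⊕ Fin 3) (Sum.elim (fun _ => (a' + 1) * p ^ j)
      ![a' * p ^ j + 1, (a' + 2) * p ^ j, (a' + 2) * p ^ j])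
    (Sum.elim (fun i => x * y ^ ((i : ℕ) + 1))
      ![(x + y) ^ p ^ j - (x + y) ^ (q' + 1) * y - (a' + 1 : ℕ) * y ^ p ^ j, 1, y]) ?_ ?_ ?_]
  · rw [Fintype.sum_sum_type, Fin.sum_univ_three]
    simp
    ring
  · rintro (i | i)
    · exact h1 i
    · fin_cases i
      · exact h2
      · change (x + y) ^ ((a' + 2) * p ^ j) * 1 = 0
        rw [h3, zero_mul]
      · change (x + y) ^ ((a' + 2) * p ^ j) * y = 0
        rw [h3, zero_mul]
  · rw [Fintype.sum_sum_type, Fin.sum_univ_three]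
    simp only [Sum.elim_inl, Sum.elim_inr, Finset.sum_const, Finset.card_univ, Fintype.card_fin,
      smul_eq_mul, Matrix.cons_val]
    rw [hq]
    apply le_of_eq
    ring
  · intro i hi
    rcases Nat.lt_or_ge i 1 with h0 | h0
    · obtain rfl : i = 0 := by omega
      exact ⟨Sum.inr 1, 1, one_ne_zero, by simp⟩
    obtain ⟨i, rfl⟩ := Nat.exists_eq_add_of_le' h0
    rcases Nat.lt_or_ge i 1 with h0' | h0'
    · obtain rfl : i = 0 := by omega
      exact ⟨Sum.inr 2, 1, one_ne_zero, by simp⟩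
    obtain ⟨i, rfl⟩ := Nat.exists_eq_add_of_le' h0'
    rcases Nat.lt_or_ge i q' with h0'' | h0''
    · refine ⟨Sum.inl ⟨i, h0''⟩, -1, neg_ne_zero.2 one_ne_zero, y ^ (i + 1), ?_⟩
      simp only [Sum.elim_inl, map_neg, map_one]
      ring
    · obtain rfl : i = q' := by omega
      refine ⟨Sum.inr 0, -((a' + 1 : ℕ) : k), ?_, (x + y) ^ (i + 1) - (x + y) ^ i * y, ?_⟩
      · rw [neg_ne_zero, Ne, CharP.cast_eq_zero_iff k p]
        exact Nat.not_dvd_of_pos_of_lt (by omega) (by omega)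
      change (x + y) ^ p ^ j - (x + y) ^ (i + 1) * y - (a' + 1 : ℕ) * y ^ p ^ j
        - algebraMap k A (-((a' + 1 : ℕ) : k)) * y ^ (i + 2) = _
      rw [map_neg, map_natCast, hq]
      ring

end RepRing

/-! ### Quantum numbers in rings with Green's relations -/

section quantumAt

variable {A B : Type*} [CommRing A] [CommRing B]

theorem quantumAt_zero (x : A) : quantumAt 0 x = 0 := by
  rw [quantumAt, quantumNumber_zero, map_zero]

theorem quantumAt_one (x : A) : quantumAt 1 x = 1 := by
  rw [quantumAt, quantumNumber_one, map_one]

theorem quantumAt_eq (n : ℤ) (x : A) :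
    quantumAt n x = x * quantumAt (n - 1) x - quantumAt (n - 2) x := by
  rw [quantumAt, quantumNumber_eq, map_sub, map_mul, Polynomial.aeval_X]
  rfl

theorem quantumAt_natCast_add_two (n : ℕ) (x : A) :
    quantumAt ((n + 2 : ℕ) : ℤ) x
      = x * quantumAt ((n + 1 : ℕ) : ℤ) x - quantumAt (n : ℤ) x := by
  rw [quantumAt_eq]
  congr 3 <;> push_cast <;> ring

theorem map_quantumAt (f : A →+* B) (n : ℤ) (x : A) :
    f (quantumAt n x) = quantumAt n (f x) :=
  (Polynomial.aeval_algHom_apply f.toIntAlgHom x (quantumNumber n)).symm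

theorem map_relatorD (f : A →+* B) (p : ℕ) {α : ℕ} (x : Fin α → A) (j : ℕ) (hj : j ≤ α) :
    f (relatorD p x j hj) = relatorD p (f ∘ x) j hj := by
  induction j with
  | zero => exact map_one f
  | succ j ih =>
    rw [relatorD, relatorD, map_sub, map_mul, ih, map_quantumAt, map_quantumAt]
    rfl

theorem map_relator (f : A →+* B) (p : ℕ) {α : ℕ} (x : Fin α → A) (j : Fin α) :
    f (relator p x j) = relator p (f ∘ x) j := by
  rw [relator, relator]
  split_ifs with h
  · exact map_quantumAt f _ _
  · rw [relatorF, relatorF, map_mul, map_sub, map_mul, map_quantumAt, map_relatorD, map_ofNat]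
    rfl

theorem quantumAt_mem {S : Subring A} {x : A} (hx : x ∈ S) (n : ℤ) : quantumAt n x ∈ S := by
  have := map_quantumAt S.subtype n ⟨x, hx⟩
  rw [Subring.subtype_apply, Subring.subtype_apply] at this
  exact this ▸ (quantumAt n (⟨x, hx⟩ : S)).2

end quantumAt

/-- Multiplication rules satisfied by the classes `v r` of the unipotent Jordan blocks of sizes
`r ≤ P` in characteristic `p`, with indices shifted so as to avoid subtraction: `r + 1` and `a + 1`
stand for the positive numbers, and `q + 2` for the power `p ^ j ≥ 2`. -/
structure GreenRelations {R : Type*} [CommRing R] (p P : ℕ) (v : ℕ → R) : Prop where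
  zero : v 0 = 0
  one : v 1 = 1
  mul_two : ∀ b, b + 1 < p → b + 2 ≤ P → v (b + 1) * v 2 = v (b + 2) + v b
  mul_of_le : ∀ j a r, r + 1 ≤ p ^ j → a * p ^ j + 1 ≤ P → r + 1 ≤ P →
    v (a * p ^ j + 1) * v (r + 1) = r * v (a * p ^ j) + v (a * p ^ j + (r + 1))
  prime_pow_mul : ∀ j r, r ≤ p ^ j → p ^ j ≤ P → v (p ^ j) * v r = r * v (p ^ j)
  pred_mul_self : ∀ j r, p ^ j = r + 2 → p ^ j ≤ P →
    v (r + 1) * v (r + 1) = r * v (p ^ j) + v 1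
  mul_succ : ∀ j q a, p ^ j = q + 2 → a + 2 < p → (a + 1) * p ^ j + 1 ≤ P →
    v ((a + 1) * p ^ j + 1) * v (p ^ j + 1) = v (a * p ^ j + 1) + q * v ((a + 1) * p ^ j)
      + v ((a + 2) * p ^ j + 1) + v ((a + 1) * p ^ j + (q + 1))
  mul_succ_of_add_two_eq : ∀ j q a, p ^ j = q + 2 → a + 2 = p → (a + 1) * p ^ j + 1 ≤ P →
    v ((a + 1) * p ^ j + 1) * v (p ^ j + 1) = v (a * p ^ j + 1) + q * v ((a + 1) * p ^ j)
      + 2 * v ((a + 2) * p ^ j)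

namespace GreenRelations

variable {R : Type*} [CommRing R] {p P : ℕ} {v : ℕ → R}

theorem map {R' : Type*} [CommRing R'] (f : R →+* R') (h : GreenRelations p P v) :
    GreenRelations p P (fun r => f (v r)) where
  zero := by rw [h.zero, map_zero]
  one := by rw [h.one, map_one]
  mul_two b h1 h2 := by simpa using congrArg f (h.mul_two b h1 h2)
  mul_of_le j a r h1 h2 h3 := by simpa using congrArg f (h.mul_of_le j a r h1 h2 h3)
  prime_pow_mul j r h1 h2 := by simpa using congrArg f (h.prime_pow_mul j r h1 h2)
  pred_mul_self j r h1 h2 := by simpa using congrArg f (h.pred_mul_self j r h1 h2)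
  mul_succ j q a h1 h2 h3 := by simpa using congrArg f (h.mul_succ j q a h1 h2 h3)
  mul_succ_of_add_two_eq j q a h1 h2 h3 := by
    simpa [map_ofNat] using congrArg f (h.mul_succ_of_add_two_eq j q a h1 h2 h3)

/-- The generator `X_j = V_{q+1} - V_{q-1}`, where `q = p ^ j`. -/
def gen (p : ℕ) (v : ℕ → R) (j : ℕ) : R := v (p ^ j + 1) - v (p ^ j - 1)

variable (h : GreenRelations p P v)
include h

theorem gen_zero : gen p v 0 = v 2 := by simp [gen, h.zero]

/-- `V_a = [a]_{X_0}` for `a ≤ p`. -/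
theorem eq_quantumAt (hP : p ≤ P) {a : ℕ} (ha : a ≤ p) :
    v a = quantumAt (a : ℤ) (gen p v 0) := by
  rw [h.gen_zero]
  induction a using Nat.twoStepInduction with
  | zero => rw [h.zero, Nat.cast_zero, quantumAt_zero]
  | one => rw [h.one, Nat.cast_one, quantumAt_one]
  | more b ih1 ih2 =>
    rw [quantumAt_natCast_add_two, ← ih1 (by omega), ← ih2 (by omega)]
    linear_combination - h.mul_two b (by omega) (by omega)

/-- `V_{aq+1} = [a+1]_{X_j} + V_{q-1} [a]_{X_j}` for `a < p`, where `q = p ^ j`. -/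
theorem mul_add_one_eq {j q : ℕ} (hq : p ^ j = q + 2) (hP : p * p ^ j ≤ P) {a : ℕ} (ha : a < p) :
    v (a * p ^ j + 1) = quantumAt ((a + 1 : ℕ) : ℤ) (gen p v j)
      + v (q + 1) * quantumAt (a : ℤ) (gen p v j) := by
  have hgen : gen p v j = v (p ^ j + 1) - v (q + 1) := by rw [gen, hq]; rfl
  induction a using Nat.twoStepInduction with
  | zero => simp [h.one, quantumAt_zero, quantumAt_one]
  | one =>
    rw [quantumAt_natCast_add_two, zero_add, Nat.cast_one, Nat.cast_zero, quantumAt_zero,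
      quantumAt_one, hgen, one_mul]
    ring
  | more a ih1 ih2 =>
    have hle : (a + 1 + 1) * p ^ j ≤ P := (Nat.mul_le_mul_right _ (by omega)).trans hP
    have hle' : (a + 1) * p ^ j + 1 ≤ P := by
      have : 1 ≤ p ^ j := by omega
      nlinarith
    have h1 := h.mul_succ j q a hq ha hle'
    have h2 := h.mul_of_le j (a + 1) q (by omega) hle' (by nlinarith)
    have ih1 := ih1 (by omega)
    have ih2 := ih2 (by omega)
    rw [quantumAt_natCast_add_two a] at ih2 ⊢
    rw [quantumAt_natCast_add_two (a + 1), quantumAt_natCast_add_two a]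
    linear_combination - h1 + h2 + gen p v j * ih2 - ih1 - v ((a + 1) * p ^ j + 1) * hgen

/-- `V_{aq} = [a]_{X_j} V_q` for `a ≤ p`, where `q = p ^ j`. -/
theorem mul_eq {j q : ℕ} (hq : p ^ j = q + 2) (hP : p * p ^ j ≤ P) {a : ℕ} (ha : a ≤ p) :
    v (a * p ^ j) = quantumAt (a : ℤ) (gen p v j) * v (p ^ j) := by
  induction a with
  | zero => simp [h.zero, quantumAt_zero]
  | succ a ih =>
    have hle : (a + 1) * p ^ j ≤ P := (Nat.mul_le_mul_right _ ha).trans hP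
    have hle' : a * p ^ j + 1 ≤ P := by
      have : 1 ≤ p ^ j := by omega
      nlinarith
    have h0 := h.prime_pow_mul j (q + 1) (by omega) (by nlinarith)
    have h1 := h.mul_of_le j a (q + 1) (by omega) hle' (by nlinarith)
    have h2 := h.mul_add_one_eq hq hP (a := a) (by omega)
    have h3 := ih (by omega)
    rw [show q + 1 + 1 = p ^ j by omega, show a * p ^ j + p ^ j = (a + 1) * p ^ j by ring] at h1
    push_cast at h0 h1
    linear_combination - h1 + v (p ^ j) * h2 + ((q : R) + 1) * (-h3)
      + quantumAt (a : ℤ) (gen p v j) * h0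

/-- `V_{pq-1} = [p]_{X_j} V_{q-1} + [p-1]_{X_j}`, where `q = p ^ j`. -/
theorem pred_eq {j q a : ℕ} (hq : p ^ j = q + 2) (hP : p * p ^ j ≤ P) (ha : a + 1 = p) :
    v (a * p ^ j + (q + 1)) = quantumAt (p : ℤ) (gen p v j) * v (q + 1)
      + quantumAt (a : ℤ) (gen p v j) := by
  have hle : (a + 1) * p ^ j ≤ P := (Nat.mul_le_mul_right _ ha.le).trans hP
  have hle' : a * p ^ j + 1 ≤ P := by
    have : 1 ≤ p ^ j := by omega
    nlinarith
  have h1 := h.mul_of_le j a q (by omega) hle' (by nlinarith)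
  have h2 := h.mul_add_one_eq hq hP (a := a) (by omega)
  have h3 := h.mul_eq hq hP (a := a) (by omega)
  have h4 := h.pred_mul_self j q hq (by nlinarith)
  rw [h.one] at h4
  rw [ha] at h2
  linear_combination - h1 + v (q + 1) * h2 - (q : R) * h3 + quantumAt (a : ℤ) (gen p v j) * h4

/-- `X_j [p]_{X_j} = 2 (V_q - V_{q-1}) [p]_{X_j}`, where `q = p ^ j`. -/
theorem gen_mul_quantumAt (hp : 2 ≤ p) {j q : ℕ} (hq : p ^ j = q + 2) (hP : p * p ^ j ≤ P) :
    (gen p v j - 2 * (v (p ^ j) - v (q + 1))) * quantumAt (p : ℤ) (gen p v j) = 0 := by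
  obtain ⟨a, rfl⟩ := Nat.exists_eq_add_of_le' hp
  have hgen : gen (a + 2) v j = v ((a + 2) ^ j + 1) - v (q + 1) := by rw [gen, hq]; rfl
  have hle : (a + 1) * (a + 2) ^ j + 1 ≤ P := by
    have : 1 ≤ (a + 2) ^ j := by omega
    nlinarith
  have h1 := h.mul_succ_of_add_two_eq j q a hq rfl hle
  have h2 := h.mul_of_le j (a + 1) q (by omega) hle (by nlinarith)
  have h3 := h.pred_eq hq hP (a := a + 1) rfl
  have h4 := h.mul_add_one_eq hq hP (a := a + 1) (by omega)
  have h5 := h.mul_add_one_eq hq hP (a := a) (by omega)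
  have h6 := h.mul_eq hq hP (a := a + 2) le_rfl
  rw [quantumAt_natCast_add_two a] at h3 h4 h6 ⊢
  linear_combination h1 - h2 - h3 - gen (a + 2) v j * h4 + h5 + 2 * h6
    + v ((a + 1) * (a + 2) ^ j + 1) * hgen

/-- `D_j = V_q - V_{q-1}`, where `q = p ^ j`. -/
theorem relatorD_eq (hp : 2 ≤ p) {α : ℕ} (hα : P = p ^ α) (j : ℕ) (hj : j ≤ α) :
    relatorD p (fun i : Fin α => gen p v i) j hj = v (p ^ j) - v (p ^ j - 1) := by
  obtain ⟨a, ha⟩ := Nat.exists_eq_add_of_le' (show 1 ≤ p by omega)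
  induction j with
  | zero => simp [relatorD, h.one, h.zero]
  | succ j ih =>
    have hP : p * p ^ j ≤ P := by
      rw [hα, ← pow_succ']
      exact Nat.pow_le_pow_right (by omega) hj
    have hcast : ((p : ℤ) - 1) = (a : ℤ) := by rw [ha]; push_cast; ring
    rw [relatorD, ih, hcast]
    rcases Nat.eq_zero_or_pos j with rfl | hj0
    · rw [pow_zero, mul_one] at hP
      have h1 := h.eq_quantumAt hP le_rfl
      have h2 := h.eq_quantumAt hP (a := a) (by omega)
      simp only [pow_zero, zero_add, pow_one, Nat.sub_self, h.zero, h.one, ← h1, ← h2]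
      rw [show p - 1 = a by omega]
      ring
    · have hpj : p ≤ p ^ j := Nat.le_self_pow (by omega) p
      obtain ⟨q, hq⟩ := Nat.exists_eq_add_of_le' (hp.trans hpj)
      have h1 := h.pred_eq hq hP ha.symm
      have h2 := h.mul_eq hq hP le_rfl
      have e : p ^ (j + 1) - 1 = a * p ^ j + (q + 1) := by
        have : p ^ (j + 1) = a * p ^ j + p ^ j := by
          rw [pow_succ', ha]
          ring
        omega
      rw [e, h1, show p ^ j - 1 = q + 1 by omega, pow_succ', h2]
      ring

/-- If `V_p = 0`, then all relators vanish. -/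
theorem relator_eq_zero (hp : 2 ≤ p) {α : ℕ} (hα : P = p ^ α) (hv : α ≠ 0 → v p = 0) (j : Fin α) :
    relator p (fun i : Fin α => gen p v i) j = 0 := by
  have hP : p * p ^ (j : ℕ) ≤ P := by
    rw [hα, ← pow_succ']
    exact Nat.pow_le_pow_right (by omega) j.2
  rw [relator]
  split_ifs with hj
  · rw [hj] at hP ⊢
    rw [pow_zero, mul_one] at hP
    rw [← h.eq_quantumAt hP le_rfl]
    exact hv (by have := j.2; omega)
  · have hpj : p ≤ p ^ (j : ℕ) := Nat.le_self_pow hj p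
    obtain ⟨q, hq⟩ := Nat.exists_eq_add_of_le' (hp.trans hpj)
    have := h.gen_mul_quantumAt hp hq hP
    rw [relatorF, h.relatorD_eq hp hα, show p ^ (j : ℕ) - 1 = q + 1 by omega]
    exact this

/-- The `X_j` generate all `V_r`: for `r = a q + s` with `0 < s < q`, where `q = p ^ j`, the product
`V_{aq+1} V_s` expresses `V_r` in terms of `V_{aq}`, `V_{aq+1}` and `V_s`, and the first two are
obtained from `V_q` and `V_{q-1}` by quantum numbers in `X_j`. -/
theorem mem_of_gen_mem (hp : 2 ≤ p) {α : ℕ} (hα : P = p ^ α) {S : Subring R}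
    (hS : ∀ i < α, gen p v i ∈ S) {r : ℕ} (hr : r ≤ P) : v r ∈ S := by
  suffices H : ∀ j ≤ α, ∀ r ≤ p ^ j, v r ∈ S from H α le_rfl r (hα ▸ hr)
  intro j
  induction j with
  | zero =>
    intro _ r hr
    rw [pow_zero] at hr
    interval_cases r
    · exact h.zero ▸ S.zero_mem
    · exact h.one ▸ S.one_mem
  | succ j ih =>
    intro hj r hr
    have ih := ih (by omega)
    have hg := hS j hj
    have hP : p * p ^ j ≤ P := by
      rw [hα, ← pow_succ']
      exact Nat.pow_le_pow_right (by omega) hj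
    rcases Nat.eq_zero_or_pos j with rfl | hj0
    · rw [pow_zero, mul_one] at hP
      rw [zero_add, pow_one] at hr
      rw [h.eq_quantumAt hP hr]
      exact quantumAt_mem hg _
    · have hpj : p ≤ p ^ j := Nat.le_self_pow (by omega) p
      obtain ⟨q, hq⟩ := Nat.exists_eq_add_of_le' (hp.trans hpj)
      have hmul : ∀ a ≤ p, v (a * p ^ j) ∈ S := fun a ha => by
        rw [h.mul_eq hq hP ha]
        exact S.mul_mem (quantumAt_mem hg _) (ih _ le_rfl)
      obtain ⟨a, s, hs, rfl⟩ : ∃ a s, s < p ^ j ∧ r = a * p ^ j + s :=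
        ⟨r / p ^ j, r % p ^ j, Nat.mod_lt _ (by omega), (Nat.div_add_mod' _ _).symm⟩
      rw [pow_succ'] at hr
      rcases Nat.eq_zero_or_pos s with rfl | hs0
      · exact hmul a (Nat.le_of_mul_le_mul_right hr (by omega))
      · have ha : a < p := by
          by_contra hcon
          have := Nat.mul_le_mul_right (p ^ j) (not_lt.1 hcon)
          omega
        obtain ⟨s, rfl⟩ := Nat.exists_eq_add_of_le' hs0
        have h1 := h.mul_of_le j a s (by omega) (by omega) (by nlinarith)
        rw [← sub_eq_iff_eq_add'.2 h1, h.mul_add_one_eq hq hP ha]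
        refine S.sub_mem (S.mul_mem (S.add_mem (quantumAt_mem hg _)
          (S.mul_mem (ih _ (by omega)) (quantumAt_mem hg _))) (ih _ (by omega)))
          (S.mul_mem (natCast_mem S _) (hmul a ha.le))

end GreenRelations

/-! ### Decomposition into Jordan blocks -/

namespace FinRep

variable {k : Type u} {G : Type v} [Field k] [Group G] [Finite G]
  {g : G} (hg : ∀ x, x ∈ Subgroup.zpowers g)

theorem aeval_mem_of_invariant {V : Type*} [AddCommGroup V] [Module k V] {T : Module.End k V}
    {U : Submodule k V} (hU : ∀ x ∈ U, T x ∈ U) (φ : k[X]) {x : V} (hx : x ∈ U) :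
    Polynomial.aeval T φ x ∈ U := by
  induction φ using Polynomial.induction_on' with
  | add a b ha hb => rw [map_add, LinearMap.add_apply]; exact U.add_mem ha hb
  | monomial i a =>
    rw [Polynomial.aeval_monomial, Module.End.mul_apply, Module.algebraMap_end_apply]
    refine U.smul_mem _ ?_
    induction i with
    | zero => simpa using hx
    | succ i ih => rw [pow_succ', Module.End.mul_apply]; exact hU _ ih

/-- Every representation is a sum of cyclic modules whose moduli are powers of irreducible
polynomials, and these moduli may be replaced by any associated polynomials `f i`. -/
theorem exists_eq_sum_cyc (W : FinRep k G) :
    ∃ (ι : Type u) (_ : Fintype ι) (q : ι → k[X]) (e : ι → ℕ), (∀ i, Irreducible (q i)) ∧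
      (∀ i, q i ^ e i ∣ Polynomial.X ^ Nat.card G - 1) ∧
      ∀ f : ι → k[X], (∀ i, Associated (q i ^ e i) (f i)) →
        RepRing.of (RepClass.mk W) = ∑ i, RepRing.of (RepClass.mk (cyc hg (f i))) := by
  classical
  have hM : (Polynomial.X ^ Nat.card G - 1 : k[X]) ≠ 0 :=
    (Polynomial.monic_X_pow_sub_C (1 : k) Nat.card_pos.ne').ne_zero
  have hkill : ∀ x : Module.AEval' (W.ρ g), (Polynomial.X ^ Nat.card G - 1 : k[X]) • x = 0 := by
    intro x
    obtain ⟨x, rfl⟩ := (Module.AEval'.of (W.ρ g)).surjective x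
    rw [← Module.AEval.of_aeval_smul]
    simp [ρ_pow_card]
  have htors : Module.IsTorsion k[X] (Module.AEval' (W.ρ g)) := fun {x} =>
    ⟨⟨_, mem_nonZeroDivisors_of_ne_zero hM⟩, hkill x⟩
  have : Module.Finite k[X] (Module.AEval' (W.ρ g)) := inferInstance
  obtain ⟨ι, _, q, hq, e, ⟨E⟩⟩ := Module.equiv_directSum_of_isTorsion htors
  have hsmul : ∀ (φ : k[X]) (x : Module.AEval' (W.ρ g)),
      (Module.AEval'.of (W.ρ g)).symm (φ • x)
        = Polynomial.aeval (W.ρ g) φ ((Module.AEval'.of (W.ρ g)).symm x) := by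
    intro φ x
    obtain ⟨x, rfl⟩ := (Module.AEval'.of (W.ρ g)).surjective x
    rw [LinearEquiv.symm_apply_apply, ← Module.AEval.of_aeval_smul]
    exact LinearEquiv.symm_apply_apply _ _
  -- the images of the standard generators
  let y : ι → Module.AEval' (W.ρ g) := fun i =>
    E.symm (DirectSum.lof k[X] ι (fun i => k[X] ⧸ k[X] ∙ q i ^ e i) i (Submodule.Quotient.mk 1))
  have hy : ∀ (i : ι) (φ : k[X]), φ • y i
      = E.symm (DirectSum.lof k[X] ι (fun i => k[X] ⧸ k[X] ∙ q i ^ e i) i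
        (Submodule.Quotient.mk φ)) := fun i φ => by
    rw [← map_smul, ← map_smul, ← Submodule.Quotient.mk_smul, smul_eq_mul, mul_one]
  have hinj : ∀ i, Function.Injective
      (DirectSum.lof k[X] ι (fun i => k[X] ⧸ k[X] ∙ q i ^ e i) i) := fun i =>
    DirectSum.of_injective i
  have hy0 : ∀ (i : ι) (φ : k[X]), φ • y i = 0 ↔ q i ^ e i ∣ φ := fun i φ => by
    rw [hy, LinearEquiv.map_eq_zero_iff, ← map_zero (DirectSum.lof k[X] ι _ i),
      (hinj i).eq_iff, Submodule.Quotient.mk_eq_zero,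
      Submodule.mem_span_singleton]
    exact ⟨fun ⟨a, ha⟩ => ⟨a, by rw [← ha, smul_eq_mul, mul_comm]⟩,
      fun ⟨a, ha⟩ => ⟨a, by rw [ha, smul_eq_mul, mul_comm]⟩⟩
  have hfin : ∀ i, Module.finrank k (k[X] ⧸ k[X] ∙ q i ^ e i) = (q i ^ e i).natDegree := fun i =>
    (AdjoinRoot.powerBasis (pow_ne_zero _ (hq i).ne_zero)).finrank.trans
      (AdjoinRoot.powerBasis_dim _)
  have hfinite : ∀ i, Module.Finite k (k[X] ⧸ k[X] ∙ q i ^ e i) := fun i =>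
    (AdjoinRoot.powerBasis (pow_ne_zero _ (hq i).ne_zero)).finite
  have hrank : Module.finrank k W.V = ∑ i, (q i ^ e i).natDegree := by
    rw [(Module.AEval'.of (W.ρ g)).finrank_eq, (E.restrictScalars k).finrank_eq,
      Module.finrank_directSum]
    exact Finset.sum_congr rfl fun i _ => hfin i
  refine ⟨ι, inferInstance, q, e, hq, fun i => (hy0 i _).1 (hkill _), fun f hf => ?_⟩
  refine of_eq_sum_cyc hg W f (fun i => (Module.AEval'.of (W.ρ g)).symm (y i)) (fun i => ?_)
    (fun U hU hUw => eq_top_iff.2 fun x _ => ?_) ?_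
  · rw [← hsmul, (hy0 i _).2 (hf i).dvd, map_zero]
  · obtain ⟨z, rfl⟩ := (Module.AEval'.of (W.ρ g)).symm.surjective x
    obtain ⟨d, rfl⟩ := E.symm.surjective z
    induction d using DirectSum.induction_on with
    | zero => rw [map_zero, map_zero]; exact U.zero_mem
    | add a b ha hb =>
      rw [map_add, map_add]
      exact U.add_mem (ha trivial) (hb trivial)
    | of i a =>
      obtain ⟨φ, rfl⟩ := Submodule.Quotient.mk_surjective _ a
      have := hy i φ
      rw [DirectSum.lof_eq_of] at this
      rw [← this, hsmul]
      exact aeval_mem_of_invariant hU φ (hUw i)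
  · rw [hrank]
    refine Finset.sum_le_sum fun i _ => ?_
    have hfi : f i ≠ 0 := (hf i).ne_zero_iff.1 (pow_ne_zero _ (hq i).ne_zero)
    rw [finrank_cyc]
    refine (CyclicAlg.finrank_le hfi).trans ?_
    exact Polynomial.natDegree_le_of_dvd (hf i).symm.dvd (pow_ne_zero _ (hq i).ne_zero)

/-- The Chinese remainder theorem for cyclic modules. -/
theorem of_cyc_prod {ι : Type*} [Fintype ι] (f : ι → k[X])
    (hf : Pairwise (Function.onFun IsCoprime f)) (hdvd : ∏ i, f i ∣ Polynomial.X ^ Nat.card G - 1) :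
    RepRing.of (RepClass.mk (cyc hg (∏ i, f i)))
      = ∑ i, RepRing.of (RepClass.mk (cyc hg (f i))) := by
  classical
  have hM : (Polynomial.X ^ Nat.card G - 1 : k[X]) ≠ 0 :=
    (Polynomial.monic_X_pow_sub_C (1 : k) Nat.card_pos.ne').ne_zero
  have hf0 : ∏ i, f i ≠ 0 := ne_zero_of_dvd_ne_zero hM hdvd
  let W := cyc hg (∏ i, f i)
  let E := cycEquiv hg (∏ i, f i)
  have hE : ∀ φ : k[X], ∀ x, E (Polynomial.aeval (W.ρ g) φ x) = Ideal.Quotient.mk _ φ * E x := by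
    intro φ x
    rw [← CyclicAlg.aeval_root]
    induction φ using Polynomial.induction_on' with
    | add a b ha hb => rw [map_add, LinearMap.add_apply, map_add, ha, hb, map_add, add_mul]
    | monomial i a =>
      rw [Polynomial.aeval_monomial, Polynomial.aeval_monomial, Module.End.mul_apply,
        Module.algebraMap_end_apply, map_smul, mul_assoc, ← Algebra.smul_def]
      congr 1
      induction i with
      | zero => simp
      | succ i ih =>
        rw [pow_succ', pow_succ', Module.End.mul_apply, mul_assoc, ← ih]
        exact cycEquiv_ρ hg (∏ i, f i) _
  -- the complementary products, applied to the generator, are generators of the summands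
  let w₀ : W.V := E.symm 1
  have hw₀ : ∀ φ : k[X], Polynomial.aeval (W.ρ g) φ w₀ = E.symm (Ideal.Quotient.mk _ φ) := by
    intro φ
    rw [← E.symm_apply_apply (Polynomial.aeval (W.ρ g) φ w₀), hE, E.apply_symm_apply, mul_one]
  refine of_eq_sum_cyc hg W f (fun i => Polynomial.aeval (W.ρ g) (∏ j ∈ Finset.univ \ {i}, f j) w₀)
    (fun i => ?_) (fun U hU hUw => ?_) ?_
  · rw [← Module.End.mul_apply, ← map_mul, hw₀,
      ← Finset.prod_singleton f i, mul_comm, Finset.prod_sdiff (Finset.subset_univ _),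
      Ideal.Quotient.eq_zero_iff_mem.2 (Ideal.mem_sup_left (Ideal.mem_span_singleton_self _)),
      map_zero]
  · have h1 : w₀ ∈ U := by
      rcases isEmpty_or_nonempty ι with hι | hι
      · have : (1 : CyclicAlg k (Nat.card G) (∏ i, f i)) = 0 := by
          rw [← map_one (Ideal.Quotient.mk _), Ideal.Quotient.eq_zero_iff_mem]
          refine Ideal.mem_sup_left (Ideal.mem_span_singleton.2 ?_)
          rw [Finset.univ_eq_empty, Finset.prod_empty]
        change E.symm 1 ∈ U
        rw [this, map_zero]
        exact U.zero_mem
      · obtain ⟨μ, hμ⟩ := (exists_sum_eq_one_iff_pairwise_coprime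
          (s := f) (t := Finset.univ) Finset.univ_nonempty).2
          fun i j hij => hf fun h => hij (Subtype.ext h)
        have h2 : w₀ = ∑ i, Polynomial.aeval (W.ρ g) (μ i)
            (Polynomial.aeval (W.ρ g) (∏ j ∈ Finset.univ \ {i}, f j) w₀) := by
          simp_rw [← Module.End.mul_apply, ← map_mul]
          rw [← LinearMap.sum_apply, ← map_sum, hμ, map_one, Module.End.one_apply]
        rw [h2]
        exact U.sum_mem fun i _ => aeval_mem_of_invariant hU _ (hUw i)
    refine eq_top_iff.2 fun x _ => ?_
    obtain ⟨φ, hφ⟩ := Ideal.Quotient.mk_surjective (E x)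
    rw [← E.symm_apply_apply x, ← hφ, ← hw₀]
    exact aeval_mem_of_invariant hU _ h1
  · rw [finrank_cyc, CyclicAlg.finrank_eq Nat.card_pos.ne' hdvd, Polynomial.natDegree_prod _ _
      fun i _ => ne_zero_of_dvd_ne_zero hf0 (Finset.dvd_prod_of_mem f (Finset.mem_univ i))]
    refine Finset.sum_le_sum fun i _ => ?_
    rw [finrank_cyc]
    exact CyclicAlg.finrank_le
      (ne_zero_of_dvd_ne_zero hf0 (Finset.dvd_prod_of_mem f (Finset.mem_univ i)))

end FinRep

namespace RepRing

variable {k : Type u} {G : Type v} [Field k] [Group G] [Finite G]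
  {g : G} (hg : ∀ x, x ∈ Subgroup.zpowers g)

theorem X_sub_C_pow_dvd_iff {m : ℕ} (hm : (m : k) ≠ 0) (hm0 : m ≠ 0) {μ : k} (hμ : μ ^ m = 1)
    (P e : ℕ) :
    (Polynomial.X - Polynomial.C μ) ^ e ∣ ((Polynomial.X ^ m - 1) ^ P : k[X]) ↔ e ≤ P := by
  classical
  have hM : (Polynomial.X ^ m - 1 : k[X]) ≠ 0 :=
    (Polynomial.monic_X_pow_sub_C (1 : k) hm0).ne_zero
  have hroot : μ ∈ (Polynomial.X ^ m - 1 : k[X]).roots := by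
    rw [Polynomial.mem_roots hM]; simp [hμ]
  have hsep : (Polynomial.X ^ m - 1 : k[X]).Separable :=
    Polynomial.separable_X_pow_sub_C (1 : k) hm one_ne_zero
  rw [← Polynomial.le_rootMultiplicity_iff (pow_ne_zero _ hM), ← Polynomial.count_roots,
    Polynomial.roots_pow, Multiset.count_nsmul,
    Multiset.count_eq_one_of_mem (Polynomial.nodup_roots hsep) hroot, mul_one]

/-- The representation ring is additively generated by Jordan blocks. -/
theorem of_mem_closure_jordan {m P : ℕ} {ζ : k} (hζ : IsPrimitiveRoot ζ m) (hm0 : m ≠ 0)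
    (hX : (Polynomial.X ^ Nat.card G - 1 : k[X]) = (Polynomial.X ^ m - 1) ^ P) (W : FinRep k G) :
    of (RepClass.mk W) ∈ AddSubgroup.closure {x | ∃ i r, r ≤ P ∧ x = jordan hg (ζ ^ i) r} := by
  have hneZero : NeZero m := ⟨hm0⟩
  have hm : (m : k) ≠ 0 := (hζ.neZero').out
  obtain ⟨ι, _, q, e, hq, hdvd, H⟩ := FinRep.exists_eq_sum_cyc hg W
  have key : ∀ i, ∃ t, Associated (q i ^ e i) ((Polynomial.X - Polynomial.C (ζ ^ t)) ^ e i) := by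
    intro i
    rcases Nat.eq_zero_or_pos (e i) with he | he
    · exact ⟨0, by rw [he, pow_zero, pow_zero]⟩
    · have h1 : q i ∣ (Polynomial.X ^ m - 1 : k[X]) :=
        (hq i).prime.dvd_of_dvd_pow
          (((dvd_pow_self _ he.ne').trans (hdvd i)).trans hX.dvd)
      rw [Polynomial.X_pow_sub_one_eq_prod (NeZero.pos m) hζ] at h1
      obtain ⟨μ, hμ, h2⟩ := ((hq i).prime.dvd_finsetProd_iff _).1 h1
      rw [Polynomial.mem_nthRootsFinset (NeZero.pos m)] at hμ
      obtain ⟨t, _, rfl⟩ := hζ.eq_pow_of_pow_eq_one hμ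
      exact ⟨t, ((hq i).associated_of_dvd (Polynomial.irreducible_X_sub_C _) h2).pow_pow⟩
  choose t ht using key
  rw [H _ ht]
  refine AddSubgroup.sum_mem _ fun i _ => AddSubgroup.subset_closure ⟨t i, e i, ?_, rfl⟩
  have h1 := (ht i).symm.dvd.trans (hdvd i)
  rw [hX] at h1
  refine (X_sub_C_pow_dvd_iff hm hm0 ?_ P (e i)).1 h1
  rw [← pow_mul, mul_comm, pow_mul, hζ.pow_eq_one, one_pow]

theorem jordan_one_one : jordan hg (1 : k) 1 = 1 := by
  have h : of (RepClass.mk (FinRep.triv k G)) = 1 := map_one of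
  rw [← h, FinRep.of_eq_sum_cyc hg (ι := Unit) (FinRep.triv k G)
    (fun _ => (Polynomial.X - Polynomial.C 1) ^ 1) (fun _ => ⟨1⟩) ?_ ?_ ?_]
  · simp [jordan]
  · intro _
    rw [pow_one, map_sub, Polynomial.aeval_X, Polynomial.aeval_C, map_one]
    exact sub_self _
  · intro U _ hU
    refine eq_top_iff.2 fun x _ => ?_
    obtain ⟨x⟩ := x
    have := U.smul_mem x (hU ())
    exact Set.mem_of_eq_of_mem (ULift.ext _ _ (mul_one x).symm) this
  · rw [Finset.sum_const, Finset.card_univ, Fintype.card_unit, one_smul]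
    refine (finrank_jordan_le hg 1 1).trans ?_
    change 1 ≤ Module.finrank k (ULift.{v} k)
    rw [ULift.moduleEquiv.finrank_eq, Module.finrank_self]

/-- The powers of a one-dimensional module. -/
theorem jordan_pow (μ : k) (hμ : μ ^ Nat.card G = 1) (i : ℕ) :
    jordan hg μ 1 ^ i = jordan hg (μ ^ i) 1 := by
  induction i with
  | zero => rw [pow_zero, pow_zero, jordan_one_one]
  | succ i ih =>
    rw [pow_succ, ih, pow_succ, jordan_one_mul]
    · rw [← pow_mul, mul_comm, pow_mul, hμ, one_pow]
    · rw [pow_one, Polynomial.dvd_iff_isRoot]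
      simp [hμ]

end RepRing

/-! ### Cyclotomic polynomials and sums over cosets -/

section cyclotomic

open Polynomial

/-- The cyclotomic polynomials with a given root `x` in a field have indices `r ^ s * orderOf x`,
where `r` is the characteristic exponent of the field. -/
theorem exists_eq_pow_mul_orderOf {F : Type*} [Field F] (x : F) :
    ∃ r : ℕ, (r = 1 ∨ r.Prime) ∧ ∀ d : ℕ, 0 < d → (cyclotomic d F).IsRoot x →
      ∃ s, d = r ^ s * orderOf x := by
  obtain ⟨r, hr⟩ := CharP.exists F
  rcases CharP.char_is_prime_or_zero F r with hp | rfl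
  · have := Fact.mk hp
    refine ⟨r, Or.inr hp, fun d hd hx => ?_⟩
    obtain ⟨s, d', hd', rfl⟩ := Nat.exists_eq_pow_mul_and_not_dvd hd.ne' r hp.ne_one
    have : NeZero (d' : F) := ⟨fun h => hd' ((CharP.cast_eq_zero_iff F r d').1 h)⟩
    have h := isRoot_cyclotomic_prime_pow_mul_iff_of_charP.1 hx
    exact ⟨s, by rw [← h.eq_orderOf]⟩
  · have := CharP.charP_to_charZero F
    refine ⟨1, Or.inl rfl, fun d hd hx => ⟨0, ?_⟩⟩
    have : NeZero (d : F) := ⟨Nat.cast_ne_zero.2 hd.ne'⟩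
    rw [pow_zero, one_mul]
    exact (isRoot_cyclotomic_iff.1 hx).eq_orderOf

/-- The polynomials `(X ^ m - 1) / Φ_m` and `(X ^ m - 1) / ((X ^ (m / l) - 1) Φ_m)`, where `l` runs
over the primes dividing `m`, generate the unit ideal of `ℤ[X]`. Otherwise they have a common root
`x` in a field of characteristic exponent `r`. Then `x` is a root of some `Φ_d` with `d ∣ m` and
`d ≠ m`, and for each prime `l ∣ m` of some such `Φ_d` with `d ∤ m / l`. All these `d` are of the
form `r ^ s * o`, where `o` is the order of `x`. Let `d₀` be the first of them. A prime `l ≠ r`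
cannot divide `m / d₀`, because then every `r ^ s * o` that divides `m` also divides `m / l`. So
`m / d₀` is a power of `r`, and not `1`; but then for `l = r` the only `r ^ s * o` dividing `m` and
not `m / l` is `m` itself. -/
theorem span_prod_cyclotomic_eq_top {m : ℕ} (hm : 0 < m) :
    Ideal.span (insert (∏ d ∈ m.properDivisors, cyclotomic d ℤ)
      {f | ∃ l : ℕ, l.Prime ∧ l ∣ m ∧
        f = ∏ d ∈ m.properDivisors \ (m / l).divisors, cyclotomic d ℤ}) = ⊤ := by
  by_contra hcon
  obtain ⟨M, hM, hle⟩ := Ideal.exists_le_maximal _ hcon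
  let _ : Field (ℤ[X] ⧸ M) := Ideal.Quotient.field M
  -- a root of one of the factors in the residue field
  have hroot : ∀ d, cyclotomic d ℤ ∈ M →
      (cyclotomic d (ℤ[X] ⧸ M)).IsRoot (Ideal.Quotient.mk M X) := by
    intro d hd
    have h := hom_eval₂ (cyclotomic d ℤ) C (Ideal.Quotient.mk M) X
    rw [eval₂_C_X, Ideal.Quotient.eq_zero_iff_mem.2 hd,
      Subsingleton.elim ((Ideal.Quotient.mk M).comp C) (Int.castRingHom _)] at h
    rw [IsRoot, ← map_cyclotomic_int, eval_map]
    exact h.symm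
  obtain ⟨r, hr, H⟩ := exists_eq_pow_mul_orderOf (Ideal.Quotient.mk M X)
  set o := orderOf (Ideal.Quotient.mk M X)
  have hS : ∀ l : ℕ, l.Prime → l ∣ m → ∃ d s, d ∣ m ∧ d ≠ m ∧ ¬ d * l ∣ m ∧ d = r ^ s * o := by
    intro l hl hlm
    have h := hle (Ideal.subset_span (Or.inr ⟨l, hl, hlm, rfl⟩))
    obtain ⟨d, hd, hdM⟩ := (hM.isPrime.prod_mem_iff).1 h
    rw [Finset.mem_sdiff, Nat.mem_properDivisors, Nat.mem_divisors] at hd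
    obtain ⟨s, hs⟩ := H d (Nat.pos_of_dvd_of_pos hd.1.1 hm) (hroot d hdM)
    refine ⟨d, s, hd.1.1, hd.1.2.ne, fun h => hd.2 ⟨?_, ?_⟩, hs⟩
    · exact (Nat.dvd_div_iff_mul_dvd hlm).2 (by rwa [mul_comm])
    · exact (Nat.div_pos (Nat.le_of_dvd hm hlm) hl.pos).ne'
  obtain ⟨d₀, hd₀, hd₀M⟩ := (hM.isPrime.prod_mem_iff).1 (hle (Ideal.subset_span (Or.inl rfl)))
  rw [Nat.mem_properDivisors] at hd₀
  obtain ⟨s, hs⟩ := H d₀ (Nat.pos_of_dvd_of_pos hd₀.1 hm) (hroot d₀ hd₀M)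
  obtain ⟨c, hc⟩ := hd₀.1
  have hc1 : c ≠ 1 := by
    rintro rfl
    rw [mul_one] at hc
    exact hd₀.2.ne hc.symm
  have hc0 : c ≠ 0 := by
    rintro rfl
    rw [mul_zero] at hc
    exact hm.ne' hc
  have ho : 0 < o := Nat.pos_of_ne_zero fun h => by
    rw [h, mul_zero] at hs
    rw [hs, zero_mul] at hc
    exact hm.ne' hc
  -- the quotient `c` of `m` by the first index `d₀` is a power of the characteristic exponent
  have hunique : ∀ l : ℕ, l.Prime → l ∣ c → l = r := by
    intro l hl hlc
    by_contra hlr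
    obtain ⟨d, s', ⟨w, hw⟩, -, hdl, hs'⟩ := hS l hl (hc ▸ hlc.mul_left _)
    apply hdl
    have hcop : Nat.Coprime (r ^ s') l := by
      refine Nat.Coprime.pow_left _ ?_
      rcases hr with rfl | hr
      · exact Nat.coprime_one_left l
      · exact ((Nat.coprime_primes hl hr).2 hlr).symm
    have h1 : r ^ s' ∣ r ^ s * c := ⟨w, by
      apply Nat.eq_of_mul_eq_mul_right ho
      rw [hs] at hc
      rw [hs', hc] at hw
      linarith⟩
    have h2 : r ^ s' * l ∣ r ^ s * c := hcop.mul_dvd_of_dvd_of_dvd h1 (hlc.mul_left _)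
    rw [hc, hs, hs']
    calc r ^ s' * o * l = (r ^ s' * l) * o := by ring
      _ ∣ (r ^ s * c) * o := Nat.mul_dvd_mul_right h2 o
      _ = r ^ s * o * c := by ring
  obtain ⟨l, hl, hlc⟩ := Nat.exists_prime_and_dvd hc1
  obtain rfl := hunique l hl hlc
  obtain ⟨d, s', hdm, hdne, hdl, hs'⟩ := hS l hl (hc ▸ hlc.mul_left _)
  have hcu := Nat.eq_prime_pow_of_unique_prime_dvd hc0 fun {q} hq hqc => hunique q hq hqc
  set t := c.primeFactorsList.length
  have hm' : m = l ^ (s + t) * o := by rw [hc, hs, hcu]; ring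
  rw [hs', hm'] at hdm
  have hle1 : s' ≤ s + t :=
    (Nat.pow_dvd_pow_iff_le_right hl.one_lt).1 (Nat.dvd_of_mul_dvd_mul_right ho hdm)
  rcases hle1.eq_or_lt with h | h
  · exact hdne (by rw [hs', hm', h])
  · apply hdl
    rw [hs', hm']
    calc l ^ s' * o * l = l ^ (s' + 1) * o := by ring
      _ ∣ l ^ (s + t) * o := Nat.mul_dvd_mul_right (Nat.pow_dvd_pow l h) o

/-- `Φ_m` times the generators of the unit ideal in `span_prod_cyclotomic_eq_top` are `X ^ m - 1`
and the sums of the powers of `X ^ (m / l)`, so `Φ_m` vanishes wherever these do. -/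
theorem eval₂_cyclotomic_eq_zero {R : Type*} [CommRing R] {m : ℕ} (hm : 0 < m) (y : R)
    (hy : y ^ m = 1)
    (hsum : ∀ l : ℕ, l.Prime → l ∣ m → ∑ i ∈ Finset.range l, (y ^ (m / l)) ^ i = 0) :
    eval₂ (Int.castRingHom R) y (cyclotomic m ℤ) = 0 := by
  change aeval y (cyclotomic m ℤ) = 0
  have key : ∀ j ∈ Ideal.span (insert (∏ d ∈ m.properDivisors, cyclotomic d ℤ)
      {f | ∃ l : ℕ, l.Prime ∧ l ∣ m ∧
        f = ∏ d ∈ m.properDivisors \ (m / l).divisors, cyclotomic d ℤ}),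
      aeval y (cyclotomic m ℤ * j) = 0 := by
    intro j hj
    induction hj using Submodule.span_induction with
    | zero => simp
    | add a b _ _ ha hb => rw [mul_add, map_add, ha, hb, add_zero]
    | smul a b _ hb => rw [smul_eq_mul, mul_left_comm, map_mul, hb, mul_zero]
    | mem f hf =>
      rcases hf with rfl | ⟨l, hl, hlm, rfl⟩
      · have h := prod_cyclotomic_eq_X_pow_sub_one hm ℤ
        rw [← Nat.cons_self_properDivisors hm.ne', Finset.prod_cons] at h
        rw [h]
        simp [hy]
      · have hml : 0 < m / l := Nat.div_pos (Nat.le_of_dvd hm hlm) hl.pos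
        have hsub : (m / l).divisors ⊆ m.divisors :=
          Nat.divisors_subset_of_dvd hm.ne' (Nat.div_dvd_of_dvd hlm)
        have hmem : m ∈ m.divisors \ (m / l).divisors := by
          rw [Finset.mem_sdiff, Nat.mem_divisors, Nat.mem_divisors]
          refine ⟨⟨dvd_rfl, hm.ne'⟩, fun h => ?_⟩
          exact absurd (Nat.le_of_dvd hml h.1) (not_le.2 (Nat.div_lt_self hm hl.one_lt))
        have h1 : cyclotomic m ℤ * ∏ d ∈ m.properDivisors \ (m / l).divisors, cyclotomic d ℤ
            = ∏ d ∈ m.divisors \ (m / l).divisors, cyclotomic d ℤ := by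
          rw [← Finset.mul_prod_erase _ _ hmem]
          congr 2
          ext d
          simp only [Finset.mem_sdiff, Nat.mem_properDivisors, Finset.mem_erase, Nat.mem_divisors]
          constructor
          · rintro ⟨⟨h1, h2⟩, h3⟩
            exact ⟨h2.ne, ⟨h1, hm.ne'⟩, h3⟩
          · rintro ⟨h1, ⟨h2, -⟩, h3⟩
            exact ⟨⟨h2, (Nat.le_of_dvd hm h2).lt_of_ne h1⟩, h3⟩
        have h2 : (∏ d ∈ m.divisors \ (m / l).divisors, cyclotomic d ℤ)
            = ∑ i ∈ Finset.range l, (X ^ (m / l) : ℤ[X]) ^ i := by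
          have h3 := Finset.prod_sdiff (f := fun d => cyclotomic d ℤ) hsub
          rw [prod_cyclotomic_eq_X_pow_sub_one hm, prod_cyclotomic_eq_X_pow_sub_one hml] at h3
          have h4 := geom_sum_mul (X ^ (m / l) : ℤ[X]) l
          rw [← pow_mul, Nat.div_mul_cancel hlm] at h4
          have hne : (X ^ (m / l) - 1 : ℤ[X]) ≠ 0 :=
            (monic_X_pow_sub_C (1 : ℤ) hml.ne').ne_zero
          exact mul_right_cancel₀ hne (h3.trans h4.symm)
        rw [h1, h2, map_sum]
        simpa using hsum l hl hlm
  have h := key 1 (by rw [span_prod_cyclotomic_eq_top hm]; trivial)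
  rwa [mul_one] at h

end cyclotomic

/-! ### Induced modules vanish in the quotient -/

namespace FinRep

variable {k : Type u} {G : Type v} [Field k] [Group G] [Finite G]
  {g : G} (hg : ∀ x, x ∈ Subgroup.zpowers g)

/-- The homomorphism to the cyclic group of order `l` that sends the generator to `1`. -/
noncomputable def toZMod {l : ℕ} (hl : l ∣ Nat.card G) : G →* Multiplicative (ZMod l) :=
  genHom hg (Multiplicative.ofAdd (1 : ZMod l)) (by
    rw [← ofAdd_nsmul, nsmul_eq_mul, mul_one, (ZMod.natCast_eq_zero_iff _ _).2 hl, ofAdd_zero])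

theorem toZMod_gen {l : ℕ} (hl : l ∣ Nat.card G) :
    toZMod hg hl g = Multiplicative.ofAdd 1 := genHom_gen hg _ _

theorem toZMod_gen_pow {l : ℕ} (hl : l ∣ Nat.card G) (i : ℕ) :
    toZMod hg hl (g ^ i) = Multiplicative.ofAdd (i : ZMod l) := by
  rw [map_pow, toZMod_gen, ← ofAdd_nsmul, nsmul_eq_mul, mul_one]

theorem ker_toZMod_lt_top {l : ℕ} (hl : l ∣ Nat.card G) (hl1 : l ≠ 1) :
    (toZMod hg hl).ker < ⊤ := by
  refine lt_top_iff_ne_top.2 fun h => ?_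
  have h1 : g ∈ (toZMod hg hl).ker := h ▸ Subgroup.mem_top g
  rw [MonoidHom.mem_ker, toZMod_gen] at h1
  have h2 : ((1 : ℕ) : ZMod l) = 0 := by rw [Nat.cast_one]; exact h1
  exact hl1 (Nat.dvd_one.1 ((ZMod.natCast_eq_zero_iff _ _).1 h2))

/-- The module induced from the trivial module of the subgroup of index `l` is
`k[X] / (X ^ l - 1)`. -/
theorem of_ind_triv {l : ℕ} (hl : l ∣ Nat.card G) :
    RepRing.of (RepClass.mk ((triv k (toZMod hg hl).ker).ind (toZMod hg hl).ker))
      = RepRing.of (RepClass.mk (cyc hg (Polynomial.X ^ l - 1 : k[X]))) := by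
  classical
  have hl0 : l ≠ 0 := by
    rintro rfl
    exact Nat.card_pos.ne' (Nat.eq_zero_of_zero_dvd hl)
  have : NeZero l := ⟨hl0⟩
  set H := (toZMod hg hl).ker with hH
  let ρ := (triv k H).ρ
  let W := (triv k H).ind H
  let w : G → W.V := fun h => IndAux.mk H.subtype ρ h ⟨1⟩
  have hw : ∀ h₁ h₂, W.ρ h₁ (w h₂) = w (h₂ * h₁⁻¹) := fun h₁ h₂ =>
    IndAux.ind_mk H.subtype ρ h₁ h₂ _
  have hwH : ∀ (x : H) (h : G), w (x * h) = w h := fun x h =>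
    IndAux.mk_mul H.subtype ρ x h (⟨1⟩ : ULift k)
  rw [of_eq_sum_cyc hg (ι := Unit) W (fun _ => Polynomial.X ^ l - 1) (fun _ => w 1) ?_ ?_ ?_]
  · simp
  · intro _
    rw [map_sub, map_pow, Polynomial.aeval_X, map_one, LinearMap.sub_apply, sub_eq_zero,
      ← map_pow, hw, one_mul, Module.End.one_apply]
    have hgl : (g ^ l)⁻¹ ∈ H := by
      rw [Subgroup.inv_mem_iff, hH, MonoidHom.mem_ker, toZMod_gen_pow]
      simp
    have := hwH ⟨_, hgl⟩ 1
    rwa [mul_one] at this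
  · intro U hU hUw
    have hUpow : ∀ (i : ℕ), ∀ x ∈ U, W.ρ (g ^ i) x ∈ U := by
      intro i
      induction i with
      | zero => intro x hx; simpa using hx
      | succ i ih =>
        intro x hx
        rw [pow_succ, map_mul, Module.End.mul_apply]
        exact ih _ (hU x hx)
    refine eq_top_iff.2 fun x _ => ?_
    refine IndAux.induction_on H.subtype ρ (P := fun x => x ∈ U) x (fun h a => ?_)
      fun x y hx hy => U.add_mem hx hy
    obtain ⟨i, hi⟩ := exists_pow_eq_of_forall_mem_zpowers hg h⁻¹
    obtain ⟨a⟩ := a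
    have h1 : IndAux.mk H.subtype ρ h (⟨a⟩ : ULift k) = a • w h :=
      (congrArg (IndAux.mk H.subtype ρ h) (ULift.ext _ _ (mul_one a).symm)).trans
        (map_smul (IndAux.mk H.subtype ρ h) a (⟨1⟩ : ULift k))
    have h2 : w h = W.ρ (g ^ i) (w 1) := by rw [hw, hi, inv_inv, one_mul]
    rw [h1, h2]
    exact U.smul_mem _ (hUpow i _ (hUw ()))
  · rw [Finset.sum_const, Finset.card_univ, Fintype.card_unit, one_smul, finrank_cyc]
    refine (CyclicAlg.finrank_le
      (Polynomial.monic_X_pow_sub_C (1 : k) hl0).ne_zero).trans ?_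
    rw [Polynomial.natDegree_X_pow_sub_C]
    -- the functions on `ℤ / l` are a quotient of the induced module
    let L : W.V →ₗ[k] (ZMod l → k) := IndAux.lift H.subtype ρ
      (fun h => (LinearMap.single k (fun _ : ZMod l => k) (toZMod hg hl h).toAdd) ∘ₗ
        ULift.moduleEquiv.toLinearMap) (by
          intro x h a
          have hx : toZMod hg hl (x : G) = 1 := x.2
          change LinearMap.single k (fun _ : ZMod l => k) (toZMod hg hl (x * h)).toAdd _ = _
          rw [map_mul, hx, one_mul]
          rfl)
    have hL : ∀ i : ℕ, L (w (g ^ i)) = Pi.single (i : ZMod l) 1 := fun i => by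
      refine (IndAux.lift_mk H.subtype ρ _ _ _ _).trans ?_
      rw [toZMod_gen_pow]
      rfl
    have hsurj : Function.Surjective L := by
      intro f
      refine ⟨∑ i : ZMod l, f i • w (g ^ i.val), ?_⟩
      rw [map_sum]
      ext j
      simp [hL, Finset.sum_apply, Pi.single_apply]
    have := LinearMap.finrank_le_finrank_of_surjective hsurj
    rwa [Module.finrank_fintype_fun_eq_card, ZMod.card] at this

/-- `k[X] / (X ^ l - 1)` is induced from a proper subgroup when `l ≠ 1`. -/
theorem mk_cyc_eq_zero {l : ℕ} (hl : l ∣ Nat.card G) (hl1 : l ≠ 1) :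
    Ideal.Quotient.mk (RepRing.inducedIdeal k G)
      (RepRing.of (RepClass.mk (cyc hg (Polynomial.X ^ l - 1 : k[X])))) = 0 := by
  rw [Ideal.Quotient.eq_zero_iff_mem, ← of_ind_triv hg hl, ← RepClass.ind_mk, ← RepRing.ind_of]
  change _ ∈ RepRing.inducedSubgroup k G
  exact le_iSup₂ (f := fun (H : Subgroup G) (_ : H < ⊤) => (RepRing.ind (k := k) H).range)
    _ (ker_toZMod_lt_top hg hl hl1) ⟨_, rfl⟩

end FinRep

/-! ### Counting Jordan blocks -/

section blockCount

variable {k V V' : Type*} [Field k] [AddCommGroup V] [Module k V] [AddCommGroup V'] [Module k V']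

/-- The dimension of `ker N ∩ im N ^ r`, which on a finite-dimensional space is the number of Jordan
blocks of `N` with eigenvalue `0` and size greater than `r`. -/
noncomputable def kerRange (N : Module.End k V) (r : ℕ) : ℕ :=
  Module.finrank k (LinearMap.ker N ⊓ LinearMap.range (N ^ r) : Submodule k V)

/-- The number of Jordan blocks of size `r ≥ 1` of `T` with eigenvalue `μ`. -/
noncomputable def blockCount (T : Module.End k V) (μ : k) (r : ℕ) : ℤ :=
  kerRange (T - algebraMap k _ μ) (r - 1) - kerRange (T - algebraMap k _ μ) r

theorem kerRange_eq_of_equiv (N : Module.End k V) (N' : Module.End k V') (e : V ≃ₗ[k] V') {c : k}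
    (hc : c ≠ 0) (h : ∀ x, e (N x) = c • N' (e x)) (r : ℕ) : kerRange N r = kerRange N' r := by
  have hpow : ∀ (r : ℕ) (x : V), e ((N ^ r) x) = c ^ r • (N' ^ r) (e x) := by
    intro r
    induction r with
    | zero => intro x; simp
    | succ r ih =>
      intro x
      rw [pow_succ, Module.End.mul_apply, ih, h, map_smul, smul_smul, pow_succ, pow_succ,
        Module.End.mul_apply]
  have hmap : (LinearMap.ker N ⊓ LinearMap.range (N ^ r)).map (e : V →ₗ[k] V')
      = LinearMap.ker N' ⊓ LinearMap.range (N' ^ r) := by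
    ext y
    obtain ⟨x, rfl⟩ := e.surjective y
    rw [Submodule.mem_map_equiv, e.symm_apply_apply, Submodule.mem_inf, Submodule.mem_inf,
      LinearMap.mem_ker, LinearMap.mem_ker, LinearMap.mem_range, LinearMap.mem_range,
      ← e.map_eq_zero_iff, h, smul_eq_zero_iff_right hc]
    refine and_congr_right fun _ => ⟨?_, ?_⟩
    · rintro ⟨z, rfl⟩
      exact ⟨c ^ r • e z, by rw [map_smul, hpow]⟩
    · rintro ⟨z, hz⟩
      refine ⟨(c ^ r)⁻¹ • e.symm z, e.injective ?_⟩
      rw [hpow, map_smul, map_smul, e.apply_symm_apply, hz, smul_inv_smul₀ (pow_ne_zero _ hc)]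
  rw [kerRange, kerRange, ← hmap]
  exact (LinearEquiv.finrank_map_eq e _).symm

theorem blockCount_eq_of_equiv (T : Module.End k V) (T' : Module.End k V') (e : V ≃ₗ[k] V')
    {c : k} (hc : c ≠ 0) (h : ∀ x, e (T x) = c • T' (e x)) (μ : k) (r : ℕ) :
    blockCount T (c * μ) r = blockCount T' μ r := by
  have h' : ∀ x, e ((T - algebraMap k _ (c * μ)) x) = c • (T' - algebraMap k _ μ) (e x) := by
    intro x
    rw [LinearMap.sub_apply, LinearMap.sub_apply, map_sub, h, Module.algebraMap_end_apply,
      Module.algebraMap_end_apply, map_smul, smul_sub, smul_smul]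
  rw [blockCount, blockCount, kerRange_eq_of_equiv _ _ e hc h', kerRange_eq_of_equiv _ _ e hc h']

theorem kerRange_prodMap [Module.Finite k V] [Module.Finite k V'] (N : Module.End k V)
    (N' : Module.End k V') (r : ℕ) :
    kerRange (LinearMap.prodMap N N' : Module.End k (V × V')) r
      = kerRange N r + kerRange N' r := by
  have hpow : ∀ (r : ℕ) (x : V × V'), (LinearMap.prodMap N N' ^ r : Module.End k (V × V')) x
      = ((N ^ r) x.1, (N' ^ r) x.2) := by
    intro r
    induction r with
    | zero => intro x; rfl
    | succ r ih => intro x; rw [pow_succ, Module.End.mul_apply, ih]; rfl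
  have h : (LinearMap.ker (LinearMap.prodMap N N' : Module.End k (V × V'))
      ⊓ LinearMap.range (LinearMap.prodMap N N' ^ r : Module.End k (V × V')))
      = (LinearMap.ker N ⊓ LinearMap.range (N ^ r)).prod
        (LinearMap.ker N' ⊓ LinearMap.range (N' ^ r)) := by
    ext x
    simp only [Submodule.mem_inf, Submodule.mem_prod, LinearMap.mem_ker, LinearMap.mem_range, hpow,
      LinearMap.prodMap_apply, Prod.ext_iff, Prod.exists]
    constructor
    · rintro ⟨⟨h1, h2⟩, a, b, h3, h4⟩
      exact ⟨⟨h1, a, h3⟩, h2, b, h4⟩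
    · rintro ⟨⟨h1, a, h3⟩, h2, b, h4⟩
      exact ⟨⟨h1, h2⟩, a, b, h3, h4⟩
  let e (p : Submodule k V) (q : Submodule k V') : (p.prod q) ≃ₗ[k] p × q :=
    { toFun := fun x => (⟨x.1.1, x.2.1⟩, ⟨x.1.2, x.2.2⟩)
      invFun := fun x => ⟨(x.1.1, x.2.1), x.1.2, x.2.2⟩
      map_add' := fun _ _ => rfl
      map_smul' := fun _ _ => rfl
      left_inv := fun _ => rfl
      right_inv := fun _ => rfl }
  rw [kerRange, h, (e _ _).finrank_eq, Module.finrank_prod, kerRange, kerRange]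

/-- If `E` is an operator with `E T = T E - T`, then `T` has no Jordan blocks of size `r` with
eigenvalue `μ`, for `r` and `μ` nonzero in `k`. Indeed, put `N = T - μ`. If `v = N ^ (r - 1) u` is
killed by `N`, then applying `E N ^ r = N ^ r E - r N ^ (r - 1) T` to `u` gives
`N ^ r (E u) = r μ v`, so `v` also lies in the image of `N ^ r`. -/
theorem blockCount_eq_zero_of_derivation (T E : Module.End k V) (hE : E * T = T * E - T) {μ : k}
    (hμ : μ ≠ 0) {r : ℕ} (hr : (r : k) ≠ 0) : blockCount T μ r = 0 := by
  obtain ⟨r, rfl⟩ := Nat.exists_eq_succ_of_ne_zero (show r ≠ 0 by rintro rfl; simp at hr)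
  set N := T - algebraMap k (Module.End k V) μ with hN
  have hNT : N * T = T * N := by
    rw [hN, sub_mul, mul_sub, Algebra.commutes]
  have hEN : E * N = N * E - T := by
    rw [hN, mul_sub, sub_mul, hE, Algebra.commutes]
    abel
  have hpow : ∀ r : ℕ, E * N ^ (r + 1) = N ^ (r + 1) * E - (r + 1) • (N ^ r * T) := by
    intro r
    induction r with
    | zero => rw [zero_add, pow_one, pow_zero, one_mul, one_smul, hEN]
    | succ r ih =>
      rw [pow_succ N (r + 1), ← mul_assoc, ih, sub_mul, mul_assoc, hEN, mul_sub, smul_mul_assoc,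
        mul_assoc (N ^ r), ← hNT, ← mul_assoc (N ^ r), ← pow_succ, ← mul_assoc, ← pow_succ,
        succ_nsmul _ (r + 1)]
      abel
  have hle : LinearMap.ker N ⊓ LinearMap.range (N ^ r)
      ≤ LinearMap.ker N ⊓ LinearMap.range (N ^ (r + 1)) := by
    rintro v ⟨hv, u, rfl⟩
    refine ⟨hv, ((r + 1 : ℕ) * μ : k)⁻¹ • E u, ?_⟩
    have hv' : (N ^ (r + 1)) u = 0 := by
      rw [pow_succ', Module.End.mul_apply]; exact hv
    have hT : (N ^ r * T) u = μ • (N ^ r) u := by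
      have h1 : N ^ r * T = T * N ^ r := (Commute.pow_left hNT r)
      have h2 : T = N + algebraMap k (Module.End k V) μ := by rw [hN, sub_add_cancel]
      rw [h1, Module.End.mul_apply, h2, LinearMap.add_apply, Module.algebraMap_end_apply]
      have : N ((N ^ r) u) = 0 := hv
      rw [this, zero_add]
    have h := LinearMap.congr_fun (hpow r) u
    rw [Module.End.mul_apply, hv', map_zero, LinearMap.sub_apply, LinearMap.smul_apply, hT,
      Module.End.mul_apply, eq_comm, sub_eq_zero] at h
    rw [map_smul, h, ← Nat.cast_smul_eq_nsmul k, smul_smul, smul_smul, mul_assoc,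
      inv_mul_cancel₀, one_smul]
    exact mul_ne_zero hr hμ
  have hge : LinearMap.ker N ⊓ LinearMap.range (N ^ (r + 1))
      ≤ LinearMap.ker N ⊓ LinearMap.range (N ^ r) := by
    refine inf_le_inf_left _ ?_
    rintro _ ⟨u, rfl⟩
    exact ⟨N u, by rw [pow_succ, Module.End.mul_apply]⟩
  rw [blockCount, kerRange, kerRange, ← hN, Nat.succ_sub_one, le_antisymm hle hge, sub_self]

end blockCount

theorem CyclicAlg.aeval_root_sub_eq_zero_iff {k : Type u} [Field k] {n : ℕ} {ν : k} {s : ℕ}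
    (h : (Polynomial.X - Polynomial.C ν) ^ s ∣ (Polynomial.X ^ n - 1 : k[X])) (φ : k[X]) :
    Polynomial.aeval (root k n ((Polynomial.X - Polynomial.C ν) ^ s) - algebraMap k _ ν) φ = 0
      ↔ Polynomial.X ^ s ∣ φ := by
  have h1 : Polynomial.aeval (root k n ((Polynomial.X - Polynomial.C ν) ^ s) - algebraMap k _ ν) φ
      = Ideal.Quotient.mk _ (φ.comp (Polynomial.X - Polynomial.C ν)) := by
    rw [← aeval_root, Polynomial.aeval_comp, map_sub, Polynomial.aeval_X, Polynomial.aeval_C]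
  rw [h1, Ideal.Quotient.eq_zero_iff_mem, span_sup_eq h, Ideal.mem_span_singleton]
  constructor
  · rintro ⟨ψ, hψ⟩
    refine ⟨ψ.comp (Polynomial.X + Polynomial.C ν), ?_⟩
    have := congrArg (fun f => Polynomial.comp f (Polynomial.X + Polynomial.C ν)) hψ
    simpa [Polynomial.comp_assoc] using this
  · rintro ⟨ψ, rfl⟩
    exact ⟨ψ.comp (Polynomial.X - Polynomial.C ν), by simp⟩

namespace CyclicAlg

variable {k : Type u} [Field k] {n : ℕ} {ν : k} {s : ℕ}

theorem exists_eq_aeval_root_sub {f : k[X]} (ν : k) (x : CyclicAlg k n f) :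
    ∃ φ : k[X], x = Polynomial.aeval (root k n f - algebraMap k _ ν) φ := by
  obtain ⟨φ, rfl⟩ := Ideal.Quotient.mk_surjective x
  refine ⟨φ.comp (Polynomial.X + Polynomial.C ν), ?_⟩
  rw [Polynomial.aeval_comp, map_add, Polynomial.aeval_X, Polynomial.aeval_C, sub_add_cancel,
    aeval_root]

variable (h : (Polynomial.X - Polynomial.C ν) ^ s ∣ (Polynomial.X ^ n - 1 : k[X]))

include h

theorem kerRange_eq_zero_of_ne {μ : k} (hμ : μ ≠ ν) (r : ℕ) :
    kerRange (LinearMap.mulLeft k (root k n ((Polynomial.X - Polynomial.C ν) ^ s))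
      - algebraMap k _ μ) r = 0 := by
  have hker : LinearMap.ker (LinearMap.mulLeft k (root k n ((Polynomial.X - Polynomial.C ν) ^ s))
      - algebraMap k _ μ) = ⊥ := by
    refine LinearMap.ker_eq_bot'.2 fun x hx => ?_
    obtain ⟨φ, rfl⟩ := exists_eq_aeval_root_sub ν x
    rw [aeval_root_sub_eq_zero_iff h]
    have h1 : Polynomial.aeval (root k n ((Polynomial.X - Polynomial.C ν) ^ s) - algebraMap k _ ν)
        ((Polynomial.X - Polynomial.C (μ - ν)) * φ) = 0 := by
      rw [← hx, map_mul, map_sub, Polynomial.aeval_X, Polynomial.aeval_C, LinearMap.sub_apply,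
        LinearMap.mulLeft_apply, Module.algebraMap_end_apply, Algebra.smul_def, ← sub_mul, map_sub]
      congr 1
      abel
    rw [aeval_root_sub_eq_zero_iff h] at h1
    refine IsCoprime.dvd_of_dvd_mul_left (IsCoprime.pow_left ?_) h1
    have := Polynomial.isCoprime_X_sub_C_of_isUnit_sub (R := k) (a := 0) (b := μ - ν)
      (by rw [zero_sub, IsUnit.neg_iff]; exact (sub_ne_zero.2 hμ).isUnit)
    rwa [map_zero, sub_zero] at this
  rw [kerRange, hker, bot_inf_eq, finrank_bot]

theorem kerRange_eq (hs : s ≠ 0) (r : ℕ) :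
    kerRange (LinearMap.mulLeft k (root k n ((Polynomial.X - Polynomial.C ν) ^ s))
      - algebraMap k _ ν) r = if r < s then 1 else 0 := by
  set z := root k n ((Polynomial.X - Polynomial.C ν) ^ s) - algebraMap k _ ν with hz
  have hN : LinearMap.mulLeft k (root k n ((Polynomial.X - Polynomial.C ν) ^ s))
      - algebraMap k _ ν = LinearMap.mulLeft k z := by
    refine LinearMap.ext fun x => ?_
    rw [hz, LinearMap.sub_apply, LinearMap.mulLeft_apply, Module.algebraMap_end_apply,
      Algebra.smul_def, LinearMap.mulLeft_apply, sub_mul]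
  have hzpow : ∀ i, z ^ i = 0 ↔ s ≤ i := fun i => by
    have := aeval_root_sub_eq_zero_iff h (Polynomial.X ^ i)
    rw [map_pow, Polynomial.aeval_X, ← hz] at this
    rw [this]
    exact ⟨fun hd => (pow_dvd_pow_iff Polynomial.X_ne_zero Polynomial.not_isUnit_X).1 hd,
      fun hd => pow_dvd_pow _ hd⟩
  rw [hN, kerRange, LinearMap.pow_mulLeft]
  split_ifs with hr
  · have hspan : LinearMap.ker (LinearMap.mulLeft k z)
          ⊓ LinearMap.range (LinearMap.mulLeft k (z ^ r))
        = Submodule.span k {z ^ (s - 1)} := by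
      refine le_antisymm ?_ ?_
      · rintro x ⟨hx, -⟩
        obtain ⟨φ, rfl⟩ := exists_eq_aeval_root_sub ν x
        have h1 : Polynomial.aeval z (Polynomial.X * φ) = 0 := by
          rw [map_mul, Polynomial.aeval_X]; exact hx
        rw [aeval_root_sub_eq_zero_iff h] at h1
        obtain ⟨t, rfl⟩ := Nat.exists_eq_succ_of_ne_zero hs
        rw [Nat.succ_eq_add_one, pow_succ', mul_dvd_mul_iff_left Polynomial.X_ne_zero] at h1
        obtain ⟨ψ, rfl⟩ := h1
        rw [Submodule.mem_span_singleton]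
        refine ⟨ψ.coeff 0, ?_⟩
        rw [← hz]
        conv_rhs => rw [← Polynomial.divX_mul_X_add ψ]
        rw [map_mul, map_add, map_mul, map_pow, Polynomial.aeval_X, Polynomial.aeval_C,
          Nat.succ_sub_one, mul_add, mul_comm _ z, ← mul_assoc, ← pow_succ, (hzpow _).2 le_rfl,
          zero_mul, zero_add, Algebra.smul_def, mul_comm]
      · rw [Submodule.span_singleton_le_iff_mem]
        refine ⟨?_, z ^ (s - 1 - r), ?_⟩
        · change z * z ^ (s - 1) = 0
          rw [← pow_succ', hzpow]
          omega
        · rw [LinearMap.mulLeft_apply, ← pow_add]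
          congr 1
          omega
    rw [hspan, finrank_span_singleton]
    rw [Ne, hzpow]
    omega
  · rw [(hzpow r).2 (not_lt.1 hr), LinearMap.mulLeft_zero_eq_zero, LinearMap.range_zero, inf_bot_eq,
      finrank_bot]

open Classical in
theorem blockCount_mulLeft_root (hs : s ≠ 0) (μ : k) {r : ℕ} (hr : r ≠ 0) :
    blockCount (LinearMap.mulLeft k (root k n ((Polynomial.X - Polynomial.C ν) ^ s))) μ r
      = if μ = ν ∧ r = s then 1 else 0 := by
  rw [blockCount]
  by_cases hμ : μ = ν
  · subst hμ
    rw [kerRange_eq h hs, kerRange_eq h hs]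
    have : r - 1 < s ↔ r < s ∨ r = s := by omega
    by_cases h1 : r = s
    · subst h1
      simp [Nat.sub_lt (Nat.pos_of_ne_zero hr) one_pos]
    · simp [this, h1]
  · rw [kerRange_eq_zero_of_ne h hμ, kerRange_eq_zero_of_ne h hμ, sub_self, if_neg fun h => hμ h.1]

end CyclicAlg

/-! ### Jordan types of cyclic and of induced modules -/

namespace FinRep

variable {k : Type u} {G : Type v} [Field k] [Group G] [Finite G]

section

variable {g : G} (hg : ∀ x, x ∈ Subgroup.zpowers g)

include hg

open Classical in
/-- The Jordan block of size `s` with eigenvalue `ν` has exactly one block. -/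
theorem blockCount_cyc {ν : k} {s : ℕ}
    (h : (Polynomial.X - Polynomial.C ν) ^ s ∣ (Polynomial.X ^ Nat.card G - 1 : k[X]))
    (hs : s ≠ 0) (μ : k) {r : ℕ} (hr : r ≠ 0) :
    blockCount ((cyc hg ((Polynomial.X - Polynomial.C ν) ^ s)).ρ g) μ r
      = if μ = ν ∧ r = s then 1 else 0 := by
  rw [← CyclicAlg.blockCount_mulLeft_root h hs μ hr, ← one_mul μ]
  rw [blockCount_eq_of_equiv _ _ (cycEquiv hg _) one_ne_zero fun x => ?_, one_mul]
  rw [cycEquiv_ρ, one_smul, LinearMap.mulLeft_apply]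

/-- A proper subgroup of a cyclic group is contained in a subgroup of prime index. -/
theorem exists_prime_forall_dvd {H : Subgroup G} (hH : H < ⊤) :
    ∃ l : ℕ, l.Prime ∧ l ∣ Nat.card G ∧ ∀ i, g ^ i ∈ H → l ∣ i := by
  have hN : H.Normal := ⟨fun x hx y => by
    obtain ⟨i, rfl⟩ := exists_pow_eq_of_forall_mem_zpowers hg x
    obtain ⟨j, rfl⟩ := exists_pow_eq_of_forall_mem_zpowers hg y
    rwa [← pow_add, add_comm, pow_add, mul_inv_cancel_right]⟩
  obtain ⟨l, hl, hld⟩ := Nat.exists_prime_and_dvd (mt Subgroup.index_eq_one.1 hH.ne)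
  refine ⟨l, hl, hld.trans H.index_dvd_card, fun i hi => hld.trans ?_⟩
  have h1 : ∀ x : G ⧸ H, x ∈ Subgroup.zpowers (g : G ⧸ H) := fun x => by
    obtain ⟨x, rfl⟩ := QuotientGroup.mk_surjective x
    obtain ⟨i, rfl⟩ := exists_pow_eq_of_forall_mem_zpowers hg x
    exact ⟨i, by simp⟩
  rw [Subgroup.index, ← orderOf_eq_card_of_forall_mem_zpowers h1, orderOf_dvd_iff_pow_eq_one,
    ← QuotientGroup.mk_pow, QuotientGroup.eq_one_iff]
  exact hi

/-- A homomorphism sending the generator to an element of order dividing `l` is trivial on a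
subgroup contained in the one of index `l`. -/
theorem genHom_eq_one {A : Type*} [Monoid A] {e : A} (he : e ^ Nat.card G = 1) {l : ℕ}
    (hel : e ^ l = 1) {H : Subgroup G} (hH : ∀ i, g ^ i ∈ H → l ∣ i) (x : H) :
    genHom hg e he x = 1 := by
  obtain ⟨i, hi⟩ := exists_pow_eq_of_forall_mem_zpowers hg (x : G)
  obtain ⟨j, rfl⟩ := hH i (hi ▸ x.2)
  rw [← hi, map_pow, genHom_gen, pow_mul, hel, one_pow]

end

/-- The map `a ↦ ⟦h ⊗ a⟧` to an induced representation. -/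
noncomputable def indMk (H : Subgroup G) (A : FinRep k H) (h : G) : A.V →ₗ[k] (A.ind H).V :=
  IndAux.mk H.subtype A.ρ h

theorem indMk_mul (H : Subgroup G) (A : FinRep k H) (x : H) (h : G) (a : A.V) :
    indMk H A (x * h) (A.ρ x a) = indMk H A h a :=
  IndAux.mk_mul H.subtype A.ρ x h a

theorem ind_ρ_indMk (H : Subgroup G) (A : FinRep k H) (g h : G) (a : A.V) :
    (A.ind H).ρ g (indMk H A h a) = indMk H A (h * g⁻¹) a :=
  IndAux.ind_mk ..

theorem ind_hom_ext {H : Subgroup G} {A : FinRep k H} {B : Type*} [AddCommGroup B] [Module k B]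
    {S T : (A.ind H).V →ₗ[k] B} (hST : ∀ h a, S (indMk H A h a) = T (indMk H A h a)) : S = T := by
  have hadd : ∀ x y, S x = T x → S y = T y → S (x + y) = T (x + y) := fun x y hx hy => by
    rw [map_add, map_add, hx, hy]
  exact LinearMap.ext fun x =>
    IndAux.induction_on H.subtype A.ρ (P := fun x => S x = T x) x hST hadd

/-- The operator `⟦h ⊗ a⟧ ↦ f h • ⟦h ⊗ a⟧` on an induced representation, for a function `f` on the
cosets of the subgroup. -/
noncomputable def indScale (H : Subgroup G) (A : FinRep k H) (f : G → k)
    (hf : ∀ (x : H) (h : G), f (x * h) = f h) : Module.End k (A.ind H).V :=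
  IndAux.lift H.subtype A.ρ (fun h => f h • indMk H A h) fun x h a => by
    rw [LinearMap.smul_apply, LinearMap.smul_apply, Subgroup.subtype_apply, indMk_mul, hf]

theorem indScale_indMk (H : Subgroup G) (A : FinRep k H) (f : G → k)
    (hf : ∀ (x : H) (h : G), f (x * h) = f h) (h : G) (a : A.V) :
    indScale H A f hf (indMk H A h a) = f h • indMk H A h a :=
  IndAux.lift_mk H.subtype A.ρ (fun h => f h • indMk H A h) _ h a

/-- The Jordan type of an induced representation is invariant under twisting by a character that
is trivial on the subgroup. -/
theorem blockCount_ind_mul (H : Subgroup G) (A : FinRep k H) (χ : G →* k)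
    (hχ : ∀ x : H, χ x = 1) (g : G) (μ : k) (r : ℕ) :
    blockCount ((A.ind H).ρ g) (χ g * μ) r = blockCount ((A.ind H).ρ g) μ r := by
  have hinv : ∀ x, χ x * χ x⁻¹ = 1 := fun x => by rw [← map_mul, mul_inv_cancel, map_one]
  have hinv' : ∀ x, χ x⁻¹ * χ x = 1 := fun x => by rw [← map_mul, inv_mul_cancel, map_one]
  let S := indScale H A χ fun x h => by rw [map_mul, hχ, one_mul]
  let S' := indScale H A (fun h => χ h⁻¹) fun x h => by
    rw [mul_inv_rev, map_mul, ← Subgroup.coe_inv, hχ, mul_one]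
  have hSS' : S ∘ₗ S' = LinearMap.id := ind_hom_ext fun h a => by
    rw [LinearMap.comp_apply, indScale_indMk, map_smul, indScale_indMk, smul_smul, hinv', one_smul,
      LinearMap.id_apply]
  have hS'S : S' ∘ₗ S = LinearMap.id := ind_hom_ext fun h a => by
    rw [LinearMap.comp_apply, indScale_indMk, map_smul, indScale_indMk, smul_smul, hinv, one_smul,
      LinearMap.id_apply]
  let e : (A.ind H).V ≃ₗ[k] (A.ind H).V := LinearEquiv.ofLinearMap S S' hSS' hS'S
  have he : ∀ x, e ((A.ind H).ρ g x) = χ g⁻¹ • (A.ind H).ρ g (e x) := by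
    have : S ∘ₗ (A.ind H).ρ g = χ g⁻¹ • ((A.ind H).ρ g ∘ₗ S) := ind_hom_ext fun h a => by
      rw [LinearMap.smul_apply, LinearMap.comp_apply, LinearMap.comp_apply, ind_ρ_indMk,
        indScale_indMk, indScale_indMk, map_smul, ind_ρ_indMk, smul_smul, map_mul, mul_comm]
    exact LinearMap.congr_fun this
  rw [← blockCount_eq_of_equiv _ _ e (left_ne_zero_of_mul_eq_one (hinv' g)) he, ← mul_assoc,
    hinv', one_mul]

/-- If a homomorphism from `G` to the additive group of `k` is trivial on the subgroup but not on
`g`, then in an induced representation `g` has no Jordan blocks of size prime to the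
characteristic. -/
theorem blockCount_ind_eq_zero (H : Subgroup G) (A : FinRep k H) (c : G →* Multiplicative k)
    (hc : ∀ x : H, c x = 1) {g : G} (hcg : c g = Multiplicative.ofAdd 1) {μ : k} (hμ : μ ≠ 0)
    {r : ℕ} (hr : (r : k) ≠ 0) : blockCount ((A.ind H).ρ g) μ r = 0 := by
  refine blockCount_eq_zero_of_derivation _
    (indScale H A (fun h => (c h).toAdd) fun x h => by rw [map_mul, hc, one_mul]) ?_ hμ hr
  refine ind_hom_ext fun h a => ?_
  rw [LinearMap.sub_apply, Module.End.mul_apply, Module.End.mul_apply, ind_ρ_indMk, indScale_indMk,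
    indScale_indMk, map_smul, ind_ρ_indMk, map_mul, map_inv, hcg, toAdd_mul, toAdd_inv, toAdd_ofAdd,
    add_smul, neg_smul, one_smul, sub_eq_add_neg]

end FinRep

/-! ### Sums of block counts -/

section blockSum

variable {k V V' : Type*} [Field k] [AddCommGroup V] [Module k V] [AddCommGroup V'] [Module k V']
  {A : Type*} [CommRing A]

/-- The sum `∑ i < m, b i * y ^ i`, where `b i` is the number of Jordan blocks of `T` of size `r`
with eigenvalue `ζ ^ i`. -/
noncomputable def blockSum (ζ : k) (m : ℕ) (y : A) (T : Module.End k V) (r : ℕ) : A :=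
  ∑ i ∈ Finset.range m, (blockCount T (ζ ^ i) r : A) * y ^ i

theorem blockSum_eq_of_equiv (ζ : k) (m : ℕ) (y : A) (T : Module.End k V) (T' : Module.End k V')
    (e : V ≃ₗ[k] V') (h : ∀ x, e (T x) = T' (e x)) (r : ℕ) :
    blockSum ζ m y T r = blockSum ζ m y T' r := by
  refine Finset.sum_congr rfl fun i _ => ?_
  rw [← blockCount_eq_of_equiv T T' e one_ne_zero (fun x => by rw [h, one_smul]), one_mul]

theorem blockSum_prodMap [Module.Finite k V] [Module.Finite k V'] (ζ : k) (m : ℕ) (y : A)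
    (T : Module.End k V) (T' : Module.End k V') (r : ℕ) :
    blockSum ζ m y (LinearMap.prodMap T T' : Module.End k (V × V')) r
      = blockSum ζ m y T r + blockSum ζ m y T' r := by
  rw [blockSum, blockSum, blockSum, ← Finset.sum_add_distrib]
  refine Finset.sum_congr rfl fun i _ => ?_
  have h : (LinearMap.prodMap T T' - algebraMap k _ (ζ ^ i) : Module.End k (V × V'))
      = LinearMap.prodMap (T - algebraMap k _ (ζ ^ i)) (T' - algebraMap k _ (ζ ^ i)) := rfl
  rw [← add_mul, ← Int.cast_add, blockCount, h, kerRange_prodMap, kerRange_prodMap, blockCount,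
    blockCount]
  congr 2
  push_cast
  ring

theorem sum_range_add_of_periodic {A : Type*} [AddCommGroup A] {f : ℕ → A} {m : ℕ}
    (hf : ∀ i, f (i + m) = f i) (d : ℕ) :
    ∑ i ∈ Finset.range m, f (i + d) = ∑ i ∈ Finset.range m, f i := by
  induction d with
  | zero => rfl
  | succ d ih =>
    rw [← ih]
    have h := Finset.sum_range_succ' (fun i => f (i + d)) m
    rw [Finset.sum_range_succ, zero_add, add_comm m d, hf] at h
    rw [add_right_cancel h]
    exact Finset.sum_congr rfl fun i _ => by rw [add_right_comm, add_assoc]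

/-- If the Jordan type of `T` is invariant under multiplication of the eigenvalues by `ζ ^ d`, then
`blockSum` is invariant under multiplication by `y ^ d`, hence vanishes. -/
theorem blockSum_eq_zero [IsDomain A] {ζ : k} {m : ℕ} {y : A} (hζ : ζ ^ m = 1) (hy : y ^ m = 1)
    {T : Module.End k V} {r d : ℕ} (hd : y ^ d ≠ 1)
    (hT : ∀ μ, blockCount T (ζ ^ d * μ) r = blockCount T μ r) : blockSum ζ m y T r = 0 := by
  have h : y ^ d * blockSum ζ m y T r = blockSum ζ m y T r := by
    refine Eq.trans ?_ (sum_range_add_of_periodic (m := m)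
      (f := fun i => (blockCount T (ζ ^ i) r : A) * y ^ i)
      (fun i => by rw [pow_add, pow_add, hζ, hy, mul_one, mul_one]) d)
    rw [blockSum, Finset.mul_sum]
    refine Finset.sum_congr rfl fun i _ => ?_
    rw [pow_add, mul_comm (ζ ^ i), hT, pow_add]
    ring
  have h1 : (y ^ d - 1) * blockSum ζ m y T r = 0 := by rw [sub_mul, h, one_mul, sub_self]
  exact (mul_eq_zero.1 h1).resolve_left (sub_ne_zero.2 hd)

end blockSum

namespace RepRing

variable {k : Type u} {G : Type v} [Field k] [Group G] {A : Type*} [CommRing A]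

/-- The additive map sending the class of `W` to `blockSum` of the action of `g` on `W`. -/
noncomputable def blockSumHom (g : G) (ζ : k) (m : ℕ) (y : A) (r : ℕ) : RepRing k G →+ A :=
  lift (Quotient.lift (fun W : FinRep k G => blockSum ζ m y (W.ρ g) r) fun W W' h => by
    obtain ⟨e, he⟩ := FinRep.exists_of_equiv h
    exact blockSum_eq_of_equiv ζ m y _ _ e (he g) r) fun a b => by
      induction a using Quotient.ind
      induction b using Quotient.ind
      exact blockSum_prodMap ζ m y _ _ r

theorem blockSumHom_of_mk (g : G) (ζ : k) (m : ℕ) (y : A) (r : ℕ) (W : FinRep k G) :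
    blockSumHom g ζ m y r (of (RepClass.mk W)) = blockSum ζ m y (W.ρ g) r :=
  lift_of ..

variable [Finite G] {g : G} (hg : ∀ x, x ∈ Subgroup.zpowers g)

include hg

theorem blockSumHom_jordan {ζ : k} {m : ℕ} (hζ : IsPrimitiveRoot ζ m) (y : A) {r j s : ℕ}
    (hr : r ≠ 0) (hs : s ≠ 0) (hj : j < m)
    (h : (Polynomial.X - Polynomial.C (ζ ^ j)) ^ s ∣ (Polynomial.X ^ Nat.card G - 1 : k[X])) :
    blockSumHom g ζ m y r (jordan hg (ζ ^ j) s) = if r = s then y ^ j else 0 := by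
  classical
  rw [jordan, blockSumHom_of_mk, blockSum, Finset.sum_eq_single_of_mem j (Finset.mem_range.2 hj)]
  · rw [FinRep.blockCount_cyc hg h hs _ hr]
    split_ifs with h1 h2 h2
    · rw [Int.cast_one, one_mul]
    · exact absurd h1.2 h2
    · exact absurd ⟨rfl, h2⟩ h1
    · rw [Int.cast_zero, zero_mul]
  · intro i hi hij
    rw [FinRep.blockCount_cyc hg h hs _ hr, if_neg, Int.cast_zero, zero_mul]
    exact fun h => hij (hζ.pow_inj (Finset.mem_range.1 hi) hj h.1)

/-- `blockSumHom` kills the induced modules: for a subgroup of prime index `l`, the Jordan type of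
an induced module is invariant under multiplication of the eigenvalues by a primitive `l`-th root of
unity if `l ∣ m`, and has no blocks of size prime to `p` if `l = p`. -/
theorem blockSumHom_eq_zero_of_mem [IsDomain A] {p α m : ℕ} (hp : p.Prime)
    (hchar : CharP k p ∨ α = 0) (hcard : Nat.card G = m * p ^ α) {ζ : k}
    (hζ : IsPrimitiveRoot ζ m) {y : A} (hy : IsPrimitiveRoot y m) {r : ℕ}
    (hr : (p ^ α).Coprime r) {x : RepRing k G} (hx : x ∈ inducedIdeal k G) :
    blockSumHom g ζ m y r x = 0 := by
  have hm0 : 0 < m := Nat.pos_of_ne_zero <| by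
    rintro rfl
    exact Nat.card_pos.ne' (hcard.trans (zero_mul _))
  suffices h : inducedSubgroup k G ≤ (blockSumHom g ζ m y r).ker from h hx
  refine iSup₂_le fun H hH => ?_
  rintro _ ⟨z, rfl⟩
  suffices h : (blockSumHom g ζ m y r).comp (ind H) = 0 from DFunLike.congr_fun h z
  refine addHom_ext fun W => ?_
  rw [AddMonoidHom.comp_apply, ind_of, AddMonoidHom.zero_apply]
  induction W using Quotient.ind with | _ W
  refine (blockSumHom_of_mk g ζ m y r (W.ind H)).trans ?_
  obtain ⟨l, hl, hlG, hlH⟩ := FinRep.exists_prime_forall_dvd hg hH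
  by_cases hlm : l ∣ m
  · have hdl : m / l * l = m := Nat.div_mul_cancel hlm
    have he1 : (ζ ^ (m / l)) ^ l = 1 := by rw [← pow_mul, hdl, hζ.pow_eq_one]
    have he : (ζ ^ (m / l)) ^ Nat.card G = 1 := by
      obtain ⟨c, hc⟩ := hlG
      rw [hc, pow_mul, he1, one_pow]
    refine blockSum_eq_zero (d := m / l) hζ.pow_eq_one hy.pow_eq_one ?_ fun μ => ?_
    · exact hy.pow_ne_one_of_pos_of_lt (Nat.div_pos (Nat.le_of_dvd hm0 hlm) hl.pos).ne'
        (Nat.div_lt_self hm0 hl.one_lt)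
    · have := FinRep.blockCount_ind_mul H W (FinRep.genHom hg _ he)
        (FinRep.genHom_eq_one hg he he1 hlH) g μ r
      rwa [FinRep.genHom_gen] at this
  · have hlp : l ∣ p ^ α := by
      rw [hcard] at hlG
      exact (hl.dvd_mul.1 hlG).resolve_left hlm
    have hα : α ≠ 0 := by
      rintro rfl
      exact hl.one_lt.ne' (Nat.dvd_one.1 hlp)
    obtain rfl := (Nat.prime_dvd_prime_iff_eq hl hp).1 (hl.dvd_of_dvd_pow hlp)
    have hCP := hchar.resolve_right hα
    have he1 : Multiplicative.ofAdd (1 : k) ^ l = 1 := by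
      rw [← ofAdd_nsmul, nsmul_eq_mul, mul_one, CharP.cast_eq_zero, ofAdd_zero]
    have he : Multiplicative.ofAdd (1 : k) ^ Nat.card G = 1 := by
      obtain ⟨c, hc⟩ := hlG
      rw [hc, pow_mul, he1, one_pow]
    refine Finset.sum_eq_zero fun i _ => ?_
    rw [FinRep.blockCount_ind_eq_zero H W (FinRep.genHom hg _ he)
      (FinRep.genHom_eq_one hg he he1 hlH) (FinRep.genHom_gen hg _ he)
      (pow_ne_zero _ (hζ.ne_zero hm0.ne')), Int.cast_zero, zero_mul]
    rw [Ne, CharP.cast_eq_zero_iff k l]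
    intro hlr
    exact hl.one_lt.ne' (Nat.dvd_one.1 (hr ▸ Nat.dvd_gcd hlp hlr))

end RepRing

theorem isDomain_cyclotomicQuotient {m : ℕ} (hm : 0 < m) : IsDomain (CyclotomicQuotient m) := by
  have hirr : Irreducible (Polynomial.cyclotomic m ℤ) := Polynomial.cyclotomic.irreducible hm
  have : (Ideal.span {Polynomial.cyclotomic m ℤ}).IsPrime :=
    (Ideal.span_singleton_prime hirr.ne_zero).2 hirr.prime
  exact Ideal.Quotient.isDomain _

theorem isPrimitiveRoot_cyclotomicQuotient {m : ℕ} (hm : 0 < m) :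
    IsPrimitiveRoot (Ideal.Quotient.mk _ Polynomial.X : CyclotomicQuotient m) m := by
  have hζ := Complex.isPrimitiveRoot_exp m hm.ne'
  set ζ := Complex.exp (2 * Real.pi * Complex.I / m)
  let f : CyclotomicQuotient m →+* ℂ := Ideal.Quotient.lift _ (Polynomial.aeval ζ).toRingHom
    fun a ha => by
      obtain ⟨b, rfl⟩ := Ideal.mem_span_singleton'.1 ha
      have : Polynomial.aeval ζ (Polynomial.cyclotomic m ℤ) = 0 := by
        rw [Polynomial.aeval_def, ← Polynomial.eval_map, Polynomial.map_cyclotomic]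
        exact hζ.isRoot_cyclotomic hm
      change Polynomial.aeval ζ (b * _) = 0
      rw [map_mul, this, mul_zero]
  have hf : f (Ideal.Quotient.mk _ Polynomial.X) = ζ :=
    (Ideal.Quotient.lift_mk ..).trans (Polynomial.aeval_X ζ)
  refine ⟨?_, fun l h => hζ.dvd_of_pow_eq_one l ?_⟩
  · rw [← sub_eq_zero, ← map_pow, ← map_one (Ideal.Quotient.mk _), ← map_sub,
      Ideal.Quotient.eq_zero_iff_mem, Ideal.mem_span_singleton]
    exact Polynomial.cyclotomic.dvd_X_pow_sub_one m ℤ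
  · rw [← hf, ← map_pow, h, map_one]

/-! ### The ranks of the quotients of polynomial rings -/

theorem quantumNumber_monic_natDegree (n : ℕ) :
    (quantumNumber ((n + 1 : ℕ) : ℤ)).Monic ∧ (quantumNumber ((n + 1 : ℕ) : ℤ)).natDegree = n := by
  induction n using Nat.twoStepInduction with
  | zero =>
    rw [zero_add, Nat.cast_one, quantumNumber_one]
    exact ⟨Polynomial.monic_one, Polynomial.natDegree_one⟩
  | one =>
    have h : quantumNumber ((1 + 1 : ℕ) : ℤ) = Polynomial.X := by
      rw [quantumNumber_eq]
      norm_num [quantumNumber_one, quantumNumber_zero]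
    rw [h]
    exact ⟨Polynomial.monic_X, Polynomial.natDegree_X⟩
  | more n h1 h2 =>
    have h : quantumNumber ((n + 2 + 1 : ℕ) : ℤ)
        = Polynomial.X * quantumNumber ((n + 1 + 1 : ℕ) : ℤ)
        - quantumNumber ((n + 1 : ℕ) : ℤ) := by
      rw [quantumNumber_eq]
      congr 3 <;> push_cast <;> ring
    have hm : (Polynomial.X * quantumNumber ((n + 1 + 1 : ℕ) : ℤ)).Monic :=
      Polynomial.monic_X.mul h2.1
    have hd : (Polynomial.X * quantumNumber ((n + 1 + 1 : ℕ) : ℤ)).natDegree = n + 2 := by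
      rw [Polynomial.natDegree_X_mul h2.1.ne_zero, h2.2]
    have hlt : (quantumNumber ((n + 1 : ℕ) : ℤ)).natDegree
        < (Polynomial.X * quantumNumber ((n + 1 + 1 : ℕ) : ℤ)).natDegree := by
      rw [hd, h1.2]
      omega
    rw [h]
    exact ⟨hm.sub_of_left (Polynomial.degree_lt_degree hlt),
      (Polynomial.natDegree_sub_eq_left_of_natDegree_lt hlt).trans hd⟩

section adjoin

open Pointwise

variable {B : Type*} [CommRing B]

theorem quantumAt_eq_aeval_map {S : Type*} [CommRing S] [Algebra S B] (n : ℤ) (x : B) :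
    quantumAt n x = Polynomial.aeval x ((quantumNumber n).map (algebraMap ℤ S)) := by
  rw [quantumAt, Polynomial.aeval_map_algebraMap]

theorem relatorD_comp_castSucc (p : ℕ) {α : ℕ} (x : Fin (α + 1) → B) (j : ℕ) (hj : j ≤ α) :
    relatorD p (x ∘ Fin.castSucc) j hj = relatorD p x j (hj.trans α.le_succ) := by
  induction j with
  | zero => rfl
  | succ j ih =>
    rw [relatorD, relatorD, ih]
    rfl

theorem relator_comp_castSucc (p : ℕ) {α : ℕ} (x : Fin (α + 1) → B) (j : Fin α) :
    relator p (x ∘ Fin.castSucc) j = relator p x j.castSucc := by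
  rw [relator, relator, relatorF, relatorF, relatorD_comp_castSucc]
  rfl

theorem relatorD_mem {S : Subring B} (p : ℕ) {α : ℕ} {x : Fin α → B} (hx : ∀ i, x i ∈ S) (j : ℕ)
    (hj : j ≤ α) : relatorD p x j hj ∈ S := by
  induction j with
  | zero => exact one_mem S
  | succ j ih => exact sub_mem (mul_mem (quantumAt_mem (hx _) _) (ih _)) (quantumAt_mem (hx _) _)

/-- The ring generated by elements `x 0, …, x (α - 1)` at which the relators vanish is generated by
`φ (p ^ α)` elements as an abelian group: modulo the previous ones, the first variable is a root of
a monic polynomial of degree `p - 1`, the later ones of monic polynomials of degree `p`. -/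
theorem exists_adjoin_le_span {p : ℕ} (hp : p.Prime) {α : ℕ} (x : Fin α → B)
    (hx : ∀ j, relator p x j = 0) :
    ∃ s : Finset B, s.card ≤ (p ^ α).totient ∧
      Subalgebra.toSubmodule (Algebra.adjoin ℤ (Set.range x)) ≤ Submodule.span ℤ (s : Set B) := by
  classical
  rcases subsingleton_or_nontrivial B with hB | hB
  · exact ⟨∅, by simp, fun b _ => Subsingleton.elim 0 b ▸ zero_mem _⟩
  induction α with
  | zero =>
    refine ⟨{1}, by simp, ?_⟩
    rw [Set.range_eq_empty, Algebra.adjoin_empty, Algebra.toSubmodule_bot, Submodule.one_eq_span,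
      Finset.coe_singleton]
  | succ α ih =>
    obtain ⟨s, hs, hspan⟩ := ih (x ∘ Fin.castSucc) fun j => by rw [relator_comp_castSucc, hx]
    set S := Algebra.adjoin ℤ (Set.range (x ∘ Fin.castSucc)) with hS
    have hrange : Set.range x = Set.range (x ∘ Fin.castSucc) ∪ {x (Fin.last α)} := by
      ext b
      simp only [Set.mem_range, Set.mem_union, Set.mem_singleton_iff, Fin.exists_fin_succ',
        Function.comp_apply, eq_comm]
    obtain ⟨q, rfl⟩ := Nat.exists_eq_succ_of_ne_zero hp.pos.ne'
    -- a monic polynomial over the ring of the previous variables that kills the last one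
    obtain ⟨hqm, hqd⟩ := quantumNumber_monic_natDegree q
    have key : ∃ f : S[X], f.Monic ∧ Polynomial.aeval (x (Fin.last α)) f = 0 ∧
        (((q + 1) ^ α).totient) * f.natDegree = ((q + 1) ^ (α + 1)).totient := by
      rcases Nat.eq_zero_or_pos α with rfl | hα
      · refine ⟨(quantumNumber ((q + 1 : ℕ) : ℤ)).map (algebraMap ℤ S), hqm.map _, ?_, ?_⟩
        · rw [← quantumAt_eq_aeval_map]
          exact hx 0
        · rw [hqm.natDegree_map, hqd, pow_zero, zero_add, pow_one, Nat.totient_prime hp,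
            Nat.totient_one, one_mul, Nat.succ_sub_one]
      · have hD : relatorD (q + 1) x α α.le_succ ∈ S := by
          rw [← relatorD_comp_castSucc (q + 1) x α le_rfl]
          exact relatorD_mem (S := S.toSubring) _
            (fun i => Algebra.subset_adjoin (Set.mem_range_self i)) _ _
        let D : S := ⟨_, hD⟩
        refine ⟨(Polynomial.X - Polynomial.C (2 * D))
          * (quantumNumber ((q + 1 : ℕ) : ℤ)).map (algebraMap ℤ S),
          (Polynomial.monic_X_sub_C _).mul (hqm.map _), ?_, ?_⟩
        · have h := hx (Fin.last α)
          rw [relator, if_neg (by rw [Fin.val_last]; exact hα.ne'), relatorF] at h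
          rw [map_mul, ← quantumAt_eq_aeval_map, map_sub, Polynomial.aeval_X, Polynomial.aeval_C,
            map_mul, map_ofNat]
          exact h
        · rw [(Polynomial.monic_X_sub_C _).natDegree_mul (hqm.map _), Polynomial.natDegree_X_sub_C,
            hqm.natDegree_map, hqd, Nat.totient_prime_pow hp hα,
            Nat.totient_prime_pow hp α.succ_pos]
          obtain ⟨β, rfl⟩ := Nat.exists_eq_succ_of_ne_zero hα.ne'
          simp only [Nat.succ_sub_one, Nat.succ_eq_add_one]
          ring
    obtain ⟨f, hf, hfx, hdeg⟩ := key
    let t : Finset B := Finset.image (x (Fin.last α) ^ ·) (Finset.range f.natDegree)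
    refine ⟨s * t, ?_, fun b hb => ?_⟩
    · rw [← hdeg]
      exact Finset.card_mul_le.trans (Nat.mul_le_mul hs (Finset.card_image_le.trans_eq
        (Finset.card_range _)))
    · rw [hrange, Algebra.adjoin_union_eq_adjoin_adjoin] at hb
      have hb' : b ∈ Submodule.span S (t : Set B) := by
        rw [Submodule.span_range_natDegree_eq_adjoin hf hfx]
        exact hb
      clear hb
      have hmul : b ∈ Subalgebra.toSubmodule S * Submodule.span ℤ (t : Set B) := by
        induction hb' using Submodule.span_induction with
        | mem c hc =>
          rw [← one_mul c]
          exact Submodule.mul_mem_mul (one_mem S) (Submodule.subset_span hc)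
        | zero => exact zero_mem _
        | add c d _ _ hc hd => exact add_mem hc hd
        | smul a c _ hc =>
          rw [← (Subalgebra.isIdempotentElem_toSubmodule S).eq, mul_assoc]
          exact Submodule.mul_mem_mul a.2 hc
      rw [Finset.coe_mul, ← Submodule.span_mul_span]
      exact mul_le_mul_left hspan _ hmul

end adjoin

/-- The ring `ℤ[X_0, …, X_{α-1}] / ([p]_{X_0}, F_1, …, F_{α-1})` is generated by `φ (p ^ α)`
elements as an abelian group. -/
theorem exists_span_quantumQuotient {p : ℕ} (hp : p.Prime) (α : ℕ) :
    ∃ s : Finset (QuantumQuotient p α), s.card ≤ (p ^ α).totient ∧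
      Submodule.span ℤ (s : Set (QuantumQuotient p α)) = ⊤ := by
  let I := Ideal.span (Set.range (relator p (MvPolynomial.X : Fin α → MvPolynomial (Fin α) ℤ)))
  obtain ⟨s, hs, hspan⟩ := exists_adjoin_le_span hp
    (fun i => Ideal.Quotient.mk I (MvPolynomial.X i)) fun j => by
      refine (map_relator (Ideal.Quotient.mk I) p MvPolynomial.X j).symm.trans ?_
      exact Ideal.Quotient.eq_zero_iff_mem.2 (Ideal.subset_span ⟨j, rfl⟩)
  refine ⟨s, hs, eq_top_iff.2 fun b _ => hspan ?_⟩
  obtain ⟨f, rfl⟩ := Ideal.Quotient.mk_surjective b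
  change Ideal.Quotient.mk I f ∈ Algebra.adjoin ℤ _
  induction f using MvPolynomial.induction_on with
  | C a =>
    rw [eq_intCast, map_intCast]
    exact intCast_mem _ a
  | add f g hf hg =>
    rw [map_add]
    exact add_mem (hf trivial) (hg trivial)
  | mul_X f i hf =>
    rw [map_mul]
    exact mul_mem (hf trivial) (Algebra.subset_adjoin ⟨i, rfl⟩)

section cyclotomic

variable (m : ℕ)

theorem free_finite_cyclotomicQuotient :
    Module.Free ℤ (CyclotomicQuotient m) ∧ Module.Finite ℤ (CyclotomicQuotient m) ∧
      Module.finrank ℤ (CyclotomicQuotient m) = m.totient := by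
  have hm := Polynomial.cyclotomic.monic m ℤ
  let b : Module.Basis (Fin (AdjoinRoot.powerBasis' hm).dim) ℤ (CyclotomicQuotient m) :=
    (AdjoinRoot.powerBasis' hm).basis
  refine ⟨.of_basis b, .of_basis b, ?_⟩
  rw [Module.finrank_eq_card_basis b, Fintype.card_fin, AdjoinRoot.powerBasis'_dim,
    Polynomial.natDegree_cyclotomic]

end cyclotomic

/-! ### The presentation of the ring of non-induced representations -/

/-- The universal property of the presented ring. -/
theorem exists_hom_combinedQuotient {R : Type*} [CommRing R] {m p α : ℕ} {y : R} {x : Fin α → R}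
    (hy : Polynomial.eval₂ (Int.castRingHom R) y (Polynomial.cyclotomic m ℤ) = 0)
    (hx : ∀ j, relator p x j = 0) :
    ∃ f : CombinedQuotient m p α →+* R, f (Ideal.Quotient.mk _ (MvPolynomial.X none)) = y ∧
      ∀ i, f (Ideal.Quotient.mk _ (MvPolynomial.X (some i))) = x i := by
  let F : MvPolynomial (Option (Fin α)) ℤ →+* R :=
    MvPolynomial.eval₂Hom (Int.castRingHom R) fun o => o.elim y x
  have hFnone : F (MvPolynomial.X none) = y := MvPolynomial.eval₂Hom_X' ..
  have hFsome : ∀ i, F (MvPolynomial.X (some i)) = x i := fun i => MvPolynomial.eval₂Hom_X' ..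
  refine ⟨Ideal.Quotient.lift _ F fun a ha => ?_, (Ideal.Quotient.lift_mk ..).trans hFnone,
    fun i => (Ideal.Quotient.lift_mk ..).trans (hFsome i)⟩
  refine (Ideal.span_le (I := RingHom.ker F)).2 ?_ ha
  rintro a (rfl | ⟨j, rfl⟩)
  · change F (Polynomial.eval₂ _ _ _) = 0
    rw [Polynomial.hom_eval₂, hFnone, RingHom.ext_int (F.comp _) (Int.castRingHom _)]
    exact hy
  · refine (map_relator F p _ j).trans ?_
    rw [show F ∘ (fun i : Fin α => MvPolynomial.X (some i)) = x from funext hFsome]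
    exact hx j

theorem exists_hom_cyclotomicQuotient {R : Type*} [CommRing R] {m : ℕ} {y : R}
    (hy : Polynomial.eval₂ (Int.castRingHom R) y (Polynomial.cyclotomic m ℤ) = 0) :
    ∃ f : CyclotomicQuotient m →+* R, f (Ideal.Quotient.mk _ Polynomial.X) = y := by
  refine ⟨Ideal.Quotient.lift _ (Polynomial.eval₂RingHom (Int.castRingHom R) y) fun a ha => ?_,
    (Ideal.Quotient.lift_mk ..).trans (Polynomial.eval₂_X ..)⟩
  obtain ⟨b, rfl⟩ := Ideal.mem_span_singleton'.1 ha
  rw [map_mul, Polynomial.coe_eval₂RingHom, hy, mul_zero]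

theorem exists_hom_quantumQuotient {R : Type*} [CommRing R] {p α : ℕ} {x : Fin α → R}
    (hx : ∀ j, relator p x j = 0) :
    ∃ f : QuantumQuotient p α →+* R, ∀ i, f (Ideal.Quotient.mk _ (MvPolynomial.X i)) = x i := by
  let F : MvPolynomial (Fin α) ℤ →+* R := MvPolynomial.eval₂Hom (Int.castRingHom R) x
  have hF : ∀ i, F (MvPolynomial.X i) = x i := fun i => MvPolynomial.eval₂Hom_X' ..
  refine ⟨Ideal.Quotient.lift _ F fun a ha => ?_, fun i => (Ideal.Quotient.lift_mk ..).trans (hF i)⟩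
  refine (Ideal.span_le (I := RingHom.ker F)).2 ?_ ha
  rintro _ ⟨j, rfl⟩
  refine (map_relator F p _ j).trans ?_
  rw [show F ∘ MvPolynomial.X = x from funext hF]
  exact hx j

theorem eval₂_X_none_cyclotomic (m p α : ℕ) :
    Polynomial.eval₂ (Int.castRingHom (CombinedQuotient m p α))
      (Ideal.Quotient.mk _ (MvPolynomial.X none)) (Polynomial.cyclotomic m ℤ) = 0 := by
  rw [RingHom.ext_int (Int.castRingHom _) ((Ideal.Quotient.mk _).comp (algebraMap ℤ _)),
    ← Polynomial.hom_eval₂]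
  exact Ideal.Quotient.eq_zero_iff_mem.2 (Ideal.subset_span (Set.mem_insert _ _))

theorem relator_X_some (m p α : ℕ) (j : Fin α) :
    relator p (fun i : Fin α => (Ideal.Quotient.mk _ (MvPolynomial.X (some i)) :
      CombinedQuotient m p α)) j = 0 := by
  refine (map_relator (Ideal.Quotient.mk _) p
    (fun i : Fin α => MvPolynomial.X (some i)) j).symm.trans ?_
  exact Ideal.Quotient.eq_zero_iff_mem.2 (Ideal.subset_span (Set.mem_insert_of_mem _ ⟨j, rfl⟩))

theorem surjective_of_forall_X {A σ : Type*} [CommRing A] {I : Ideal (MvPolynomial σ ℤ)}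
    (F : A →+* MvPolynomial σ ℤ ⧸ I)
    (hF : ∀ o, ∃ a, F a = Ideal.Quotient.mk I (MvPolynomial.X o)) : Function.Surjective F := by
  intro x
  obtain ⟨x, rfl⟩ := Ideal.Quotient.mk_surjective x
  induction x using MvPolynomial.induction_on with
  | C a => exact ⟨a, by rw [eq_intCast, map_intCast, map_intCast]⟩
  | add a b ha hb =>
    obtain ⟨a', ha⟩ := ha
    obtain ⟨b', hb⟩ := hb
    exact ⟨a' + b', by rw [map_add, map_add, ha, hb]⟩
  | mul_X a o ha =>
    obtain ⟨a', ha⟩ := ha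
    obtain ⟨b', hb⟩ := hF o
    exact ⟨a' * b', by rw [map_mul, map_mul, ha, hb]⟩

theorem exists_tensor_hom_surjective (m p α : ℕ) :
    ∃ f : CyclotomicQuotient m ⊗[ℤ] QuantumQuotient p α →+* CombinedQuotient m p α,
      Function.Surjective f := by
  obtain ⟨f, hf⟩ := exists_hom_cyclotomicQuotient (eval₂_X_none_cyclotomic m p α)
  obtain ⟨h, hh⟩ := exists_hom_quantumQuotient (relator_X_some m p α)
  let F : CyclotomicQuotient m ⊗[ℤ] QuantumQuotient p α →+* CombinedQuotient m p α :=
    (Algebra.TensorProduct.productMap f.toIntAlgHom h.toIntAlgHom).toRingHom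
  have hF : ∀ a b, F (a ⊗ₜ b) = f a * h b := fun a b =>
    Algebra.TensorProduct.productMap_apply_tmul ..
  refine ⟨F, surjective_of_forall_X (A := CyclotomicQuotient m ⊗[ℤ] QuantumQuotient p α) F ?_⟩
  rintro (_ | i)
  · exact ⟨_ ⊗ₜ 1, by rw [hF, hf, map_one, mul_one]⟩
  · exact ⟨1 ⊗ₜ _, by rw [hF, hh, map_one, one_mul]⟩

namespace RepRing

variable {k : Type u} {G : Type v} [Field k] [Group G]

/-- The Frobenius, or `α = 0`. -/
theorem X_pow_mul_pow_sub_one_eq {k : Type*} [Field k] {p α : ℕ} (m : ℕ) (hp : p.Prime)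
    (hchar : CharP k p ∨ α = 0) :
    (Polynomial.X ^ (m * p ^ α) - 1 : k[X]) = (Polynomial.X ^ m - 1) ^ p ^ α := by
  rcases hchar with hk | rfl
  · have := Fact.mk hp
    rw [sub_pow_char_pow, one_pow, ← pow_mul]
  · rw [pow_zero, mul_one, pow_one]

theorem X_sub_C_pow_dvd_X_pow_sub_one {k : Type*} [Field k] {p α m : ℕ} (hp : p.Prime)
    (hchar : CharP k p ∨ α = 0) {μ : k} (hμ : μ ^ m = 1) {r : ℕ} (hr : r ≤ p ^ α) :
    (Polynomial.X - Polynomial.C μ) ^ r ∣ (Polynomial.X ^ (m * p ^ α) - 1 : k[X]) := by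
  rw [X_pow_mul_pow_sub_one_eq m hp hchar]
  refine (pow_dvd_pow _ hr).trans (pow_dvd_pow_of_dvd ?_ _)
  rw [Polynomial.dvd_iff_isRoot]
  simp [hμ]

theorem eq_top_of_forall_of_mem {T : AddSubgroup (RepRing k G)} (hT : ∀ a, of a ∈ T) : T = ⊤ := by
  have h : QuotientAddGroup.mk' T = 0 :=
    addHom_ext fun a => (QuotientAddGroup.eq_zero_iff (of a)).2 (hT a)
  refine eq_top_iff.2 fun x _ => ?_
  exact (QuotientAddGroup.eq_zero_iff x).1 (DFunLike.congr_fun h x)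

variable [Finite G] {g : G} (hg : ∀ x, x ∈ Subgroup.zpowers g) {p α m : ℕ} (hp : p.Prime)
  (hchar : CharP k p ∨ α = 0) (hcard : Nat.card G = m * p ^ α)
  {ζ : k} (hζ : IsPrimitiveRoot ζ m)

include hcard in
theorem pos_of_card_eq : 0 < m := Nat.pos_of_ne_zero <| by
  rintro rfl
  exact Nat.card_pos.ne' (hcard.trans (zero_mul _))

section

include hcard hζ

/-- The sum of the characters of order dividing `l` is induced from the trivial module of the
subgroup of index `l`. -/
theorem sum_mk_jordan_pow_eq_zero {l : ℕ} (hl : l.Prime) (hlm : l ∣ m) :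
    ∑ i ∈ Finset.range l,
      (Ideal.Quotient.mk (inducedIdeal k G) (jordan hg ζ 1) ^ (m / l)) ^ i = 0 := by
  have hm0 := pos_of_card_eq hcard
  have hω : IsPrimitiveRoot (ζ ^ (m / l)) l := hζ.pow hm0 (Nat.div_mul_cancel hlm).symm
  have hζG : ζ ^ Nat.card G = 1 := by rw [hcard, pow_mul, hζ.pow_eq_one, one_pow]
  have hlG : l ∣ Nat.card G := hcard ▸ hlm.mul_right _
  have hprod : (Polynomial.X ^ l - 1 : k[X])
      = ∏ i : Fin l, (Polynomial.X - Polynomial.C ((ζ ^ (m / l)) ^ (i : ℕ))) := by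
    have := NeZero.mk hl.ne_zero
    rw [Polynomial.X_pow_sub_one_eq_prod hl.pos hω]
    refine (Finset.prod_bij (fun (i : Fin l) _ => (ζ ^ (m / l)) ^ (i : ℕ)) ?_ ?_ ?_ ?_).symm
    · intro i _
      rw [Polynomial.mem_nthRootsFinset hl.pos, ← pow_mul, mul_comm, pow_mul, hω.pow_eq_one,
        one_pow]
    · intro i _ j _ hij
      exact Fin.ext (hω.pow_inj i.2 j.2 hij)
    · intro μ hμ
      obtain ⟨i, hi, rfl⟩ := hω.eq_pow_of_pow_eq_one ((Polynomial.mem_nthRootsFinset hl.pos _).1 hμ)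
      exact ⟨⟨i, hi⟩, Finset.mem_univ _, rfl⟩
    · intro i _
      rfl
  have hdvd : (Polynomial.X ^ l - 1 : k[X]) ∣ Polynomial.X ^ Nat.card G - 1 := by
    obtain ⟨c, hc⟩ := hlG
    rw [hc, pow_mul]
    simpa using sub_dvd_pow_sub_pow (Polynomial.X ^ l : k[X]) 1 c
  have h := FinRep.mk_cyc_eq_zero (k := k) hg hlG hl.one_lt.ne'
  rw [hprod, FinRep.of_cyc_prod hg _ ?_ (hprod ▸ hdvd), map_sum] at h
  · rw [Finset.sum_range, ← h]
    refine Finset.sum_congr rfl fun i _ => ?_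
    rw [← map_pow, ← map_pow, jordan_pow hg ζ hζG, jordan_pow hg, jordan, pow_one]
    rw [← pow_mul, mul_comm, pow_mul, hζG, one_pow]
  · intro i j hij
    refine Polynomial.isCoprime_X_sub_C_of_isUnit_sub (sub_ne_zero.2 fun h => ?_).isUnit
    exact hij (Fin.ext (hω.pow_inj i.2 j.2 h))

/-- A faithful character of the quotient of order `m` is a root of `Φ_m` modulo induced modules. -/
theorem eval₂_mk_jordan_cyclotomic :
    Polynomial.eval₂ (Int.castRingHom (NonInducedRing k G))
      (Ideal.Quotient.mk (inducedIdeal k G) (jordan hg ζ 1)) (Polynomial.cyclotomic m ℤ) = 0 := by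
  have hζG : ζ ^ Nat.card G = 1 := by rw [hcard, pow_mul, hζ.pow_eq_one, one_pow]
  have h : jordan hg ζ 1 ^ m = 1 := by
    rw [jordan_pow hg ζ hζG, hζ.pow_eq_one, jordan_one_one]
  refine eval₂_cyclotomic_eq_zero (pos_of_card_eq hcard) _ ?_ fun l hl hlm =>
    sum_mk_jordan_pow_eq_zero hg hcard hζ hl hlm
  rw [← map_pow, h, map_one]

end

include hp hchar hcard

theorem greenRelations_jordan : GreenRelations p (p ^ α) (fun r => jordan hg (1 : k) r) := by
  have hP : (Polynomial.X - Polynomial.C 1) ^ p ^ α ∣ (Polynomial.X ^ Nat.card G - 1 : k[X]) :=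
    hcard ▸ X_sub_C_pow_dvd_X_pow_sub_one hp hchar (one_pow m) le_rfl
  -- for `α = 0` only the relations for `V_0` and `V_1` remain
  rcases hchar with hk | rfl
  · exact
      { zero := jordan_zero hg 1
        one := jordan_one_one hg
        mul_two := fun b hb h => jordan_mul_two hg hP hb h
        mul_of_le := fun j a r hr h hrP => jordan_mul_jordan_of_le hg hP hp hr h hrP
        prime_pow_mul := fun j r hr h => jordan_prime_pow_mul hg hP hp hr h
        pred_mul_self := fun j r hr h => jordan_pred_mul_self hg hP hp hr h
        mul_succ := fun j q a hq ha h => jordan_mul_succ hg hP hp hq ha h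
        mul_succ_of_add_two_eq := fun j q a hq ha h =>
          jordan_mul_succ_of_add_two_eq hg hP hp hq ha h }
  · rw [pow_zero]
    have hpos : ∀ j, 0 < p ^ j := fun j => pow_pos hp.pos j
    exact
      { zero := jordan_zero hg 1
        one := jordan_one_one hg
        mul_two := fun b _ h => by omega
        mul_of_le := fun j a r _ h hrP => by
          obtain rfl : a = 0 := by
            by_contra ha
            have := Nat.mul_pos (Nat.pos_of_ne_zero ha) (hpos j)
            omega
          obtain rfl : r = 0 := by omega
          simp [jordan_one_one]
        prime_pow_mul := fun j r hr h => by
          have hj := hpos j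
          rw [show p ^ j = 1 by omega] at hr ⊢
          interval_cases r <;> simp [jordan_zero, jordan_one_one]
        pred_mul_self := fun j r hr h => by omega
        mul_succ := fun j q a hq _ h => by
          have := Nat.mul_pos a.succ_pos (hpos j)
          rw [Nat.succ_eq_add_one] at this
          omega
        mul_succ_of_add_two_eq := fun j q a hq _ h => by
          have := Nat.mul_pos a.succ_pos (hpos j)
          rw [Nat.succ_eq_add_one] at this
          omega }

/-- The Jordan block of size `p` is induced from the trivial module of the subgroup of index `p`. -/
theorem mk_jordan_prime_eq_zero (hα : α ≠ 0) :
    Ideal.Quotient.mk (inducedIdeal k G) (jordan hg (1 : k) p) = 0 := by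
  have hk := hchar.resolve_right hα
  have := Fact.mk hp
  have h : (Polynomial.X - Polynomial.C 1 : k[X]) ^ p = Polynomial.X ^ p - 1 := by
    rw [map_one, sub_pow_char, one_pow]
  rw [jordan, h]
  exact FinRep.mk_cyc_eq_zero hg (hcard ▸ (dvd_pow_self p hα).mul_left m) hp.one_lt.ne'

include hg hζ

/-- The ring `ℤ[X_0, …, X_{α-1}, Y] / (Φ_m(Y), [p]_{X_0}, F_1, …, F_{α-1})` maps onto the ring of
non-induced representations, `Y` going to a faithful character of the quotient of order `m` and
`X_j` to `V_{q+1} - V_{q-1}` for `q = p ^ j`, where `V_r` is the unipotent Jordan block of size `r`.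
-/
theorem exists_combinedQuotient_surjective :
    ∃ f : CombinedQuotient m p α →+* NonInducedRing k G, Function.Surjective f := by
  let π : RepRing k G →+* NonInducedRing k G := Ideal.Quotient.mk (inducedIdeal k G)
  let v : ℕ → NonInducedRing k G := fun r => π (jordan hg (1 : k) r)
  have hv : GreenRelations p (p ^ α) v :=
    GreenRelations.map (R' := NonInducedRing k G) π (greenRelations_jordan hg hp hchar hcard)
  obtain ⟨f, hfY, hfX⟩ := exists_hom_combinedQuotient (R := NonInducedRing k G)
    (x := fun i : Fin α => GreenRelations.gen p v i) (eval₂_mk_jordan_cyclotomic hg hcard hζ)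
    (hv.relator_eq_zero hp.two_le rfl fun hα => mk_jordan_prime_eq_zero hg hp hchar hcard hα)
  refine ⟨f, fun x => ?_⟩
  -- the range contains the characters `Y ^ i` and all `V_r`, hence all Jordan blocks
  let S : Subring (NonInducedRing k G) := RingHom.range f
  let T : AddSubgroup (RepRing k G) := S.toAddSubgroup.comap π.toAddMonoidHom
  have hT : T = ⊤ := by
    refine eq_top_of_forall_of_mem fun a => ?_
    induction a using Quotient.ind with | _ W
    refine (AddSubgroup.closure_le _).2 ?_ (of_mem_closure_jordan hg hζ (pos_of_card_eq hcard).ne'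
      (hcard ▸ X_pow_mul_pow_sub_one_eq m hp hchar) W)
    rintro _ ⟨i, r, hr, rfl⟩
    change π (jordan hg (ζ ^ i) r) ∈ S
    have hζG : ζ ^ Nat.card G = 1 := by rw [hcard, pow_mul, hζ.pow_eq_one, one_pow]
    have h1 := jordan_one_mul hg (ζ ^ i) 1
      (by rw [← pow_mul, mul_comm, pow_mul, hζG, one_pow])
      (hcard ▸ X_sub_C_pow_dvd_X_pow_sub_one hp hchar (one_pow m) hr)
    rw [mul_one, ← jordan_pow hg ζ hζG] at h1
    rw [← h1, map_mul, map_pow]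
    refine S.mul_mem (S.pow_mem (RingHom.mem_range.2 ⟨_, hfY⟩) i) ?_
    exact hv.mem_of_gen_mem (S := S) hp.two_le rfl
      (fun j hj => RingHom.mem_range.2 ⟨_, hfX ⟨j, hj⟩⟩) hr
  obtain ⟨x, rfl⟩ := Ideal.Quotient.mk_surjective x
  have hx : x ∈ T := hT ▸ AddSubgroup.mem_top x
  exact hx

end RepRing

/-! ### Comparison of the ranks -/

namespace RepRing

variable {k : Type u} {G : Type v} [Field k] [Group G] [Finite G] {g : G}
  (hg : ∀ x, x ∈ Subgroup.zpowers g) {p α m : ℕ} (hp : p.Prime)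
  (hchar : CharP k p ∨ α = 0) (hcard : Nat.card G = m * p ^ α)
  {ζ : k} (hζ : IsPrimitiveRoot ζ m)

include hg hp hchar hcard hζ

/-- Counting the Jordan blocks of each size `r ≤ p ^ α` prime to `p` maps the ring of non-induced
representations onto a free abelian group of rank `φ (m) φ (p ^ α)`. -/
theorem exists_blockSum_surjective :
    ∃ f : NonInducedRing k G →+
        ({r // r ∈ (Finset.Ico 1 (1 + p ^ α)).filter (p ^ α).Coprime} → CyclotomicQuotient m),
      Function.Surjective f := by
  classical
  have hm0 := pos_of_card_eq hcard
  have := isDomain_cyclotomicQuotient hm0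
  have hy := isPrimitiveRoot_cyclotomicQuotient hm0
  set y : CyclotomicQuotient m := Ideal.Quotient.mk _ Polynomial.X
  set ι := {r // r ∈ (Finset.Ico 1 (1 + p ^ α)).filter (p ^ α).Coprime}
  have hι : ∀ r : ι, (r : ℕ) ≠ 0 ∧ (r : ℕ) ≤ p ^ α ∧ (p ^ α).Coprime r := fun r => by
    have h := r.2
    rw [Finset.mem_filter, Finset.mem_Ico] at h
    exact ⟨by omega, by omega, h.2⟩
  let Λ : RepRing k G →+ (ι → CyclotomicQuotient m) :=
    AddMonoidHom.mk' (fun x r => blockSumHom g ζ m y r x) fun x z => funext fun r => map_add _ x z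
  have hΛ : ∀ x ∈ (inducedIdeal k G).toAddSubgroup, Λ x = 0 := fun x hx => funext fun r =>
    blockSumHom_eq_zero_of_mem hg hp hchar hcard hζ hy (hι r).2.2 hx
  have hsingle : ∀ (r : ι) (j : ℕ), Pi.single r (y ^ j) ∈ Λ.range := fun r j => by
    refine ⟨jordan hg (ζ ^ (j % m)) r, funext fun r' => ?_⟩
    refine (blockSumHom_jordan hg hζ y (hι r').1 (hι r).1 (Nat.mod_lt j hm0) (hcard ▸
      X_sub_C_pow_dvd_X_pow_sub_one hp hchar ?_ (hι r).2.1)).trans ?_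
    · rw [← pow_mul, mul_comm, pow_mul, hζ.pow_eq_one, one_pow]
    · rw [Pi.single_apply, ← pow_mod_orderOf y j, ← hy.eq_orderOf]
      exact if_congr Subtype.ext_iff.symm rfl rfl
  have hsurj : Λ.range = ⊤ := by
    refine eq_top_iff.2 fun x _ => ?_
    rw [← Finset.univ_sum_single x]
    refine AddSubgroup.sum_mem _ fun r _ => ?_
    obtain ⟨φ, hφ⟩ := Ideal.Quotient.mk_surjective (x r)
    rw [← hφ]
    clear hφ
    induction φ using Polynomial.induction_on' with
    | add φ ψ h1 h2 =>
      rw [map_add, Pi.single_add]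
      exact add_mem h1 h2
    | monomial j a =>
      have h1 : Ideal.Quotient.mk (Ideal.span {Polynomial.cyclotomic m ℤ})
          (Polynomial.monomial j a) = a • y ^ j := by
        rw [← Polynomial.C_mul_X_pow_eq_monomial, map_mul, map_pow, zsmul_eq_mul, eq_intCast,
          map_intCast]
      rw [h1]
      have h2 := map_zsmul (AddMonoidHom.single (fun _ : ι => CyclotomicQuotient m) r) a (y ^ j)
      exact Set.mem_of_eq_of_mem h2 (zsmul_mem (hsingle r j) a)
  refine ⟨QuotientAddGroup.lift _ Λ hΛ, fun x => ?_⟩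
  obtain ⟨z, rfl⟩ := AddMonoidHom.range_eq_top.1 hsurj x
  exact ⟨Ideal.Quotient.mk _ z, rfl⟩

end RepRing

/-- The `ℤ`-module structures are arbitrary instances, since the ones on function spaces, on tensor
products and on quotient rings are defined in different ways. -/
theorem bijective_of_surjective_of_finrank_int_le {M N : Type*} [AddCommGroup M] [AddCommGroup N]
    [Module ℤ M] [Module ℤ N] [Module.Free ℤ M] [Module.Finite ℤ M] [Module.Free ℤ N]
    [Module.Finite ℤ N] (f : M →+ N) (hf : Function.Surjective f)
    (h : Module.finrank ℤ M ≤ Module.finrank ℤ N) : Function.Bijective f :=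
  OrzechProperty.bijective_of_surjective_of_finrank_le
    ({ f with map_smul' := fun c x => map_intCast_smul f ℤ ℤ c x } : M →ₗ[ℤ] N) hf h

theorem finrank_int_eq_of_bijective {M N : Type*} [AddCommGroup M] [AddCommGroup N]
    [Module ℤ M] [Module ℤ N] (f : M →+ N) (hf : Function.Bijective f) :
    Module.finrank ℤ M = Module.finrank ℤ N :=
  (LinearEquiv.ofBijective
    ({ f with map_smul' := fun c x => map_intCast_smul f ℤ ℤ c x } : M →ₗ[ℤ] N) hf).finrank_eq

/-- The chain of surjections `ℤ ^ n → ℤ[Y]/(Φ_m) ⊗ ℤ[X]/(…) → ℤ[X, Y]/(…) → N → ℤ ^ n` with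
`n = φ (m) φ (p ^ α)` consists of isomorphisms. -/
theorem nonInducedRing_equiv {k : Type u} [Field k] {G : Type v} [Group G] [Finite G] [IsCyclic G]
    {p α m : ℕ} (hp : p.Prime) (hchar : CharP k p ∨ α = 0) (hcard : Nat.card G = m * p ^ α)
    {ζ : k} (hζ : IsPrimitiveRoot ζ m) :
    Nonempty (NonInducedRing k G ≃+* CyclotomicQuotient m ⊗[ℤ] QuantumQuotient p α) ∧
      Nonempty (NonInducedRing k G ≃+* CombinedQuotient m p α) ∧
      Module.finrank ℤ (NonInducedRing k G) = m.totient * (p ^ α).totient := by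
  classical
  obtain ⟨g, hg⟩ := IsCyclic.exists_generator (α := G)
  obtain ⟨s, hs, hspan⟩ := exists_span_quantumQuotient hp α
  obtain ⟨f₁, hf₁⟩ := exists_tensor_hom_surjective m p α
  obtain ⟨f₂, hf₂⟩ := RepRing.exists_combinedQuotient_surjective hg hp hchar hcard hζ
  obtain ⟨f₃, hf₃⟩ := RepRing.exists_blockSum_surjective hg hp hchar hcard hζ
  obtain ⟨_, _, hrank⟩ := free_finite_cyclotomicQuotient m
  let L : (s → ℤ) →ₗ[ℤ] QuantumQuotient p α := Fintype.linearCombination ℤ (fun i : s => i.1)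
  have hL : Function.Surjective L := by
    rw [← LinearMap.range_eq_top, Fintype.range_linearCombination, Subtype.range_coe_subtype]
    exact hspan
  let e₀ := TensorProduct.piScalarRight ℤ ℤ (CyclotomicQuotient m) s
  let f₀ : (s → CyclotomicQuotient m) →+ CyclotomicQuotient m ⊗[ℤ] QuantumQuotient p α :=
    (L.lTensor (CyclotomicQuotient m) ∘ₗ e₀.symm.toLinearMap).toAddMonoidHom
  have hf₀ : Function.Surjective f₀ := (LinearMap.lTensor_surjective _ hL).comp e₀.symm.surjective
  let f := f₃.comp (f₂.toAddMonoidHom.comp (f₁.toAddMonoidHom.comp f₀))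
  have hf : Function.Surjective f := hf₃.comp (hf₂.comp (hf₁.comp hf₀))
  have hrank' : Module.finrank ℤ ({r // r ∈ (Finset.Ico 1 (1 + p ^ α)).filter (p ^ α).Coprime} →
      CyclotomicQuotient m) = m.totient * (p ^ α).totient := by
    rw [Module.finrank_pi_fintype, Finset.sum_const, hrank, Finset.card_univ, Fintype.card_coe,
      Nat.filter_coprime_Ico_eq_totient, smul_eq_mul, mul_comm]
  have hfb : Function.Bijective f := by
    refine bijective_of_surjective_of_finrank_int_le f hf ?_
    rw [hrank', Module.finrank_pi_fintype, Finset.sum_const, hrank, Finset.card_univ,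
      Fintype.card_coe, smul_eq_mul, mul_comm]
    exact Nat.mul_le_mul_left _ hs
  have hb₁₀ : Function.Injective (f₂ ∘ (f₁ ∘ f₀)) := hfb.1.of_comp (f := f₃)
  have hb₃ : Function.Bijective f₃ :=
    ⟨hfb.1.of_comp_right (g := f₂ ∘ (f₁ ∘ f₀)) (hf₂.comp (hf₁.comp hf₀)), hf₃⟩
  have hb₂ : Function.Bijective f₂ := ⟨hb₁₀.of_comp_right (hf₁.comp hf₀), hf₂⟩
  have hb₁ : Function.Bijective f₁ :=
    ⟨(Function.Injective.of_comp hb₁₀).of_comp_right hf₀, hf₁⟩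
  let e₁ := RingEquiv.ofBijective f₁ hb₁
  let e₂ := RingEquiv.ofBijective f₂ hb₂
  exact ⟨⟨(e₁.trans e₂).symm⟩, ⟨e₂.symm⟩, (finrank_int_eq_of_bijective f₃ hb₃).trans hrank'⟩

theorem mainTheorem1 {k : Type u} [Field k] {G : Type v} [Group G] [Finite G] [IsCyclic G] :
    (∀ (p m α : ℕ), p.Prime → CharP k p → ¬ p ∣ m → Nat.card G = m * p ^ α →
      (∃ ζ : k, IsPrimitiveRoot ζ m) →
        Nonempty (NonInducedRing k G ≃+* CyclotomicQuotient m ⊗[ℤ] QuantumQuotient p α) ∧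
        Nonempty (NonInducedRing k G ≃+* CombinedQuotient m p α) ∧
        Module.finrank ℤ (NonInducedRing k G) = Nat.totient m * Nat.totient (p ^ α) ∧
        Module.finrank ℤ (NonInducedRing k G) = Nat.totient (Nat.card G)) ∧
    (CharZero k → (∃ ζ : k, IsPrimitiveRoot ζ (Nat.card G)) →
      Module.finrank ℤ (NonInducedRing k G) = Nat.totient (Nat.card G)) := by
  refine ⟨fun p m α hp hk hpm hcard ⟨ζ, hζ⟩ => ?_, fun _ ⟨ζ, hζ⟩ => ?_⟩
  · obtain ⟨h1, h2, h3⟩ := nonInducedRing_equiv hp (.inl hk) hcard hζ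
    refine ⟨h1, h2, h3, ?_⟩
    rw [h3, hcard, Nat.totient_mul]
    exact (((Nat.Prime.coprime_iff_not_dvd hp).2 hpm).pow_left α).symm
  · -- for `α = 0` the prime plays no role
    have h := (nonInducedRing_equiv (k := k) (G := G) Nat.prime_two (α := 0) (.inr rfl)
      (m := Nat.card G) (by rw [pow_zero, mul_one]) hζ).2.2
    rwa [pow_zero, Nat.totient_one, mul_one] at h
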